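/- Let $d\ge 1$, put $a=[d/2]+1$ and let $K,M$ be constants. For a locally integrable $f:\mathbb R^d\to\mathbb C$ set $\|f\|_{\mathrm{BMO}}=\sup_Q\big(\frac1{|Q|}\int_Q|f-f_Q|^2\big)^{1/2}$, where $Q$ runs over all cubes with sides parallel to the axes and $f_Q=\frac1{|Q|}\int_Q f$. Let $X$ be the space of measurable $f:\mathbb R^d\to\mathbb C$ with $\int_{\mathbb R^d}|f(x)|^2(1+|x|)^{-2a}\,dx<\infty$. Then every locally integrable $f$ with $\|f\|_{\mathrm{BMO}}<\infty$ belongs to $X$, and there are constants $C_1,C_2>0$, depending only on $d,K,M$, with the following property. Let $\{\psi_n\}_{n\in\mathbb Z}$ be complex-valued functions on $\mathbb R^d$ with $|\psi_n|\le M$, having weak derivatives $D^\alpha\psi_n$ for all multi-indices $|\alpha|\le a$, such that 1) $\sum_{n\in\mathbb Z}\psi_n(x)=1$ for all $x\ne0$; 2) $\psi_n(x)=0$ unless $2^{n-1}\le|x|<2^{n+1}$; 3) $\big(2^{-nd}\int|D^\alpha\psi_n(\xi)|^2\,d\xi\big)^{1/2}\le K\,2^{-n|\alpha|}$ for all $n\in\mathbb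 Z$ and $0\le|\alpha|\le a$. For $f\in X$ let $\Delta_nf$ be the convolution of $f$ with the inverse Fourier transform of $\psi_n$ (Fourier transform $\hat g(\xi)=\int g(x)e^{-2\pi i x\cdot\xi}dx$), and put $$\|f\|_D=\sup_Q\Big(\frac1{|Q|}\int_Q\sum_{n:\,2^{-n}\le l(Q)}|\Delta_nf(x)|^2\,dx\Big)^{1/2},$$ where $l(Q)$ is the edge length of $Q$. Then for every $f\in X$ one has $\widehat{\Delta_nf}=\psi_n\hat f$ for all $n$, in the sense that $\int\Delta_nf\,\hat\varphi=\int f\,\widehat{\psi_n\varphi}$ for all Schwartz functions $\varphi$, with absolutely convergent integrals, and, as an inequality in $[0,\infty]$, $$C_1\|f\|_D\le\|f\|_{\mathrm{BMO}}\le C_2\|f\|_D .$$ In particular, a function $f\in X$ is in $\mathrm{BMO}$ if and only if $\|f\|_D<\infty$. -/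

import Mathlib

open MeasureTheory
open scoped ENNReal NNReal FourierTransform SchwartzMap

namespace LittlewoodPaleyBMO

/-- The classical partial derivative `D^α φ` for a multi-index `α`: the iterated Fréchet derivative
of order `|α|`, applied to the list of directions in which `e_i` occurs `α i` times. -/
noncomputable def partialDeriv {d : ℕ} (α : Fin d → ℕ)
    (φ : EuclideanSpace ℝ (Fin d) → ℝ) (x : EuclideanSpace ℝ (Fin d)) : ℝ :=
  iteratedFDeriv ℝ (∑ i, α i) φ x
    (fun k => EuclideanSpace.single (finSigmaFinEquiv.symm k).1 (1 : ℝ))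

/-- `v` is the weak derivative `D^α u` on `ℝ^d`. -/
def HasWeakDeriv {d : ℕ} (α : Fin d → ℕ) (u v : EuclideanSpace ℝ (Fin d) → ℂ) : Prop :=
  LocallyIntegrable u ∧ LocallyIntegrable v ∧
    ∀ φ : EuclideanSpace ℝ (Fin d) → ℝ, ContDiff ℝ (⊤ : ℕ∞) φ → HasCompactSupport φ →
      ∫ x, (partialDeriv α φ x : ℂ) * u x = (-1 : ℂ) ^ (∑ i, α i) * ∫ x, (φ x : ℂ) * v x

/-- The number of derivatives, `a = [d/2] + 1`. -/
def order (d : ℕ) : ℕ := d / 2 + 1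

/-- The conditions on the symbols `ψ_n`, with uniform bound `M` and constant `K`. -/
structure IsSymbolSystem (d : ℕ) (K M : ℝ)
    (ψ : ℤ → EuclideanSpace ℝ (Fin d) → ℂ) : Prop where
  bounded : ∀ n x, ‖ψ n x‖ ≤ M
  sum_eq_one : ∀ x, x ≠ 0 → HasSum (fun n => ψ n x) 1
  support_subset : ∀ n, Function.support (ψ n) ⊆
    {x | (2 : ℝ) ^ (n - 1) ≤ ‖x‖ ∧ ‖x‖ < (2 : ℝ) ^ (n + 1)}
  weakDeriv : ∀ n, ∀ α : Fin d → ℕ, ∑ i, α i ≤ order d →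
    ∃ v : EuclideanSpace ℝ (Fin d) → ℂ, HasWeakDeriv α (ψ n) v ∧
      (ENNReal.ofReal ((2 : ℝ) ^ (-(n * d))) * ∫⁻ ξ, ‖v ξ‖ₑ ^ 2) ^ (1 / 2 : ℝ) ≤
        ENNReal.ofReal (K * (2 : ℝ) ^ (-(n * ∑ i, (α i : ℤ))))

/-- The measurable functions `f` on `ℝ^d` with `∫ |f(x)|² (1 + |x|)^(-2a) dx < ∞`. -/
def MemWeighted {d : ℕ} (f : EuclideanSpace ℝ (Fin d) → ℂ) : Prop :=
  AEStronglyMeasurable f ∧ ∫⁻ x, ‖f x‖ₑ ^ 2 / ENNReal.ofReal ((1 + ‖x‖) ^ (2 * order d)) < ⊤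

/-- The operator with symbol `m`: convolution with the inverse Fourier transform of `m`. -/
noncomputable def multiplier {d : ℕ} (m f : EuclideanSpace ℝ (Fin d) → ℂ)
    (x : EuclideanSpace ℝ (Fin d)) : ℂ :=
  ∫ y, 𝓕⁻ m (x - y) * f y

/-- `ĝ = m · f̂` in the sense of tempered distributions: `∫ g φ̂ = ∫ f (m φ)^` for every Schwartz
function `φ`, where both integrals converge absolutely and so does the one that defines
`(m φ)^`. -/
def FourierEq {d : ℕ} (m f g : EuclideanSpace ℝ (Fin d) → ℂ) : Prop :=
  ∀ φ : 𝓢(EuclideanSpace ℝ (Fin d), ℂ),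
    Integrable (fun ξ => m ξ * φ ξ) ∧
    Integrable (fun x => g x * 𝓕 (fun ξ => φ ξ) x) ∧
    Integrable (fun x => f x * 𝓕 (fun ξ => m ξ * φ ξ) x) ∧
    ∫ x, g x * 𝓕 (fun ξ => φ ξ) x = ∫ x, f x * 𝓕 (fun ξ => m ξ * φ ξ) x

/-- The closed cube with centre `c` and edge length `l`. -/
def cube {d : ℕ} (c : EuclideanSpace ℝ (Fin d)) (l : ℝ) : Set (EuclideanSpace ℝ (Fin d)) :=
  {x | ∀ i, |x i - c i| ≤ l / 2}

/-- `‖f‖_BMO = sup_Q (|Q|⁻¹ ∫_Q |f - f_Q|²)^(1/2)`; used for locally integrable `f` only. -/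
noncomputable def bmoNorm {d : ℕ} (f : EuclideanSpace ℝ (Fin d) → ℂ) : ℝ≥0∞ :=
  ⨆ (c : EuclideanSpace ℝ (Fin d)) (l : ℝ) (_ : 0 < l),
    ((volume (cube c l))⁻¹ *
      ∫⁻ x in cube c l, ‖f x - ⨍ y in cube c l, f y‖ₑ ^ 2) ^ (1 / 2 : ℝ)

/-- `‖f‖_D = sup_Q (|Q|⁻¹ ∫_Q ∑_{2^(-n) ≤ l(Q)} |Δ_n f|²)^(1/2)`. -/
noncomputable def dNorm {d : ℕ} (ψ : ℤ → EuclideanSpace ℝ (Fin d) → ℂ)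
    (f : EuclideanSpace ℝ (Fin d) → ℂ) : ℝ≥0∞ :=
  ⨆ (c : EuclideanSpace ℝ (Fin d)) (l : ℝ) (_ : 0 < l),
    ((volume (cube c l))⁻¹ *
      ∫⁻ x in cube c l, ∑' n : {n : ℤ // (2 : ℝ) ^ (-n) ≤ l},
        ‖multiplier (ψ n) f x‖ₑ ^ 2) ^ (1 / 2 : ℝ)

end LittlewoodPaleyBMO

/-!
Write `a = order d`, so that `d < 2a ≤ d + 2`, and let `k_n` be the inverse Fourier transform of
`ψ_n`.

**Kernels.** Plancherel's identity turns the bound for the weak derivatives of order `a` into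
`∫ |x|^{2a} |k_n|² ≤ C 2^{n(d - 2a)}` (`IsSymbolSystem.lintegral_pow_mul_kernel_le`). Hence `k_n` is
integrable, and its integral is `ψ_n(0) = 0`. The weight `(1 + |x|)^{2a}` for the kernels is dual to
the one that defines the space `X`, so the convolutions with `f ∈ X` converge absolutely, and
Fubini's theorem gives the identity on the Fourier side (`fourierEq_multiplier`).

**Weighted means.** The averages of a function of bounded mean oscillation over the dilates `2^k Q`
drift at most linearly in `k`, while the weight `(1 + |x|)^{-2a}` beats the volume of `2^k Q` by a
factor `2^{-k}`. This gives membership in `X` (`memWeighted_of_bmoNorm_lt_top`) and a weighted bound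
for `f - f_Q` at every scale (`lintegral_sub_average_mul_decay_le`).

**The bound `‖f‖_D ≤ C ‖f‖_BMO`** (`dNorm_le_mul_bmoNorm`). Since the kernels have mean zero, `f`
may be replaced on a cube `Q` by `f - f_{2Q}`. The part inside `2Q` is treated with the `L²` bound
for the square function, at most two symbols being nonzero at any frequency. For the part outside
`2Q`, the Cauchy–Schwarz inequality with weight `|x - y|^{2a}` bounds its contribution to
`|Δ_n f|²` on `Q` by `C (2^n l(Q))^{-1} ‖f‖_BMO²`, which can be summed over `2^{-n} ≤ l(Q)`.

**The bound `‖f‖_BMO ≤ C ‖f‖_D`** (`bmoNorm_le_mul_dNorm`). Let `h` be the complex conjugate of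
`(f - f_Q) 1_Q`. Then `∫ f h = ∫ |h|²`. With smooth cutoffs at the frequencies `2^j`, `h` is
decomposed into bands `h_j`, whose Fourier transforms are smooth functions supported where
`2^j ≤ |ξ| ≤ 2^{j+2}`. As the symbols add up to one, `∫ f h_j` is a sum of three integrals
`∫ Δ_{j+i} f · h_j` (`integral_mul_band_eq`). The bands sum to `h` weakly against `X`: the high
frequencies converge because `f` is locally square integrable and the kernels of the cutoffs decay
rapidly off `2Q`
(`tendsto_integral_mul_lowPass_atTop`), and the low frequencies vanish because `∫ h = 0`
(`tendsto_integral_mul_lowPass_neg`). If `2^{-j} ≤ l(Q)`, up to a factor two, the product is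
integrated over `2Q` with the inequality `xy ≤ t x² + t⁻¹ y²` and Plancherel's identity. Elsewhere
the smoothness of the cutoffs and `∫ h = 0` give
`|h_j(x)| ≤ C min(2^j l(Q), (2^j l(Q))^{-1}) 2^{jd} (1 + 2^j |x - c|)^{-2a} ‖h‖₁` (`norm_band_le`),
while the quadratic means of `Δ_{j+i} f` over cubes of edge at least `2^{-j}` are at most `‖f‖_D`,
so that the sum over `j` is geometric. For a large `t`, the resulting multiple of `∫ |h|²` is
absorbed in the left hand side.
-/

namespace LittlewoodPaleyBMO

/-! ### The Fourier integral on `L¹ ∩ L²` -/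

lemma memLp_two_of_lintegral {X : Type*} [MeasurableSpace X] {μ : Measure X} {u : X → ℂ}
    (hu : AEStronglyMeasurable u μ)
    (h : ∫⁻ x, ‖u x‖ₑ ^ 2 ∂μ < ⊤) : MemLp u 2 μ := by
  refine ⟨hu, ?_⟩
  rw [eLpNorm_lt_top_iff_lintegral_rpow_enorm_lt_top (by norm_num) (by norm_num)]
  simpa using h

lemma lintegral_enorm_sq_lt_top {X : Type*} [MeasurableSpace X] {μ : Measure X} {u : X → ℂ}
    (hu : MemLp u 2 μ) :
    ∫⁻ x, ‖u x‖ₑ ^ 2 ∂μ < ⊤ := by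
  have := hu.2
  rw [eLpNorm_lt_top_iff_lintegral_rpow_enorm_lt_top (by norm_num) (by norm_num)] at this
  simpa using this

section Fourier

variable {V : Type*} [NormedAddCommGroup V] [InnerProductSpace ℝ V] [FiniteDimensional ℝ V]
  [MeasurableSpace V] [BorelSpace V]

lemma continuous_fourier {u : V → ℂ} (h1 : Integrable u) : Continuous (𝓕 u) :=
  VectorFourier.fourierIntegral_continuous Real.continuous_fourierChar
    (by exact continuous_inner) h1

lemma continuous_fourierInv {u : V → ℂ} (h1 : Integrable u) : Continuous (𝓕⁻ u) := by
  have : 𝓕⁻ u = fun x => 𝓕 u (-x) := by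
    ext x; exact Real.fourierInv_eq_fourier_neg u x
  rw [this]
  exact (continuous_fourier h1).comp continuous_neg

lemma integral_fourier_mul {u v : V → ℂ} (hu : Integrable u) (hv : Integrable v) :
    ∫ ξ, 𝓕 u ξ * v ξ = ∫ x, u x * 𝓕 v x := by
  have := VectorFourier.integral_fourierIntegral_smul_eq_flip (L := innerₗ V)
    (μ := volume) (ν := volume) Real.continuous_fourierChar (by exact continuous_inner) hu hv
  simpa using! this

lemma integral_fourierInv_mul {u v : V → ℂ} (hu : Integrable u) (hv : Integrable v) :
    ∫ ξ, 𝓕⁻ u ξ * v ξ = ∫ x, u x * 𝓕⁻ v x := by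
  simp_rw [Real.fourierInv_eq_fourier_comp_neg u, Real.fourierInv_eq_fourier_neg v]
  rw [integral_fourier_mul hu.comp_neg hv, ← integral_neg_eq_self]
  simp

/-- The Fourier integral of a function in `L¹ ∩ L²` represents its `L²` Fourier transform. -/
lemma fourier_toLp_ae_eq {u : V → ℂ} (h1 : Integrable u) (h2 : MemLp u 2) :
    (𝓕 (h2.toLp u) : Lp ℂ 2 (volume : Measure V)) =ᵐ[volume] 𝓕 u := by
  -- Both sides are tested against smooth functions of compact support; on the left the transform
  -- is moved onto the test function as for tempered distributions.
  refine ae_eq_of_integral_contDiff_smul_eq ((Lp.memLp _).locallyIntegrable (by norm_num))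
    (continuous_fourier h1).locallyIntegrable fun g hg hgc => ?_
  have hg₁ : HasCompactSupport (Complex.ofRealCLM ∘ g) := hgc.comp_left rfl
  have hg₂ : ContDiff ℝ (⊤ : ℕ∞) (Complex.ofRealCLM ∘ g) := by fun_prop
  set G : 𝓢(V, ℂ) := hg₁.toSchwartzMap hg₂ with hG
  have hGg : ∀ x, G x = (g x : ℂ) := fun x => rfl
  have e1 : ∫ x, g x • (𝓕 (h2.toLp u) : Lp ℂ 2 (volume : Measure V)) x
      = ((𝓕 (h2.toLp u) : Lp ℂ 2 (volume : Measure V)) : 𝓢'(V, ℂ)) G := by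
    rw [Lp.toTemperedDistribution_apply]
    simp [hGg]
  rw [e1, ← Lp.fourier_toTemperedDistribution_eq]
  have e2 : (𝓕 ((h2.toLp u : Lp ℂ 2 (volume : Measure V)) : 𝓢'(V, ℂ))) G
      = ((h2.toLp u : Lp ℂ 2 (volume : Measure V)) : 𝓢'(V, ℂ)) (𝓕 G) := rfl
  rw [e2, Lp.toTemperedDistribution_apply]
  have e3 : ∫ x, (𝓕 G) x • (h2.toLp u) x = ∫ x, 𝓕 (G : V → ℂ) x * u x := by
    refine integral_congr_ae ?_
    filter_upwards [h2.coeFn_toLp] with x hx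
    rw [hx]; rfl
  rw [e3, integral_fourier_mul G.integrable h1]
  simp [hGg]

lemma memLp_fourier {u : V → ℂ} (h1 : Integrable u) (h2 : MemLp u 2) : MemLp (𝓕 u) 2 :=
  (memLp_congr_ae (fourier_toLp_ae_eq h1 h2)).1 (Lp.memLp _)

/-- Parseval's identity for the Fourier integral on `L¹ ∩ L²`. -/
lemma integral_conj_fourier_mul_fourier {u v : V → ℂ} (hu : Integrable u) (hu2 : MemLp u 2)
    (hv : Integrable v) (hv2 : MemLp v 2) :
    ∫ ξ, starRingEnd ℂ (𝓕 u ξ) * 𝓕 v ξ = ∫ x, starRingEnd ℂ (u x) * v x := by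
  have h := Lp.inner_fourier_eq (hu2.toLp u) (hv2.toLp v)
  rw [L2.inner_def, L2.inner_def] at h
  have e1 : ∫ ξ, starRingEnd ℂ (𝓕 u ξ) * 𝓕 v ξ
      = ∫ ξ, inner ℂ ((𝓕 (hu2.toLp u) : Lp ℂ 2 (volume : Measure V)) ξ)
        ((𝓕 (hv2.toLp v) : Lp ℂ 2 (volume : Measure V)) ξ) := by
    refine integral_congr_ae ?_
    filter_upwards [fourier_toLp_ae_eq hu hu2, fourier_toLp_ae_eq hv hv2] with x h1 h2
    rw [h1, h2, RCLike.inner_apply, mul_comm]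
  have e2 : ∫ ξ, starRingEnd ℂ (u ξ) * v ξ
      = ∫ ξ, inner ℂ ((hu2.toLp u : Lp ℂ 2 (volume : Measure V)) ξ)
        ((hv2.toLp v : Lp ℂ 2 (volume : Measure V)) ξ) := by
    refine integral_congr_ae ?_
    filter_upwards [hu2.coeFn_toLp, hv2.coeFn_toLp] with x h1 h2
    rw [h1, h2, RCLike.inner_apply, mul_comm]
  rw [e1, e2, h]

lemma lintegral_enorm_sq_eq_eLpNorm {u : V → ℂ} :
    ∫⁻ x, ‖u x‖ₑ ^ 2 = eLpNorm u 2 volume ^ 2 := by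
  rw [eLpNorm_eq_lintegral_rpow_enorm_toReal (by norm_num) (by norm_num)]
  rw [← ENNReal.rpow_natCast, ← ENNReal.rpow_mul]
  simp

/-- Plancherel's identity for the Fourier integral on `L¹ ∩ L²`. -/
lemma lintegral_enorm_fourier_sq {u : V → ℂ} (h1 : Integrable u) (h2 : MemLp u 2) :
    ∫⁻ ξ, ‖𝓕 u ξ‖ₑ ^ 2 = ∫⁻ x, ‖u x‖ₑ ^ 2 := by
  rw [lintegral_enorm_sq_eq_eLpNorm, lintegral_enorm_sq_eq_eLpNorm,
    ← eLpNorm_congr_ae (fourier_toLp_ae_eq h1 h2), ← eLpNorm_congr_ae h2.coeFn_toLp]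
  have := Lp.norm_fourier_eq (h2.toLp u)
  rw [Lp.norm_def, Lp.norm_def] at this
  rw [(ENNReal.toReal_eq_toReal_iff' (Lp.eLpNorm_ne_top _) (Lp.eLpNorm_ne_top _)).1 this]

lemma lintegral_enorm_fourierInv_sq {u : V → ℂ} (h1 : Integrable u) (h2 : MemLp u 2) :
    ∫⁻ ξ, ‖𝓕⁻ u ξ‖ₑ ^ 2 = ∫⁻ x, ‖u x‖ₑ ^ 2 := by
  rw [← lintegral_enorm_fourier_sq h1 h2, ← lintegral_neg_eq_self]
  simp [Real.fourierInv_eq_fourier_neg]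

lemma memLp_fourierInv {u : V → ℂ} (h1 : Integrable u) (h2 : MemLp u 2) : MemLp (𝓕⁻ u) 2 :=
  memLp_two_of_lintegral (continuous_fourierInv h1).aestronglyMeasurable
    (by rw [lintegral_enorm_fourierInv_sq h1 h2]; exact lintegral_enorm_sq_lt_top h2)

lemma fourierInv_conj (w : V → ℂ) (ξ : V) :
    𝓕⁻ (fun x => starRingEnd ℂ (w x)) ξ = starRingEnd ℂ (𝓕 w ξ) := by
  rw [Real.fourierInv_eq', Real.fourier_eq', ← integral_conj]
  congr 1
  ext v
  simp only [smul_eq_mul, map_mul, ← Complex.exp_conj]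
  simp [Complex.conj_ofNat]

/-- The translate of an inverse Fourier integral is the one of the modulated function. -/
lemma fourierInv_translate (m : V → ℂ) (x y : V) :
    𝓕⁻ m (x - y) =
      𝓕⁻ (fun ξ => Complex.exp (↑(-2 * Real.pi * inner ℝ ξ y) * Complex.I) * m ξ) x := by
  rw [Real.fourierInv_eq', Real.fourierInv_eq']
  congr 1
  ext v
  rw [smul_eq_mul, smul_eq_mul, ← mul_assoc, ← Complex.exp_add]
  congr 2
  rw [inner_sub_right]
  push_cast
  ring

lemma integrable_exp_mul {m : V → ℂ} (hm : Integrable m) (y : V) :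
    Integrable (fun ξ => Complex.exp (↑(-2 * Real.pi * inner ℝ ξ y) * Complex.I) * m ξ) := by
  refine hm.bdd_mul (c := 1) (Continuous.aestronglyMeasurable (by fun_prop)) ?_
  filter_upwards with ξ
  rw [Complex.norm_exp_ofReal_mul_I]

/-- Convolution of `g` with the inverse Fourier integral of `m` is multiplication by `m` on the
Fourier side. -/
lemma integral_fourierInv_sub_mul {m g : V → ℂ} (hm : Integrable m) (hg : Integrable g) (x : V) :
    ∫ y, 𝓕⁻ m (x - y) * g y = 𝓕⁻ (fun ξ => m ξ * 𝓕 g ξ) x := by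
  have h1 : ∀ y, 𝓕⁻ m (x - y)
      = 𝓕 (fun ξ => Complex.exp (↑(-2 * Real.pi * inner ℝ ξ (-x)) * Complex.I) * m ξ) y := by
    intro y
    rw [show x - y = -y - (-x) by abel, fourierInv_translate, Real.fourierInv_eq_fourier_neg,
      neg_neg]
  simp_rw [h1]
  rw [integral_fourier_mul (integrable_exp_mul hm _) hg, Real.fourierInv_eq']
  congr 1
  ext ξ
  simp [mul_assoc]

lemma integral_fourier_sub_mul {m g : V → ℂ} (hm : Integrable m) (hg : Integrable g) (x : V) :
    ∫ y, 𝓕 m (x - y) * g y = 𝓕 (fun ξ => m ξ * 𝓕⁻ g ξ) x := by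
  have h := integral_fourierInv_sub_mul hm.comp_neg hg x
  rw [show (fun ξ => m (-ξ) * 𝓕 g ξ) = fun ξ => (fun ξ => m ξ * 𝓕⁻ g ξ) (-ξ) by
    ext ξ; simp [Real.fourierInv_eq_fourier_neg]] at h
  rw [Real.fourierInv_eq_fourier_comp_neg, Real.fourierInv_eq_fourier_comp_neg] at h
  simpa using h

/-- The Fourier integral of `m φ`, with `φ` Schwartz, is the correlation of `φ̂` with the inverse
Fourier integral of `m`. -/
lemma fourier_mul_schwartz {m : V → ℂ} (hm : Integrable m) (φ : 𝓢(V, ℂ)) (y : V) :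
    𝓕 (fun ξ => m ξ * φ ξ) y = ∫ x, 𝓕 (fun ξ => φ ξ) x * 𝓕⁻ m (x - y) := by
  simp_rw [fourierInv_translate]
  have h := integral_fourierInv_mul (u := ((𝓕 φ : 𝓢(V, ℂ)) : V → ℂ)) (𝓕 φ).integrable
    (integrable_exp_mul hm y)
  have e : 𝓕⁻ ((𝓕 φ : 𝓢(V, ℂ)) : V → ℂ) = φ := by
    rw [← SchwartzMap.fourierInv_coe]
    simp
  rw [e] at h
  refine Eq.trans ?_ h
  rw [Real.fourier_eq']
  congr 1
  ext ξ
  rw [smul_eq_mul]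
  push_cast
  ring

end Fourier

/-! ### Cubes and decay profiles -/

section Cubes

variable {d : ℕ}

lemma abs_apply_le_norm (x : EuclideanSpace ℝ (Fin d)) (i : Fin d) : |x i| ≤ ‖x‖ := by
  simpa using PiLp.norm_apply_le x i

lemma norm_le_sum_abs (x : EuclideanSpace ℝ (Fin d)) : ‖x‖ ≤ ∑ i, |x i| := by
  rw [EuclideanSpace.norm_eq]
  refine Real.sqrt_le_iff.2 ⟨Finset.sum_nonneg fun i _ => abs_nonneg _, ?_⟩
  simpa using Finset.sum_sq_le_sq_sum_of_nonneg (s := Finset.univ) (f := fun i => |x i|)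
    (fun i _ => abs_nonneg _)

lemma cube_eq_preimage (c : EuclideanSpace ℝ (Fin d)) (l : ℝ) :
    cube c l = (WithLp.ofLp : EuclideanSpace ℝ (Fin d) → Fin d → ℝ) ⁻¹'
      (Set.Icc (fun i => c i - l / 2) (fun i => c i + l / 2)) := by
  ext x
  simp only [cube, Set.mem_ofPred_eq, Set.mem_preimage, Set.mem_Icc, Pi.le_def, abs_le]
  constructor
  · intro h
    exact ⟨fun i => by linarith [(h i).1], fun i => by linarith [(h i).2]⟩
  · intro h i
    exact ⟨by linarith [h.1 i], by linarith [h.2 i]⟩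

lemma measurableSet_cube (c : EuclideanSpace ℝ (Fin d)) (l : ℝ) : MeasurableSet (cube c l) := by
  rw [cube_eq_preimage]
  exact measurableSet_Icc.preimage (PiLp.volume_preserving_ofLp (Fin d)).measurable

lemma volume_cube (c : EuclideanSpace ℝ (Fin d)) (l : ℝ) :
    volume (cube c l) = ENNReal.ofReal l ^ d := by
  rw [cube_eq_preimage, (PiLp.volume_preserving_ofLp (Fin d)).measure_preimage
    measurableSet_Icc.nullMeasurableSet, Real.volume_Icc_pi]
  simp

lemma volume_cube_ne_top (c : EuclideanSpace ℝ (Fin d)) (l : ℝ) :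
    volume (cube c l) ≠ ⊤ := by
  rw [volume_cube c l]
  exact ENNReal.pow_ne_top ENNReal.ofReal_ne_top

lemma volume_cube_ne_zero (c : EuclideanSpace ℝ (Fin d)) {l : ℝ} (hl : 0 < l) :
    volume (cube c l) ≠ 0 := by
  rw [volume_cube c l]
  exact pow_ne_zero _ (by simpa using hl)

lemma norm_sub_le_of_mem_cube {c x : EuclideanSpace ℝ (Fin d)} {l : ℝ} (hx : x ∈ cube c l) :
    ‖x - c‖ ≤ d * (l / 2) := by
  refine (norm_le_sum_abs _).trans ?_
  calc ∑ i, |(x - c) i| ≤ ∑ _i : Fin d, l / 2 := Finset.sum_le_sum fun i _ => by simpa using hx i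
    _ = d * (l / 2) := by simp

lemma lt_norm_sub_of_notMem_cube {c x : EuclideanSpace ℝ (Fin d)} {l : ℝ} (hx : x ∉ cube c l) :
    l / 2 < ‖x - c‖ := by
  simp only [cube, Set.mem_ofPred_eq, not_forall, not_le] at hx
  obtain ⟨i, hi⟩ := hx
  exact hi.trans_le (by simpa using abs_apply_le_norm (x - c) i)

lemma cube_subset_cube {c c' : EuclideanSpace ℝ (Fin d)} {l l' : ℝ}
    (h : ∀ i, |c i - c' i| + l / 2 ≤ l' / 2) : cube c l ⊆ cube c' l' := by
  intro x hx i
  have := abs_sub_le (x i) (c i) (c' i)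
  linarith [hx i, h i]

lemma cube_mono (c : EuclideanSpace ℝ (Fin d)) {l l' : ℝ} (h : l ≤ l') : cube c l ⊆ cube c l' :=
  cube_subset_cube fun i => by simp; linarith

lemma cube_subset_closedBall (c : EuclideanSpace ℝ (Fin d)) (l : ℝ) :
    cube c l ⊆ Metric.closedBall c (d * (l / 2)) := fun _ hx => by
  rw [mem_closedBall_iff_norm]
  exact norm_sub_le_of_mem_cube hx

lemma isCompact_cube (c : EuclideanSpace ℝ (Fin d)) (l : ℝ) : IsCompact (cube c l) := by
  refine (isCompact_closedBall c (d * (l / 2))).of_isClosed_subset ?_ (cube_subset_closedBall c l)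
  rw [cube_eq_preimage]
  exact isClosed_Icc.preimage (PiLp.continuous_ofLp 2 _)

lemma exists_mem_cube_two_pow (c x : EuclideanSpace ℝ (Fin d)) {r : ℝ} (hr : 0 < r) :
    ∃ k : ℕ, x ∈ cube c (2 ^ k * r) := by
  obtain ⟨k, hk⟩ := pow_unbounded_of_one_lt (2 * ‖x - c‖ / r) (one_lt_two (α := ℝ))
  refine ⟨k, fun i => ?_⟩
  have h1 := abs_apply_le_norm (x - c) i
  rw [div_lt_iff₀ hr] at hk
  simp only [PiLp.sub_apply] at h1
  linarith

/-- The decay profile `(1 + |z| / r) ^ (-s)` at scale `r`. -/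
noncomputable def decay (s : ℕ) (r : ℝ) (z : EuclideanSpace ℝ (Fin d)) : ℝ :=
  ((1 + ‖z‖ / r) ^ s)⁻¹

lemma decay_pos (s : ℕ) {r : ℝ} (hr : 0 < r) (z : EuclideanSpace ℝ (Fin d)) : 0 < decay s r z := by
  unfold decay; positivity

lemma decay_le_one (s : ℕ) {r : ℝ} (hr : 0 < r) (z : EuclideanSpace ℝ (Fin d)) :
    decay s r z ≤ 1 := by
  unfold decay
  refine inv_le_one_of_one_le₀ (one_le_pow₀ ?_)
  have : 0 ≤ ‖z‖ / r := by positivity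
  linarith

lemma continuous_decay (s : ℕ) {r : ℝ} (hr : 0 < r) :
    Continuous (decay s r : EuclideanSpace ℝ (Fin d) → ℝ) := by
  unfold decay
  refine Continuous.inv₀ (by fun_prop) fun z => ?_
  positivity

lemma decay_le_mul_decay {s : ℕ} {r r' A : ℝ} {z z' : EuclideanSpace ℝ (Fin d)} (hr : 0 < r)
    (hr' : 0 < r') (h : 1 + ‖z'‖ / r' ≤ A * (1 + ‖z‖ / r)) :
    decay s r z ≤ A ^ s * decay s r' z' := by
  unfold decay
  rw [inv_le_comm₀ (by positivity) (by
    have : 0 < A := by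
      by_contra hA
      have h1 : 0 < 1 + ‖z'‖ / r' := by positivity
      have h2 : 0 < 1 + ‖z‖ / r := by positivity
      nlinarith
    positivity), mul_inv, inv_inv]
  have hA : 0 < A := by
    by_contra hA
    have h1 : 0 < 1 + ‖z'‖ / r' := by positivity
    have h2 : 0 < 1 + ‖z‖ / r := by positivity
    nlinarith
  rw [inv_mul_le_iff₀ (by positivity), ← mul_pow]
  gcongr

/-- The decay profile is dominated by a geometric sum over dyadically growing cubes. -/
lemma decay_le_tsum (s : ℕ) {r : ℝ} (hr : 0 < r) (c x : EuclideanSpace ℝ (Fin d)) :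
    ENNReal.ofReal (decay s r (x - c)) ≤
      4 ^ s * ∑' k : ℕ, ((2 : ℝ≥0∞) ^ (k * s))⁻¹ * (cube c (2 ^ k * r)).indicator 1 x := by
  classical
  have hex := exists_mem_cube_two_pow c x hr
  set k := Nat.find hex with hk
  have hmem : x ∈ cube c (2 ^ k * r) := Nat.find_spec hex
  refine le_trans ?_ (mul_le_mul_right (ENNReal.le_tsum k) _)
  rw [Set.indicator_of_mem hmem, Pi.one_apply, mul_one]
  have key : decay s r (x - c) ≤ 4 ^ s * (2 ^ (k * s))⁻¹ := by
    rcases Nat.eq_zero_or_pos k with h0 | h0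
    · rw [h0]
      refine (decay_le_one s hr _).trans ?_
      simpa using one_le_pow₀ (by norm_num : (1 : ℝ) ≤ 4)
    · have hlt : x ∉ cube c (2 ^ (k - 1) * r) := Nat.find_min hex (by omega)
      have h1 := lt_norm_sub_of_notMem_cube hlt
      unfold decay
      rw [pow_mul, ← inv_pow, ← inv_pow, ← mul_pow]
      gcongr
      rw [inv_le_comm₀ (by positivity) (by positivity), mul_inv, inv_inv]
      have h2 : (2 : ℝ) ^ k = 2 ^ (k - 1) * 2 := by rw [← pow_succ]; congr 1; omega
      have h3 : 2 ^ (k - 1) / 2 ≤ ‖x - c‖ / r := by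
        rw [le_div_iff₀ hr]; linarith
      rw [h2]; linarith
  calc ENNReal.ofReal (decay s r (x - c)) ≤ ENNReal.ofReal (4 ^ s * (2 ^ (k * s))⁻¹) :=
        ENNReal.ofReal_le_ofReal key
    _ = 4 ^ s * ((2 : ℝ≥0∞) ^ (k * s))⁻¹ := by
        rw [ENNReal.ofReal_mul (by positivity), ENNReal.ofReal_inv_of_pos (by positivity),
          ENNReal.ofReal_pow (by positivity), ENNReal.ofReal_pow (by positivity)]
        simp

/-- Integration against the decay profile, when the integrals over the cubes of edge `2 ^ k * r`
grow at most like `p k` times their volumes. -/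
lemma lintegral_mul_decay_le {s : ℕ} (hs : d + 1 ≤ s) {r : ℝ} (hr : 0 < r)
    (c : EuclideanSpace ℝ (Fin d)) {F : EuclideanSpace ℝ (Fin d) → ℝ≥0∞} (hF : AEMeasurable F)
    (B : ℝ≥0∞) (p : ℕ → ℝ≥0∞)
    (h : ∀ k : ℕ, ∫⁻ x in cube c (2 ^ k * r), F x ≤ B * p k * ENNReal.ofReal (2 ^ k * r) ^ d) :
    ∫⁻ x, F x * ENNReal.ofReal (decay s r (x - c)) ≤
      4 ^ s * (∑' k : ℕ, p k * (2⁻¹) ^ k) * B * ENNReal.ofReal r ^ d := by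
  calc ∫⁻ x, F x * ENNReal.ofReal (decay s r (x - c))
      ≤ ∫⁻ x, 4 ^ s * ∑' k : ℕ, ((2 : ℝ≥0∞) ^ (k * s))⁻¹ *
          (cube c (2 ^ k * r)).indicator F x := by
        refine lintegral_mono fun x => ?_
        refine (mul_le_mul_right (decay_le_tsum s hr c x) (F x)).trans (le_of_eq ?_)
        rw [mul_left_comm, ← ENNReal.tsum_mul_left]
        congr 2
        ext k
        by_cases hx : x ∈ cube c (2 ^ k * r)
        · rw [Set.indicator_of_mem hx, Set.indicator_of_mem hx, Pi.one_apply, mul_one, mul_comm]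
        · simp [hx]
    _ = 4 ^ s * ∑' k : ℕ, ((2 : ℝ≥0∞) ^ (k * s))⁻¹ * ∫⁻ x in cube c (2 ^ k * r), F x := by
        rw [lintegral_const_mul' _ _ (by finiteness), lintegral_tsum fun k =>
          (hF.indicator (measurableSet_cube _ _)).const_mul _]
        congr 2
        ext k
        rw [lintegral_const_mul' _ _ (by simp), lintegral_indicator (measurableSet_cube _ _)]
    _ ≤ 4 ^ s * ∑' k : ℕ, (p k * 2⁻¹ ^ k) * (B * ENNReal.ofReal r ^ d) := by
        refine mul_le_mul_right (ENNReal.tsum_le_tsum fun k => ?_) _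
        calc ((2 : ℝ≥0∞) ^ (k * s))⁻¹ * ∫⁻ x in cube c (2 ^ k * r), F x
            ≤ ((2 : ℝ≥0∞) ^ (k * (d + 1)))⁻¹ * (B * p k * ENNReal.ofReal (2 ^ k * r) ^ d) := by
              gcongr
              · norm_num
              · exact h k
          _ = (((2 : ℝ≥0∞) ^ (k * d))⁻¹ * 2 ^ (k * d)) *
                ((p k * 2⁻¹ ^ k) * (B * ENNReal.ofReal r ^ d)) := by
              rw [ENNReal.ofReal_mul (by positivity), ENNReal.ofReal_pow (by positivity), mul_pow,
                mul_add, pow_add, mul_one, ENNReal.mul_inv (by simp) (by simp), ← pow_mul,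
                ← ENNReal.inv_pow (n := k)]
              simp only [ENNReal.ofReal_ofNat]
              ring
          _ = _ := by rw [ENNReal.inv_mul_cancel (by simp) (by simp), one_mul]
    _ = _ := by rw [ENNReal.tsum_mul_right]; ring

lemma tsum_inv_two_pow : ∑' k : ℕ, (2⁻¹ : ℝ≥0∞) ^ k = 2 := by
  rw [ENNReal.tsum_geometric]
  simp

lemma lintegral_decay_le {s : ℕ} (hs : d + 1 ≤ s) {r : ℝ} (hr : 0 < r)
    (c : EuclideanSpace ℝ (Fin d)) :
    ∫⁻ x, ENNReal.ofReal (decay s r (x - c)) ≤ 4 ^ s * 2 * ENNReal.ofReal r ^ d := by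
  have := lintegral_mul_decay_le hs hr c (F := fun _ => 1) aemeasurable_const 1 (fun _ => 1)
    (fun k => by simp [volume_cube])
  simpa [tsum_inv_two_pow] using this

end Cubes

/-! ### Weak derivatives and the Fourier integral -/

section WeakDerivatives

variable {d : ℕ}

/-- The character `ξ ↦ e^{2πi x·ξ}`. -/
noncomputable def character (x ξ : EuclideanSpace ℝ (Fin d)) : ℂ :=
  Complex.exp (↑(2 * Real.pi * inner ℝ ξ x) * Complex.I)

lemma contDiff_character (x : EuclideanSpace ℝ (Fin d)) {n : WithTop ℕ∞} :
    ContDiff ℝ n (character x) := by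
  unfold character
  refine Complex.contDiff_exp.comp (ContDiff.mul ?_ contDiff_const)
  exact Complex.ofRealCLM.contDiff.comp
    (contDiff_const.mul (contDiff_id.inner ℝ contDiff_const))

lemma norm_character (x ξ : EuclideanSpace ℝ (Fin d)) : ‖character x ξ‖ = 1 :=
  Complex.norm_exp_ofReal_mul_I _

lemma fourierInv_eq_integral_character (m : EuclideanSpace ℝ (Fin d) → ℂ)
    (x : EuclideanSpace ℝ (Fin d)) : 𝓕⁻ m x = ∫ ξ, character x ξ * m ξ := by
  rw [Real.fourierInv_eq']; rfl

lemma fderiv_character (x ξ e : EuclideanSpace ℝ (Fin d)) :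
    fderiv ℝ (character x) ξ e = (2 * Real.pi * inner ℝ e x * Complex.I) * character x ξ := by
  have h1 : HasFDerivAt (fun ξ : EuclideanSpace ℝ (Fin d) => (2 * Real.pi) * inner ℝ ξ x)
      ((2 * Real.pi) • innerSL ℝ x) ξ := by
    have := ((innerSL ℝ x).hasFDerivAt (x := ξ)).const_mul (2 * Real.pi)
    simpa [real_inner_comm] using! this
  have h2 := ((Complex.ofRealCLM.hasFDerivAt.comp ξ h1).mul_const Complex.I).cexp
  have h3 : HasFDerivAt (character x) _ ξ := h2
  rw [h3.fderiv]
  simp [character, real_inner_comm]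
  ring

lemma iteratedFDeriv_character (x e : EuclideanSpace ℝ (Fin d)) (n : ℕ)
    (ξ : EuclideanSpace ℝ (Fin d)) :
    iteratedFDeriv ℝ n (character x) ξ (fun _ => e) =
      (2 * Real.pi * inner ℝ e x * Complex.I) ^ n * character x ξ := by
  induction n generalizing ξ with
  | zero => simp
  | succ n ih =>
    rw [iteratedFDeriv_succ_apply_left]
    have hdiff : DifferentiableAt ℝ (iteratedFDeriv ℝ n (character x)) ξ :=
      (contDiff_character x (n := (⊤ : ℕ∞))).differentiable_iteratedFDeriv
        (by exact_mod_cast ENat.natCast_lt_top n) ξ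
    have h1 : fderiv ℝ (iteratedFDeriv ℝ n (character x)) ξ e (Fin.tail fun _ => e)
        = fderiv ℝ (fun ξ => iteratedFDeriv ℝ n (character x) ξ (fun _ => e)) ξ e := by
      rw [fderiv_continuousMultilinear_apply_const_apply hdiff]
      rfl
    rw [h1]
    simp_rw [ih]
    rw [fderiv_const_mul ((contDiff_character x (n := 1)).differentiable (by norm_num) ξ)]
    rw [smul_apply, fderiv_character, smul_eq_mul, pow_succ]
    ring

lemma partialDeriv_single (i : Fin d) (a : ℕ) (φ : EuclideanSpace ℝ (Fin d) → ℝ)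
    (ξ : EuclideanSpace ℝ (Fin d)) :
    partialDeriv (Pi.single i a) φ ξ =
      iteratedFDeriv ℝ a φ ξ (fun _ => EuclideanSpace.single i (1 : ℝ)) := by
  have hidx : ∀ k : Fin (∑ j, (Pi.single i a : Fin d → ℕ) j), (finSigmaFinEquiv.symm k).1 = i := by
    intro k
    by_contra hne
    have h := (finSigmaFinEquiv.symm k).2.2
    simp [Pi.single_eq_of_ne hne] at h
  have hs : ∑ j, (Pi.single i a : Fin d → ℕ) j = a := by simp
  unfold partialDeriv
  simp_rw [hidx]
  rw [hs]

/-- A weak derivative vanishes almost everywhere off any closed set containing the support. -/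
lemma HasWeakDeriv.ae_eq_zero {α : Fin d → ℕ} {u v : EuclideanSpace ℝ (Fin d) → ℂ}
    (h : HasWeakDeriv α u v) {S : Set (EuclideanSpace ℝ (Fin d))} (hS : IsClosed S)
    (hu : ∀ x, x ∉ S → u x = 0) : ∀ᵐ x, x ∉ S → v x = 0 := by
  refine hS.isOpen_compl.ae_eq_zero_of_integral_contDiff_smul_eq_zero
    (h.2.1.locallyIntegrableOn _) fun g hg hgc hgS => ?_
  have h1 := h.2.2 g hg hgc
  have h2 : ∀ x, (partialDeriv α g x : ℂ) * u x = 0 := by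
    intro x
    by_cases hx : x ∈ S
    · have : iteratedFDeriv ℝ (∑ i, α i) g x = 0 := by
        by_contra hne
        exact hgS (support_iteratedFDeriv_subset _ hne) hx
      simp [partialDeriv, this]
    · simp [hu x hx]
  simp only [h2, integral_zero] at h1
  have h3 := (mul_eq_zero.1 h1.symm).resolve_left (pow_ne_zero _ (by norm_num))
  simpa using h3

lemma integrable_of_locallyIntegrable_of_ae {u : EuclideanSpace ℝ (Fin d) → ℂ}
    (hu : LocallyIntegrable u) {ρ : ℝ}
    (h0 : ∀ᵐ x, x ∉ Metric.closedBall (0 : EuclideanSpace ℝ (Fin d)) ρ → u x = 0) :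
    Integrable u :=
  (hu.integrableOn_isCompact (isCompact_closedBall 0 ρ)).integrable_of_ae_notMem_eq_zero h0

/-- The Fourier side of a pure weak derivative of a compactly supported function. -/
lemma HasWeakDeriv.fourierInv_eq {i : Fin d} {a : ℕ} {u v : EuclideanSpace ℝ (Fin d) → ℂ}
    (h : HasWeakDeriv (Pi.single i a) u v) {ρ : ℝ} (hρ : 0 < ρ)
    (hu : ∀ x, x ∉ Metric.closedBall 0 ρ → u x = 0) (x : EuclideanSpace ℝ (Fin d)) :
    (2 * Real.pi * x i * Complex.I) ^ a * 𝓕⁻ u x = (-1) ^ a * 𝓕⁻ v x := by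
  have hv0 := h.ae_eq_zero Metric.isClosed_closedBall hu
  have hui : Integrable u := integrable_of_locallyIntegrable_of_ae h.1 (.of_forall hu)
  have hvi : Integrable v := integrable_of_locallyIntegrable_of_ae h.2.1 hv0
  set c : ℂ := 2 * Real.pi * x i * Complex.I with hc
  let b : ContDiffBump (0 : EuclideanSpace ℝ (Fin d)) := ⟨ρ + 1, ρ + 2, by linarith, by linarith⟩
  -- The weak derivative is tested against the real and imaginary parts of the character,
  -- cut off away from the support.
  have key : ∀ L : ℂ →L[ℝ] ℝ, ∫ ξ, (L (c ^ a * character x ξ) : ℂ) * u ξ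
      = (-1) ^ a * ∫ ξ, (L (character x ξ) : ℂ) * v ξ := by
    intro L
    have hsm : ContDiff ℝ (⊤ : ℕ∞) (fun ξ => L (character x ξ)) :=
      L.contDiff.comp (contDiff_character x)
    have h1 := h.2.2 (fun ξ => b ξ * L (character x ξ)) (b.contDiff.mul hsm)
      (b.hasCompactSupport.mul_right)
    have hloc : ∀ ξ ∈ Metric.closedBall (0 : EuclideanSpace ℝ (Fin d)) ρ,
        partialDeriv (Pi.single i a) (fun ξ => b ξ * L (character x ξ)) ξ
          = L (c ^ a * character x ξ) := by
      intro ξ hξ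
      rw [partialDeriv_single]
      have heq : (fun ξ => b ξ * L (character x ξ)) =ᶠ[nhds ξ] (L ∘ character x) := by
        have : Metric.ball (0 : EuclideanSpace ℝ (Fin d)) (ρ + 1) ∈ nhds ξ :=
          Metric.isOpen_ball.mem_nhds (by
            rw [mem_closedBall_zero_iff] at hξ
            rw [mem_ball_zero_iff]; linarith)
        filter_upwards [this] with y hy
        rw [b.one_of_mem_closedBall (Metric.ball_subset_closedBall hy), one_mul]
        rfl
      rw [(heq.iteratedFDeriv ℝ a).eq_of_nhds,
        L.iteratedFDeriv_comp_left (contDiff_character x (n := a)).contDiffAt le_rfl]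
      simp [iteratedFDeriv_character, hc, EuclideanSpace.inner_single_left]
    have e1 : ∀ ξ, (partialDeriv (Pi.single i a) (fun ξ => b ξ * L (character x ξ)) ξ : ℂ) * u ξ
        = (L (c ^ a * character x ξ) : ℂ) * u ξ := by
      intro ξ
      by_cases hξ : ξ ∈ Metric.closedBall (0 : EuclideanSpace ℝ (Fin d)) ρ
      · rw [hloc ξ hξ]
      · rw [hu ξ hξ, mul_zero, mul_zero]
    have e2 : ∫ ξ, ((b ξ * L (character x ξ) : ℝ) : ℂ) * v ξ
        = ∫ ξ, (L (character x ξ) : ℂ) * v ξ := by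
      refine integral_congr_ae ?_
      filter_upwards [hv0] with ξ hξ
      by_cases hm : ξ ∈ Metric.closedBall (0 : EuclideanSpace ℝ (Fin d)) ρ
      · rw [b.one_of_mem_closedBall (Metric.closedBall_subset_closedBall (by
          change ρ ≤ ρ + 1; linarith) hm), one_mul]
      · rw [hξ hm, mul_zero, mul_zero]
    simp_rw [e1] at h1
    rw [h1, e2]
    simp
  have hint : ∀ (w : EuclideanSpace ℝ (Fin d) → ℂ) (z : ℂ) (L : ℂ →L[ℝ] ℝ), Integrable w →
      Integrable fun ξ => (L (z * character x ξ) : ℂ) * w ξ := by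
    intro w z L hw
    refine hw.bdd_mul (c := ‖L‖ * ‖z‖) ?_ ?_
    · refine (Continuous.aestronglyMeasurable ?_)
      have := (contDiff_character x (n := 0)).continuous
      fun_prop
    · filter_upwards with ξ
      rw [Complex.norm_real]
      refine (L.le_opNorm _).trans ?_
      rw [norm_mul, norm_character, mul_one]
  have comb : ∀ (w : EuclideanSpace ℝ (Fin d) → ℂ) (z : ℂ), Integrable w →
      ∫ ξ, (z * character x ξ) * w ξ = (∫ ξ, (Complex.reCLM (z * character x ξ) : ℂ) * w ξ)
        + Complex.I * ∫ ξ, (Complex.imCLM (z * character x ξ) : ℂ) * w ξ := by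
    intro w z hw
    rw [← integral_const_mul, ← integral_add (hint w z _ hw) ((hint w z _ hw).const_mul _)]
    congr 1
    ext ξ
    nth_rewrite 1 [← Complex.re_add_im (z * character x ξ)]
    simp only [Complex.reCLM_apply, Complex.imCLM_apply]
    ring
  have c1 := comb u (c ^ a) hui
  have c2 := comb v 1 hvi
  simp only [one_mul] at c2
  rw [fourierInv_eq_integral_character, fourierInv_eq_integral_character, ← integral_const_mul, c2]
  simp_rw [← mul_assoc]
  rw [c1, key, key]
  ring

end WeakDerivatives

/-! ### The kernels -/

section Kernels

variable {d : ℕ}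

lemma succ_le_two_mul_order (d : ℕ) : d + 1 ≤ 2 * order d := by unfold order; omega

lemma two_mul_order_le (d : ℕ) : 2 * order d ≤ d + 2 := by unfold order; omega

lemma ennreal_mul_le_sq_add_sq (a b : ℝ≥0∞) : a * b ≤ a ^ 2 + b ^ 2 := by
  rcases le_total a b with h | h
  · calc a * b ≤ b * b := by gcongr
      _ ≤ a ^ 2 + b ^ 2 := by rw [← sq]; exact le_add_self
  · calc a * b ≤ a * a := by gcongr
      _ ≤ a ^ 2 + b ^ 2 := by rw [← sq]; exact le_self_add

variable {K M : ℝ} {ψ : ℤ → EuclideanSpace ℝ (Fin d) → ℂ}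

lemma IsSymbolSystem.eq_zero_of_notMem (h : IsSymbolSystem d K M ψ) (n : ℤ)
    {x : EuclideanSpace ℝ (Fin d)} (hx : x ∉ Metric.closedBall 0 ((2 : ℝ) ^ (n + 1))) :
    ψ n x = 0 := by
  by_contra hne
  have := (h.support_subset n hne).2
  exact hx (by rw [mem_closedBall_zero_iff]; exact this.le)

lemma IsSymbolSystem.eq_zero_of_lt (h : IsSymbolSystem d K M ψ) (n : ℤ)
    {x : EuclideanSpace ℝ (Fin d)} (hx : ‖x‖ < (2 : ℝ) ^ (n - 1)) : ψ n x = 0 := by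
  by_contra hne
  exact absurd (h.support_subset n hne).1 (not_le.2 hx)

lemma IsSymbolSystem.integrable (h : IsSymbolSystem d K M ψ) (n : ℤ) : Integrable (ψ n) := by
  obtain ⟨v, hv, -⟩ := h.weakDeriv n 0 (by simp)
  exact integrable_of_locallyIntegrable_of_ae hv.1
    (.of_forall fun x hx => h.eq_zero_of_notMem n hx)

lemma memLp_two_of_bounded {u : EuclideanSpace ℝ (Fin d) → ℂ} (hu : Integrable u) {M : ℝ}
    (hM : ∀ x, ‖u x‖ ≤ M) : MemLp u 2 := by
  refine memLp_two_of_lintegral hu.1 ?_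
  calc ∫⁻ x, ‖u x‖ₑ ^ 2 ≤ ∫⁻ x, ENNReal.ofReal M * ‖u x‖ₑ := by
        refine lintegral_mono fun x => ?_
        rw [sq]
        gcongr
        rw [← ofReal_norm]
        exact ENNReal.ofReal_le_ofReal (hM x)
    _ = ENNReal.ofReal M * ∫⁻ x, ‖u x‖ₑ := lintegral_const_mul' _ _ ENNReal.ofReal_ne_top
    _ < ⊤ := ENNReal.mul_lt_top ENNReal.ofReal_lt_top hu.2

lemma IsSymbolSystem.memLp (h : IsSymbolSystem d K M ψ) (n : ℤ) : MemLp (ψ n) 2 :=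
  memLp_two_of_bounded (h.integrable n) (h.bounded n)

lemma exists_norm_le_mul_abs (hd : 1 ≤ d) (x : EuclideanSpace ℝ (Fin d)) :
    ∃ i, ‖x‖ ≤ d * |x i| := by
  have : Nonempty (Fin d) := ⟨⟨0, hd⟩⟩
  obtain ⟨i, hi⟩ := Finite.exists_max fun i => |x i|
  refine ⟨i, (norm_le_sum_abs x).trans ?_⟩
  calc ∑ j, |x j| ≤ ∑ _j : Fin d, |x i| := Finset.sum_le_sum fun j _ => hi j
    _ = d * |x i| := by simp

/-- Plancherel's identity applied to the pure derivative of order `a` in the direction `i`. -/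
lemma IsSymbolSystem.lintegral_coord_pow_mul_kernel_le (h : IsSymbolSystem d K M ψ) (n : ℤ)
    (i : Fin d) :
    ∫⁻ x, (‖x i‖ₑ ^ order d * ‖𝓕⁻ (ψ n) x‖ₑ) ^ 2 ≤ ENNReal.ofReal K ^ 2 *
      ENNReal.ofReal (((2 : ℝ) ^ n) ^ d * (((2 : ℝ) ^ n) ^ (2 * order d))⁻¹) := by
  obtain ⟨v, hv, hb⟩ := h.weakDeriv n (Pi.single i (order d)) (by simp)
  have hsum : ∑ j, ((Pi.single i (order d) : Fin d → ℕ) j : ℤ) = order d := by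
    rw [← Nat.cast_sum]; simp
  rw [hsum] at hb
  set r : ℝ := (2 : ℝ) ^ n with hr
  have hrpos : 0 < r := by positivity
  have hz1 : (2 : ℝ) ^ (-(n * (d : ℤ))) = (r ^ d)⁻¹ := by
    rw [zpow_neg, zpow_mul, zpow_natCast]
  have hz2 : (2 : ℝ) ^ (-(n * (order d : ℤ))) = (r ^ order d)⁻¹ := by
    rw [zpow_neg, zpow_mul, zpow_natCast]
  rw [hz1, hz2] at hb
  have hv2 : ∫⁻ ξ, ‖v ξ‖ₑ ^ 2 ≤ ENNReal.ofReal K ^ 2 *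
      ENNReal.ofReal (r ^ d * (r ^ (2 * order d))⁻¹) := by
    have h1 : ENNReal.ofReal (r ^ d)⁻¹ * ∫⁻ ξ, ‖v ξ‖ₑ ^ 2 ≤
        ENNReal.ofReal (K * (r ^ order d)⁻¹) ^ 2 := by
      have := ENNReal.rpow_le_rpow hb (by norm_num : (0 : ℝ) ≤ 2)
      rw [← ENNReal.rpow_mul] at this
      norm_num at this
      exact this
    calc ∫⁻ ξ, ‖v ξ‖ₑ ^ 2
        = ENNReal.ofReal (r ^ d) * (ENNReal.ofReal (r ^ d)⁻¹ * ∫⁻ ξ, ‖v ξ‖ₑ ^ 2) := by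
          rw [← mul_assoc, ← ENNReal.ofReal_mul (by positivity), mul_inv_cancel₀ (by positivity)]
          simp
      _ ≤ ENNReal.ofReal (r ^ d) * ENNReal.ofReal (K * (r ^ order d)⁻¹) ^ 2 := by gcongr
      _ = _ := by
          rw [mul_comm K, ENNReal.ofReal_mul (by positivity), mul_pow,
            ENNReal.ofReal_mul (by positivity), ← ENNReal.ofReal_pow (by positivity), ← inv_pow,
            ← inv_pow, ← pow_mul, mul_comm (order d) 2]
          ring
  have hu : ∀ x, x ∉ Metric.closedBall 0 ((2 : ℝ) ^ (n + 1)) → ψ n x = 0 :=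
    fun x hx => h.eq_zero_of_notMem n hx
  have hvi : Integrable v := integrable_of_locallyIntegrable_of_ae hv.2.1
    (hv.ae_eq_zero Metric.isClosed_closedBall hu)
  have hvL : MemLp v 2 := memLp_two_of_lintegral hvi.1
    (hv2.trans_lt (ENNReal.mul_lt_top (by finiteness) (by finiteness)))
  refine le_trans ?_ hv2
  rw [← lintegral_enorm_fourierInv_sq hvi hvL]
  refine lintegral_mono fun x => ?_
  have h1 := congrArg (fun z => ‖z‖) (hv.fourierInv_eq (by positivity) hu x)
  simp only [norm_mul, norm_pow, norm_neg, norm_one, one_pow, one_mul, Complex.norm_I, mul_one,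
    Complex.norm_real, RCLike.norm_ofNat] at h1
  have h2 : ‖x i‖ ^ order d * ‖𝓕⁻ (ψ n) x‖ ≤ ‖𝓕⁻ v x‖ := by
    rw [← h1]
    gcongr
    have hπ : (1 : ℝ) ≤ 2 * ‖Real.pi‖ := by
      rw [Real.norm_of_nonneg Real.pi_pos.le]; linarith [Real.pi_gt_three]
    nlinarith [norm_nonneg (x i)]
  dsimp only
  gcongr
  have h3 := ENNReal.ofReal_le_ofReal h2
  rwa [ENNReal.ofReal_mul (by positivity), ENNReal.ofReal_pow (by positivity), ofReal_norm,
    ofReal_norm, ofReal_norm] at h3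

/-- Each kernel has `a` moments in `L²`, with the scale invariant bound. -/
lemma IsSymbolSystem.lintegral_pow_mul_kernel_le (hd : 1 ≤ d) (h : IsSymbolSystem d K M ψ)
    (n : ℤ) :
    ∫⁻ x, (‖x‖ₑ ^ order d * ‖𝓕⁻ (ψ n) x‖ₑ) ^ 2 ≤
      (d : ℝ≥0∞) ^ (2 * order d) * d * ENNReal.ofReal K ^ 2 *
      ENNReal.ofReal (((2 : ℝ) ^ n) ^ d * (((2 : ℝ) ^ n) ^ (2 * order d))⁻¹) := by
  have hcont := continuous_fourierInv (h.integrable n)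
  calc ∫⁻ x, (‖x‖ₑ ^ order d * ‖𝓕⁻ (ψ n) x‖ₑ) ^ 2
      ≤ ∫⁻ x, (d : ℝ≥0∞) ^ (2 * order d) *
          ∑ i, (‖x i‖ₑ ^ order d * ‖𝓕⁻ (ψ n) x‖ₑ) ^ 2 := by
        refine lintegral_mono fun x => ?_
        obtain ⟨i, hi⟩ := exists_norm_le_mul_abs hd x
        have hi' : ‖x‖ₑ ≤ d * ‖x i‖ₑ := by
          rw [← ofReal_norm, ← ofReal_norm, ← ENNReal.ofReal_natCast,
            ← ENNReal.ofReal_mul (by positivity)]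
          exact ENNReal.ofReal_le_ofReal hi
        calc (‖x‖ₑ ^ order d * ‖𝓕⁻ (ψ n) x‖ₑ) ^ 2
            ≤ ((d * ‖x i‖ₑ) ^ order d * ‖𝓕⁻ (ψ n) x‖ₑ) ^ 2 := by gcongr
          _ = (d : ℝ≥0∞) ^ (2 * order d) * (‖x i‖ₑ ^ order d * ‖𝓕⁻ (ψ n) x‖ₑ) ^ 2 := by ring
          _ ≤ _ := by
              gcongr
              exact Finset.single_le_sum
                (f := fun i => (‖x i‖ₑ ^ order d * ‖𝓕⁻ (ψ n) x‖ₑ) ^ 2) (fun _ _ => zero_le)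
                (Finset.mem_univ i)
    _ = (d : ℝ≥0∞) ^ (2 * order d) *
          ∑ i, ∫⁻ x, (‖x i‖ₑ ^ order d * ‖𝓕⁻ (ψ n) x‖ₑ) ^ 2 := by
        rw [lintegral_const_mul' _ _ (by finiteness), lintegral_finsetSum']
        intro i _
        refine (Measurable.aemeasurable ?_)
        have : Measurable fun x : EuclideanSpace ℝ (Fin d) => x i :=
          (by fun_prop : Continuous fun x : EuclideanSpace ℝ (Fin d) => x i).measurable
        have h2 := hcont.measurable
        fun_prop
    _ ≤ (d : ℝ≥0∞) ^ (2 * order d) * ∑ _i : Fin d, (ENNReal.ofReal K ^ 2 *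
          ENNReal.ofReal (((2 : ℝ) ^ n) ^ d * (((2 : ℝ) ^ n) ^ (2 * order d))⁻¹)) := by
        gcongr with i
        exact h.lintegral_coord_pow_mul_kernel_le n i
    _ = _ := by
        rw [Finset.sum_const, Finset.card_univ, Fintype.card_fin, nsmul_eq_mul]
        ring

/-- The squared weighted norm `∫ |k|² (1 + |x|)^{2a}` of the kernel `k` with symbol `m`. It is
dual to the weight that defines `MemWeighted`. -/
noncomputable def kernelEnergy (m : EuclideanSpace ℝ (Fin d) → ℂ) : ℝ≥0∞ :=
  ∫⁻ x, (ENNReal.ofReal ((1 + ‖x‖) ^ order d) * ‖𝓕⁻ m x‖ₑ) ^ 2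

lemma IsSymbolSystem.kernelEnergy_lt_top (hd : 1 ≤ d) (h : IsSymbolSystem d K M ψ) (n : ℤ) :
    kernelEnergy (ψ n) < ⊤ := by
  have hcont := continuous_fourierInv (h.integrable n)
  have hk2 : ∫⁻ x, ‖𝓕⁻ (ψ n) x‖ₑ ^ 2 < ⊤ :=
    lintegral_enorm_sq_lt_top (memLp_fourierInv (h.integrable n) (h.memLp n))
  have hka := h.lintegral_pow_mul_kernel_le hd n
  calc kernelEnergy (ψ n)
      ≤ ∫⁻ x, (2 ^ order d) ^ 2 * (‖𝓕⁻ (ψ n) x‖ₑ ^ 2 +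
          (‖x‖ₑ ^ order d * ‖𝓕⁻ (ψ n) x‖ₑ) ^ 2) := by
        refine lintegral_mono fun x => ?_
        have h1 : ENNReal.ofReal ((1 + ‖x‖) ^ order d) ≤
            2 ^ order d * max 1 (‖x‖ₑ ^ order d) := by
          rw [ENNReal.ofReal_pow (by positivity), ENNReal.ofReal_add (by norm_num) (by positivity),
            ofReal_norm, ENNReal.ofReal_one]
          rcases le_total ‖x‖ₑ 1 with hx | hx
          · refine le_trans ?_ (mul_le_mul_right (le_max_left _ _) _)
            rw [mul_one]
            gcongr
            calc 1 + ‖x‖ₑ ≤ 1 + 1 := by gcongr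
              _ = 2 := by norm_num
          · refine le_trans ?_ (mul_le_mul_right (le_max_right _ _) _)
            rw [← mul_pow]
            gcongr
            calc 1 + ‖x‖ₑ ≤ ‖x‖ₑ + ‖x‖ₑ := by gcongr
              _ = 2 * ‖x‖ₑ := by ring
        calc (ENNReal.ofReal ((1 + ‖x‖) ^ order d) * ‖𝓕⁻ (ψ n) x‖ₑ) ^ 2
            ≤ ((2 ^ order d * max 1 (‖x‖ₑ ^ order d)) * ‖𝓕⁻ (ψ n) x‖ₑ) ^ 2 := by gcongr
          _ = (2 ^ order d) ^ 2 * (max 1 (‖x‖ₑ ^ order d) * ‖𝓕⁻ (ψ n) x‖ₑ) ^ 2 := by ring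
          _ ≤ _ := by
              gcongr
              rcases max_choice 1 (‖x‖ₑ ^ order d) with hm | hm <;> rw [hm]
              · rw [one_mul]; exact le_self_add
              · exact le_add_self
    _ = (2 ^ order d) ^ 2 * ((∫⁻ x, ‖𝓕⁻ (ψ n) x‖ₑ ^ 2) +
          ∫⁻ x, (‖x‖ₑ ^ order d * ‖𝓕⁻ (ψ n) x‖ₑ) ^ 2) := by
        rw [lintegral_const_mul' _ _ (by finiteness), lintegral_add_left]
        have := hcont.measurable
        fun_prop
    _ < ⊤ := by
        refine ENNReal.mul_lt_top (by finiteness) (ENNReal.add_lt_top.2 ⟨hk2, hka.trans_lt ?_⟩)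
        finiteness

lemma ofReal_decay_eq (s : ℕ) (x : EuclideanSpace ℝ (Fin d)) :
    ENNReal.ofReal (decay s 1 x) = (ENNReal.ofReal ((1 + ‖x‖) ^ s))⁻¹ := by
  unfold decay
  rw [ENNReal.ofReal_inv_of_pos (by positivity), div_one]

/-- Any kernel of finite energy is integrable, since `2a > d`. -/
lemma integrable_fourierInv_of_kernelEnergy {m : EuclideanSpace ℝ (Fin d) → ℂ}
    (hm : Integrable m) (hk : kernelEnergy m < ⊤) : Integrable (𝓕⁻ m) := by
  have hcont := continuous_fourierInv hm
  refine ⟨hcont.aestronglyMeasurable, ?_⟩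
  rw [hasFiniteIntegral_iff_enorm]
  calc ∫⁻ x, ‖𝓕⁻ m x‖ₑ ≤ ∫⁻ x, ((ENNReal.ofReal ((1 + ‖x‖) ^ order d) * ‖𝓕⁻ m x‖ₑ) ^ 2 +
        ENNReal.ofReal (decay (2 * order d) 1 (x - 0))) := by
        refine lintegral_mono fun x => ?_
        set b := ENNReal.ofReal ((1 + ‖x‖) ^ order d) with hb
        have hb0 : b ≠ 0 := by rw [hb]; simp; positivity
        have hbt : b ≠ ⊤ := ENNReal.ofReal_ne_top
        rw [sub_zero, ofReal_decay_eq, show (1 + ‖x‖) ^ (2 * order d) =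
          ((1 + ‖x‖) ^ order d) ^ 2 by ring, ENNReal.ofReal_pow (by positivity), ← hb,
          ENNReal.inv_pow]
        calc ‖𝓕⁻ m x‖ₑ = (b * ‖𝓕⁻ m x‖ₑ) * b⁻¹ := by
              rw [mul_comm b, mul_assoc, ENNReal.mul_inv_cancel hb0 hbt, mul_one]
          _ ≤ _ := ennreal_mul_le_sq_add_sq _ _
    _ = kernelEnergy m + ∫⁻ x, ENNReal.ofReal (decay (2 * order d) 1 (x - 0)) := by
        rw [lintegral_add_left]
        · rfl
        · have := hcont.measurable
          fun_prop
    _ < ⊤ := by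
        refine ENNReal.add_lt_top.2 ⟨hk, (lintegral_decay_le (succ_le_two_mul_order d) one_pos
          0).trans_lt ?_⟩
        finiteness

lemma IsSymbolSystem.integrable_kernel (hd : 1 ≤ d) (h : IsSymbolSystem d K M ψ) (n : ℤ) :
    Integrable (𝓕⁻ (ψ n)) :=
  integrable_fourierInv_of_kernelEnergy (h.integrable n) (h.kernelEnergy_lt_top hd n)

/-- The symbols vanish near the origin, where Fourier inversion holds pointwise. -/
lemma IsSymbolSystem.integral_kernel (hd : 1 ≤ d) (h : IsSymbolSystem d K M ψ) (n : ℤ) :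
    ∫ x, 𝓕⁻ (ψ n) x = 0 := by
  have hev : ∀ᶠ x in nhds (0 : EuclideanSpace ℝ (Fin d)), ψ n x = 0 := by
    filter_upwards [Metric.ball_mem_nhds (0 : EuclideanSpace ℝ (Fin d))
      (by positivity : (0 : ℝ) < 2 ^ (n - 1))] with x hx
    exact h.eq_zero_of_lt n (by simpa using hx)
  have hc : ContinuousAt (ψ n) 0 := by
    have : ψ n =ᶠ[nhds 0] fun _ => 0 := hev
    exact (continuousAt_congr this).2 continuousAt_const
  have hF : Integrable (𝓕 (ψ n)) := by
    have := (h.integrable_kernel hd n).comp_neg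
    simpa [Real.fourierInv_eq_fourier_neg] using this
  have := (h.integrable n).fourier_fourierInv_eq hF hc
  rw [hev.self_of_nhds, Real.fourier_eq'] at this
  simpa using this

end Kernels

/-! ### The convolution operators on the weighted space -/

section Multiplier

variable {d : ℕ} {m f : EuclideanSpace ℝ (Fin d) → ℂ}

/-- The squared norm `∫ |f|² (1 + |x|)^{-2a}` of `f` in the weighted space. -/
noncomputable def weightedEnergy (f : EuclideanSpace ℝ (Fin d) → ℂ) : ℝ≥0∞ :=
  ∫⁻ x, ‖f x‖ₑ ^ 2 * ENNReal.ofReal (decay (2 * order d) 1 x)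

lemma weightedEnergy_eq (f : EuclideanSpace ℝ (Fin d) → ℂ) :
    weightedEnergy f = ∫⁻ x, ‖f x‖ₑ ^ 2 / ENNReal.ofReal ((1 + ‖x‖) ^ (2 * order d)) := by
  simp_rw [weightedEnergy, ofReal_decay_eq, div_eq_mul_inv]

lemma MemWeighted.weightedEnergy_lt_top (hf : MemWeighted f) : weightedEnergy f < ⊤ := by
  rw [weightedEnergy_eq]; exact hf.2

/-- The convolution grows at most like `(1 + |x|)^a`. -/
lemma lintegral_kernel_mul_le (hm : Integrable m) (f : EuclideanSpace ℝ (Fin d) → ℂ)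
    (x : EuclideanSpace ℝ (Fin d)) :
    ∫⁻ y, ‖𝓕⁻ m (x - y)‖ₑ * ‖f y‖ₑ ≤
      ENNReal.ofReal ((1 + ‖x‖) ^ order d) * (kernelEnergy m + weightedEnergy f) := by
  have hcont := continuous_fourierInv hm
  calc ∫⁻ y, ‖𝓕⁻ m (x - y)‖ₑ * ‖f y‖ₑ
      ≤ ∫⁻ y, ENNReal.ofReal ((1 + ‖x‖) ^ order d) *
          ((ENNReal.ofReal ((1 + ‖x - y‖) ^ order d) * ‖𝓕⁻ m (x - y)‖ₑ) ^ 2 +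
            ‖f y‖ₑ ^ 2 * ENNReal.ofReal (decay (2 * order d) 1 y)) := by
        refine lintegral_mono fun y => ?_
        have h0 : (1 : ℝ) ≤ (1 + ‖x‖) ^ order d * (1 + ‖x - y‖) ^ order d *
            ((1 + ‖y‖) ^ order d)⁻¹ := by
          rw [le_mul_inv_iff₀ (by positivity), one_mul, ← mul_pow]
          gcongr
          have : ‖y‖ ≤ ‖x‖ + ‖x - y‖ := by
            calc ‖y‖ = ‖x - (x - y)‖ := by congr 1; abel
              _ ≤ _ := norm_sub_le _ _
          nlinarith [norm_nonneg x, norm_nonneg (x - y)]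
        have h1 : (1 : ℝ≥0∞) ≤ ENNReal.ofReal ((1 + ‖x‖) ^ order d) *
            ENNReal.ofReal ((1 + ‖x - y‖) ^ order d) * ENNReal.ofReal ((1 + ‖y‖) ^ order d)⁻¹ := by
          rw [← ENNReal.ofReal_mul (by positivity), ← ENNReal.ofReal_mul (by positivity)]
          simpa using h0
        have h2 : ENNReal.ofReal (decay (2 * order d) 1 y) =
            ENNReal.ofReal ((1 + ‖y‖) ^ order d)⁻¹ ^ 2 := by
          rw [← ENNReal.ofReal_pow (by positivity)]
          unfold decay
          rw [div_one, inv_pow, ← pow_mul, mul_comm 2]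
        calc ‖𝓕⁻ m (x - y)‖ₑ * ‖f y‖ₑ
            ≤ (ENNReal.ofReal ((1 + ‖x‖) ^ order d) * ENNReal.ofReal ((1 + ‖x - y‖) ^ order d) *
                ENNReal.ofReal ((1 + ‖y‖) ^ order d)⁻¹) * (‖𝓕⁻ m (x - y)‖ₑ * ‖f y‖ₑ) :=
              le_mul_of_one_le_left' h1
          _ = ENNReal.ofReal ((1 + ‖x‖) ^ order d) *
              ((ENNReal.ofReal ((1 + ‖x - y‖) ^ order d) * ‖𝓕⁻ m (x - y)‖ₑ) *
                (‖f y‖ₑ * ENNReal.ofReal ((1 + ‖y‖) ^ order d)⁻¹)) := by ring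
          _ ≤ _ := by
              gcongr
              refine (ennreal_mul_le_sq_add_sq _ _).trans (le_of_eq ?_)
              rw [h2, mul_pow ‖f y‖ₑ]
    _ = _ := by
        rw [lintegral_const_mul' _ _ ENNReal.ofReal_ne_top, lintegral_add_left]
        · congr 2
          exact lintegral_sub_left_eq_self
            (fun z => (ENNReal.ofReal ((1 + ‖z‖) ^ order d) * ‖𝓕⁻ m z‖ₑ) ^ 2) x
        · have := hcont.measurable
          fun_prop

lemma aestronglyMeasurable_kernel_mul (hm : Integrable m) (hf : AEStronglyMeasurable f) :
    AEStronglyMeasurable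
      (fun p : EuclideanSpace ℝ (Fin d) × EuclideanSpace ℝ (Fin d) => 𝓕⁻ m (p.1 - p.2) * f p.2)
      (volume.prod volume) := by
  have hcont := continuous_fourierInv hm
  exact (by fun_prop : Continuous fun p : EuclideanSpace ℝ (Fin d) × EuclideanSpace ℝ (Fin d) =>
    𝓕⁻ m (p.1 - p.2)).aestronglyMeasurable.mul hf.comp_snd

lemma aestronglyMeasurable_multiplier (hm : Integrable m) (hf : AEStronglyMeasurable f) :
    AEStronglyMeasurable (multiplier m f) :=
  (aestronglyMeasurable_kernel_mul hm hf).integral_prod_right'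

/-- The convolution with a kernel of finite energy converges absolutely at every point. -/
lemma integrable_kernel_mul (hm : Integrable m) (hk : kernelEnergy m < ⊤) (hf : MemWeighted f)
    (x : EuclideanSpace ℝ (Fin d)) : Integrable fun y => 𝓕⁻ m (x - y) * f y := by
  have hcont := continuous_fourierInv hm
  refine ⟨(by fun_prop : Continuous fun y => 𝓕⁻ m (x - y)).aestronglyMeasurable.mul hf.1, ?_⟩
  rw [hasFiniteIntegral_iff_enorm]
  simp_rw [enorm_mul]
  refine (lintegral_kernel_mul_le hm f x).trans_lt ?_
  exact ENNReal.mul_lt_top ENNReal.ofReal_lt_top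
    (ENNReal.add_lt_top.2 ⟨hk, hf.weightedEnergy_lt_top⟩)

lemma lintegral_schwartz_mul_pow_lt_top (Φ : 𝓢(EuclideanSpace ℝ (Fin d), ℂ)) (k : ℕ) :
    ∫⁻ x, ‖Φ x‖ₑ * ENNReal.ofReal ((1 + ‖x‖) ^ k) < ⊤ := by
  have h : Integrable fun x => (1 + ‖x‖) ^ k * ‖Φ x‖ := by
    have h0 := Φ.integrable_pow_mul volume 0
    have hk := Φ.integrable_pow_mul volume k
    refine ((h0.add hk).const_mul (2 ^ k)).mono' ?_ ?_
    · exact (by have := Φ.continuous; fun_prop :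
        Continuous fun x => (1 + ‖x‖) ^ k * ‖Φ x‖).aestronglyMeasurable
    · filter_upwards with x
      rw [Real.norm_of_nonneg (by positivity)]
      simp only [Pi.add_apply, pow_zero, one_mul]
      have h1 : (1 + ‖x‖) ^ k ≤ 2 ^ k * (1 + ‖x‖ ^ k) := by
        rcases le_total ‖x‖ 1 with hx | hx
        · calc (1 + ‖x‖) ^ k ≤ 2 ^ k := by gcongr; linarith
            _ ≤ _ := le_mul_of_one_le_right (by positivity)
              (by linarith [pow_nonneg (norm_nonneg x) k])
        · calc (1 + ‖x‖) ^ k ≤ (2 * ‖x‖) ^ k := by gcongr; linarith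
            _ = 2 ^ k * ‖x‖ ^ k := mul_pow _ _ _
            _ ≤ _ := by gcongr; linarith
      nlinarith [norm_nonneg (Φ x)]
  have h2 := h.2
  rw [hasFiniteIntegral_iff_enorm] at h2
  refine lt_of_eq_of_lt ?_ h2
  congr 1
  ext x
  rw [enorm_mul, enorm_norm, mul_comm, ← ofReal_norm ((1 + ‖x‖) ^ k),
    Real.norm_of_nonneg (by positivity)]

lemma integrable_schwartz_mul_kernel_mul (hm : Integrable m) (hk : kernelEnergy m < ⊤)
    (hf : MemWeighted f) (Φ : 𝓢(EuclideanSpace ℝ (Fin d), ℂ)) :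
    Integrable (fun p : EuclideanSpace ℝ (Fin d) × EuclideanSpace ℝ (Fin d) =>
      Φ p.1 * (𝓕⁻ m (p.1 - p.2) * f p.2)) (volume.prod volume) := by
  have hmeas := Φ.continuous.aestronglyMeasurable (μ := (volume : Measure
    (EuclideanSpace ℝ (Fin d)))).comp_fst (β := EuclideanSpace ℝ (Fin d)) (ν := volume)
    |>.mul (aestronglyMeasurable_kernel_mul hm hf.1)
  refine ⟨hmeas, ?_⟩
  rw [hasFiniteIntegral_iff_enorm]
  refine (lintegral_prod _ hmeas.enorm).trans_lt ?_
  simp only [Pi.mul_apply, enorm_mul]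
  calc ∫⁻ x, ∫⁻ y, ‖Φ x‖ₑ * (‖𝓕⁻ m (x - y)‖ₑ * ‖f y‖ₑ)
      = ∫⁻ x, ‖Φ x‖ₑ * ∫⁻ y, ‖𝓕⁻ m (x - y)‖ₑ * ‖f y‖ₑ := by
        congr 1; ext x; rw [lintegral_const_mul' _ _ enorm_ne_top]
    _ ≤ ∫⁻ x, (‖Φ x‖ₑ * ENNReal.ofReal ((1 + ‖x‖) ^ order d)) *
          (kernelEnergy m + weightedEnergy f) := by
        refine lintegral_mono fun x => ?_
        rw [mul_assoc]
        gcongr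
        exact lintegral_kernel_mul_le hm f x
    _ = (∫⁻ x, ‖Φ x‖ₑ * ENNReal.ofReal ((1 + ‖x‖) ^ order d)) *
          (kernelEnergy m + weightedEnergy f) :=
        lintegral_mul_const' _ _ (ENNReal.add_lt_top.2 ⟨hk, hf.weightedEnergy_lt_top⟩).ne
    _ < ⊤ := ENNReal.mul_lt_top (lintegral_schwartz_mul_pow_lt_top Φ _)
        (ENNReal.add_lt_top.2 ⟨hk, hf.weightedEnergy_lt_top⟩)

/-- The convolution operator acts on the Fourier side as multiplication by its symbol. -/
lemma fourierEq_multiplier (hm : Integrable m) (hk : kernelEnergy m < ⊤) (hf : MemWeighted f) :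
    FourierEq m f (multiplier m f) := by
  intro φ
  have hI := integrable_schwartz_mul_kernel_mul hm hk hf (𝓕 φ)
  have e1 : ∀ x, (𝓕 φ : 𝓢(EuclideanSpace ℝ (Fin d), ℂ)) x = 𝓕 (fun ξ => φ ξ) x := fun x => rfl
  have e2 : ∀ y, f y * 𝓕 (fun ξ => m ξ * φ ξ) y =
      ∫ x, (𝓕 φ : 𝓢(EuclideanSpace ℝ (Fin d), ℂ)) x * (𝓕⁻ m (x - y) * f y) := by
    intro y
    rw [fourier_mul_schwartz hm, ← integral_const_mul]
    congr 1
    ext x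
    rw [e1]; ring
  have e3 : ∀ x, multiplier m f x * 𝓕 (fun ξ => φ ξ) x =
      ∫ y, (𝓕 φ : 𝓢(EuclideanSpace ℝ (Fin d), ℂ)) x * (𝓕⁻ m (x - y) * f y) := by
    intro x
    rw [integral_const_mul, mul_comm, e1]; rfl
  refine ⟨?_, ?_, ?_, ?_⟩
  · obtain ⟨C, hC⟩ := φ.decay 0 0
    refine hm.mul_bdd (c := C) φ.continuous.aestronglyMeasurable (.of_forall fun x => ?_)
    simpa using hC.2 x
  · simp_rw [e3]; exact hI.integral_prod_left
  · simp_rw [e2]; exact hI.integral_prod_right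
  · simp_rw [e2, e3]
    exact integral_integral_swap hI

end Multiplier

/-! ### Characterizations of the two norms, and elementary inequalities -/

section Norms

variable {d : ℕ}

lemma rpow_half_average_le_iff {v I B : ℝ≥0∞} (hv0 : v ≠ 0) (hvt : v ≠ ⊤) :
    (v⁻¹ * I) ^ (1 / 2 : ℝ) ≤ B ↔ I ≤ v * B ^ 2 := by
  rw [one_div, ENNReal.rpow_inv_le_iff (by norm_num), ENNReal.inv_mul_le_iff hv0 hvt]
  norm_num

lemma bmoNorm_le_iff {f : EuclideanSpace ℝ (Fin d) → ℂ} {B : ℝ≥0∞} :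
    bmoNorm f ≤ B ↔ ∀ (c : EuclideanSpace ℝ (Fin d)) (l : ℝ), 0 < l →
      ∫⁻ x in cube c l, ‖f x - ⨍ y in cube c l, f y‖ₑ ^ 2 ≤ volume (cube c l) * B ^ 2 := by
  simp only [bmoNorm, iSup_le_iff]
  refine forall_congr' fun c => forall_congr' fun l => forall_congr' fun hl => ?_
  exact rpow_half_average_le_iff (volume_cube_ne_zero c hl) (volume_cube_ne_top c _)

lemma dNorm_le_iff {ψ : ℤ → EuclideanSpace ℝ (Fin d) → ℂ} {f : EuclideanSpace ℝ (Fin d) → ℂ}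
    {B : ℝ≥0∞} :
    dNorm ψ f ≤ B ↔ ∀ (c : EuclideanSpace ℝ (Fin d)) (l : ℝ), 0 < l →
      ∫⁻ x in cube c l, ∑' n : {n : ℤ // (2 : ℝ) ^ (-n) ≤ l}, ‖multiplier (ψ n) f x‖ₑ ^ 2 ≤
        volume (cube c l) * B ^ 2 := by
  simp only [dNorm, iSup_le_iff]
  refine forall_congr' fun c => forall_congr' fun l => forall_congr' fun hl => ?_
  exact rpow_half_average_le_iff (volume_cube_ne_zero c hl) (volume_cube_ne_top c _)

lemma ennreal_add_sq_le (a b : ℝ≥0∞) : (a + b) ^ 2 ≤ 2 * (a ^ 2 + b ^ 2) := by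
  have := ENNReal.rpow_add_le_mul_rpow_add_rpow a b (p := 2) (by norm_num)
  norm_num at this
  exact this

lemma enorm_add_sq_le (a b : ℂ) : ‖a + b‖ₑ ^ 2 ≤ 2 * (‖a‖ₑ ^ 2 + ‖b‖ₑ ^ 2) :=
  (pow_le_pow_left' (enorm_add_le a b) 2).trans (ennreal_add_sq_le _ _)

/-- The Cauchy–Schwarz inequality, squared. -/
lemma lintegral_mul_sq_le {X : Type*} [MeasurableSpace X] {μ : Measure X} {u v : X → ℝ≥0∞}
    (hu : AEMeasurable u μ) (hv : AEMeasurable v μ) :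
    (∫⁻ x, u x * v x ∂μ) ^ 2 ≤ (∫⁻ x, u x ^ 2 ∂μ) * ∫⁻ x, v x ^ 2 ∂μ := by
  have h := ENNReal.lintegral_mul_le_Lp_mul_Lq μ Real.HolderConjugate.two_two hu hv
  have h2 := pow_le_pow_left' h 2
  simp only [Pi.mul_apply] at h2
  refine h2.trans (le_of_eq ?_)
  rw [mul_pow, ← ENNReal.rpow_natCast, ← ENNReal.rpow_natCast, ← ENNReal.rpow_mul,
    ← ENNReal.rpow_mul]
  norm_num

lemma tsum_int_inv_two_pow (m : ℤ) : ∑' n : ℤ, (2⁻¹ : ℝ≥0∞) ^ (n - m).natAbs ≤ 4 := by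
  refine ((Equiv.subRight m).tsum_eq fun n : ℤ => (2⁻¹ : ℝ≥0∞) ^ n.natAbs).trans_le ?_
  rw [tsum_of_nat_of_neg_add_one ENNReal.summable ENNReal.summable]
  have h1 : ∀ n : ℕ, (2⁻¹ : ℝ≥0∞) ^ (-((n : ℤ) + 1)).natAbs ≤ 2⁻¹ ^ n := by
    intro n
    have : (-((n : ℤ) + 1)).natAbs = n + 1 := by omega
    rw [this, pow_succ]
    exact mul_le_of_le_one_right' (by norm_num)
  calc _ ≤ ∑' n : ℕ, (2⁻¹ : ℝ≥0∞) ^ n + ∑' n : ℕ, (2⁻¹ : ℝ≥0∞) ^ n := by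
        refine add_le_add (le_of_eq ?_) (ENNReal.tsum_le_tsum h1)
        simp
    _ = 4 := by rw [tsum_inv_two_pow]; norm_num

lemma exists_int_two_zpow {l : ℝ} (hl : 0 < l) : ∃ m : ℤ, 1 ≤ 2 ^ m * l ∧ 2 ^ m * l < 2 := by
  obtain ⟨m, h1, h2⟩ := exists_mem_Ico_zpow hl (one_lt_two (α := ℝ))
  refine ⟨-m, ?_, ?_⟩
  · rw [zpow_neg, ← div_eq_inv_mul, le_div_iff₀ (by positivity)]; linarith
  · rw [zpow_neg, ← div_eq_inv_mul, div_lt_iff₀ (by positivity)]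
    rw [zpow_add₀ (by norm_num)] at h2; norm_num at h2; linarith

lemma ofReal_inv_le_inv_two_pow {l : ℝ} {m : ℤ} (hm : 1 ≤ 2 ^ m * l) {n : ℤ} (hn : m ≤ n) :
    ENNReal.ofReal ((2 ^ n * l)⁻¹) ≤ 2⁻¹ ^ (n - m).natAbs := by
  obtain ⟨k, rfl⟩ := Int.le.dest hn
  have e : (m + k - m : ℤ).natAbs = k := by omega
  rw [e]
  have h1 : ((2 : ℝ) ^ (m + (k : ℤ)) * l)⁻¹ ≤ (2⁻¹) ^ k := by
    rw [zpow_add₀ (by norm_num), zpow_natCast, inv_pow]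
    gcongr
    nlinarith [pow_pos (two_pos (α := ℝ)) k]
  refine (ENNReal.ofReal_le_ofReal h1).trans (le_of_eq ?_)
  rw [ENNReal.ofReal_pow (by norm_num), ENNReal.ofReal_inv_of_pos (by norm_num)]
  simp

end Norms

/-! ### Bounded mean oscillation in the weighted mean -/

section BMO

variable {d : ℕ}

/-- The growth of the mean oscillation over the dyadic dilates of a cube, about the mean over the
cube itself. -/
noncomputable def oscillationGrowth (d k : ℕ) : ℝ≥0∞ := 2 * (1 + (k * (2 + 2 * 2 ^ d)) ^ 2)

lemma tsum_oscillationGrowth_lt_top (d : ℕ) :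
    ∑' k : ℕ, oscillationGrowth d k * 2⁻¹ ^ k < ⊤ := by
  have hs : Summable fun k : ℕ => (2 * (1 + (k * (2 + 2 * 2 ^ d)) ^ 2) : ℝ) * 2⁻¹ ^ k := by
    have h0 := summable_pow_mul_geometric_of_norm_lt_one (R := ℝ) 0 (r := 2⁻¹) (by norm_num)
    have h2 := summable_pow_mul_geometric_of_norm_lt_one (R := ℝ) 2 (r := 2⁻¹) (by norm_num)
    refine ((h0.mul_left 2).add (h2.mul_left (2 * (2 + 2 * 2 ^ d) ^ 2))).congr fun k => ?_
    ring
  refine lt_of_eq_of_lt ?_ (lt_top_iff_ne_top.2 hs.tsum_ofReal_ne_top)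
  congr 1
  ext k
  rw [ENNReal.ofReal_mul (by positivity), ENNReal.ofReal_pow (by norm_num),
    ENNReal.ofReal_inv_of_pos (by norm_num), ENNReal.ofReal_mul (by norm_num),
    ENNReal.ofReal_add (by norm_num) (by positivity), ENNReal.ofReal_pow (by positivity),
    ENNReal.ofReal_mul (by positivity), ENNReal.ofReal_add (by norm_num) (by positivity),
    ENNReal.ofReal_mul (by norm_num), ENNReal.ofReal_pow (by norm_num), oscillationGrowth]
  simp

/-- The averages over a cube and its double differ by at most a constant times the norm. -/
lemma enorm_average_sub_average_le {f : EuclideanSpace ℝ (Fin d) → ℂ}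
    (hf : AEStronglyMeasurable f) (c : EuclideanSpace ℝ (Fin d)) {r : ℝ} (hr : 0 < r) (k : ℕ) :
    ‖(⨍ y in cube c (2 ^ k * r), f y) - ⨍ y in cube c (2 ^ (k + 1) * r), f y‖ₑ ≤
      (2 + 2 * 2 ^ d) * bmoNorm f := by
  set a := ⨍ y in cube c (2 ^ k * r), f y with ha
  set b := ⨍ y in cube c (2 ^ (k + 1) * r), f y with hb
  have hpos : 0 < 2 ^ k * r := by positivity
  have hpos' : 0 < 2 ^ (k + 1) * r := by positivity
  have h1 := bmoNorm_le_iff.1 (le_refl (bmoNorm f)) c _ hpos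
  have h2 := bmoNorm_le_iff.1 (le_refl (bmoNorm f)) c _ hpos'
  rw [← ha] at h1
  rw [← hb] at h2
  set V := volume (cube c (2 ^ k * r)) with hV
  have hV0 : V ≠ 0 := volume_cube_ne_zero c hpos
  have hVt : V ≠ ⊤ := volume_cube_ne_top c _
  have hV2 : volume (cube c (2 ^ (k + 1) * r)) = 2 ^ d * V := by
    rw [hV, volume_cube c _, volume_cube c _, ← mul_pow, pow_succ,
      mul_comm (2 ^ k) (2 : ℝ), mul_assoc, ENNReal.ofReal_mul (by norm_num)]
    simp
  have h3 : V * ‖a - b‖ₑ ^ 2 ≤ V * ((2 + 2 * 2 ^ d) * bmoNorm f) ^ 2 := by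
    calc V * ‖a - b‖ₑ ^ 2 = ∫⁻ _x in cube c (2 ^ k * r), ‖a - b‖ₑ ^ 2 := by
          rw [setLIntegral_const, mul_comm]
      _ ≤ ∫⁻ x in cube c (2 ^ k * r), (2 * ‖f x - a‖ₑ ^ 2 + 2 * ‖f x - b‖ₑ ^ 2) := by
          refine lintegral_mono fun x => ?_
          have := enorm_add_sq_le (a - f x) (f x - b)
          rw [sub_add_sub_cancel, mul_add, ← neg_sub (f x) a, enorm_neg] at this
          exact this
      _ = 2 * (∫⁻ x in cube c (2 ^ k * r), ‖f x - a‖ₑ ^ 2) +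
            2 * ∫⁻ x in cube c (2 ^ k * r), ‖f x - b‖ₑ ^ 2 := by
          rw [lintegral_add_left', lintegral_const_mul' _ _ (by norm_num),
            lintegral_const_mul' _ _ (by norm_num)]
          exact ((hf.restrict.sub aestronglyMeasurable_const).enorm.pow_const 2).const_mul 2
      _ ≤ 2 * (V * bmoNorm f ^ 2) + 2 * (2 ^ d * V * bmoNorm f ^ 2) := by
          gcongr
          refine (lintegral_mono_set (cube_mono c ?_)).trans (h2.trans_eq (by rw [hV2]))
          rw [pow_succ]; nlinarith [pow_pos (two_pos (α := ℝ)) k]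
      _ = V * ((2 + 2 * 2 ^ d) * bmoNorm f ^ 2) := by ring
      _ ≤ _ := by
          rw [mul_pow]
          gcongr
          refine le_self_pow₀ ?_ (by norm_num)
          exact le_trans (by norm_num) (le_self_add (a := (2 : ℝ≥0∞)))
  rw [ENNReal.mul_le_mul_iff_right hV0 hVt] at h3
  exact (ENNReal.pow_le_pow_left_iff (by norm_num)).1 h3

/-- The oscillation about the average over a cube, weighted by the decay profile at the scale of
that cube, is controlled by the norm: the averages over the dyadic dilates of the cube drift only
linearly in the number of doublings. -/
lemma lintegral_sub_average_mul_decay_le (d : ℕ) : ∃ C : ℝ≥0, ∀ f : EuclideanSpace ℝ (Fin d) → ℂ,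
    AEStronglyMeasurable f → ∀ (c : EuclideanSpace ℝ (Fin d)) (r : ℝ), 0 < r →
      ∫⁻ x, ‖f x - ⨍ y in cube c r, f y‖ₑ ^ 2 * ENNReal.ofReal (decay (2 * order d) r (x - c)) ≤
        C * bmoNorm f ^ 2 * ENNReal.ofReal r ^ d := by
  refine ⟨(4 ^ (2 * order d) * ∑' k : ℕ, oscillationGrowth d k * 2⁻¹ ^ k).toNNReal,
    fun f hf c r hr => ?_⟩
  rw [ENNReal.coe_toNNReal (ENNReal.mul_ne_top (by finiteness)
    (tsum_oscillationGrowth_lt_top d).ne)]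
  refine lintegral_mul_decay_le (succ_le_two_mul_order d) hr c
    ((hf.sub aestronglyMeasurable_const).enorm.pow_const 2) (bmoNorm f ^ 2) _ fun k => ?_
  set a : ℕ → ℂ := fun k => ⨍ y in cube c (2 ^ k * r), f y with ha
  have ha0 : ⨍ y in cube c r, f y = a 0 := by simp [ha]
  have hdiff : ‖a k - a 0‖ₑ ≤ k * (2 + 2 * 2 ^ d) * bmoNorm f := by
    induction k with
    | zero => simp
    | succ k ih =>
      calc ‖a (k + 1) - a 0‖ₑ = ‖(a (k + 1) - a k) + (a k - a 0)‖ₑ := by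
            rw [sub_add_sub_cancel]
        _ ≤ ‖a (k + 1) - a k‖ₑ + ‖a k - a 0‖ₑ := enorm_add_le _ _
        _ ≤ (2 + 2 * 2 ^ d) * bmoNorm f + k * (2 + 2 * 2 ^ d) * bmoNorm f := by
            gcongr
            rw [← neg_sub, enorm_neg]
            exact enorm_average_sub_average_le hf c hr k
        _ = _ := by push_cast; ring
  have hpos : 0 < 2 ^ k * r := by positivity
  have h1 := bmoNorm_le_iff.1 (le_refl (bmoNorm f)) c _ hpos
  rw [ha0]
  calc ∫⁻ x in cube c (2 ^ k * r), ‖f x - a 0‖ₑ ^ 2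
      ≤ ∫⁻ x in cube c (2 ^ k * r), (2 * ‖f x - a k‖ₑ ^ 2 + 2 * ‖a k - a 0‖ₑ ^ 2) := by
        refine lintegral_mono fun x => ?_
        have := enorm_add_sq_le (f x - a k) (a k - a 0)
        rwa [sub_add_sub_cancel, mul_add] at this
    _ = 2 * (∫⁻ x in cube c (2 ^ k * r), ‖f x - a k‖ₑ ^ 2) +
          2 * ‖a k - a 0‖ₑ ^ 2 * volume (cube c (2 ^ k * r)) := by
        rw [lintegral_add_right _ measurable_const, lintegral_const_mul' _ _ (by norm_num),
          setLIntegral_const]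
    _ ≤ 2 * (volume (cube c (2 ^ k * r)) * bmoNorm f ^ 2) +
          2 * (k * (2 + 2 * 2 ^ d) * bmoNorm f) ^ 2 * volume (cube c (2 ^ k * r)) := by
        gcongr
    _ = bmoNorm f ^ 2 * oscillationGrowth d k * ENNReal.ofReal (2 ^ k * r) ^ d := by
        rw [volume_cube c _, oscillationGrowth]; ring

lemma memWeighted_of_bmoNorm_lt_top {f : EuclideanSpace ℝ (Fin d) → ℂ}
    (hf : LocallyIntegrable f) (hB : bmoNorm f < ⊤) : MemWeighted f := by
  refine ⟨hf.aestronglyMeasurable, ?_⟩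
  rw [← weightedEnergy_eq]
  obtain ⟨C, hC⟩ := lintegral_sub_average_mul_decay_le d
  have h1 := hC f hf.aestronglyMeasurable 0 1 one_pos
  set a := ⨍ y in cube 0 1, f y with ha
  have h2 := lintegral_decay_le (succ_le_two_mul_order d) one_pos (0 : EuclideanSpace ℝ (Fin d))
  simp only [sub_zero] at h1 h2
  have hmeas : Measurable fun x : EuclideanSpace ℝ (Fin d) =>
      ENNReal.ofReal (decay (2 * order d) 1 x) :=
    (continuous_decay _ one_pos).measurable.ennreal_ofReal
  calc weightedEnergy f
      ≤ ∫⁻ x, (2 * (‖f x - a‖ₑ ^ 2 * ENNReal.ofReal (decay (2 * order d) 1 x)) +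
          2 * ‖a‖ₑ ^ 2 * ENNReal.ofReal (decay (2 * order d) 1 x)) := by
        refine lintegral_mono fun x => ?_
        have := enorm_add_sq_le (f x - a) a
        rw [sub_add_cancel] at this
        calc ‖f x‖ₑ ^ 2 * ENNReal.ofReal (decay (2 * order d) 1 x)
            ≤ (2 * (‖f x - a‖ₑ ^ 2 + ‖a‖ₑ ^ 2)) * ENNReal.ofReal (decay (2 * order d) 1 x) := by
              gcongr
          _ = _ := by ring
    _ = 2 * (∫⁻ x, ‖f x - a‖ₑ ^ 2 * ENNReal.ofReal (decay (2 * order d) 1 x)) +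
          2 * ‖a‖ₑ ^ 2 * ∫⁻ x : EuclideanSpace ℝ (Fin d),
            ENNReal.ofReal (decay (2 * order d) 1 x) := by
        rw [lintegral_add_right _ (hmeas.const_mul _), lintegral_const_mul' _ _ (by norm_num),
          lintegral_const_mul' _ _ (by finiteness)]
    _ < ⊤ := by
        refine ENNReal.add_lt_top.2 ⟨ENNReal.mul_lt_top (by norm_num) (h1.trans_lt ?_),
          ENNReal.mul_lt_top (by finiteness) (h2.trans_lt ?_)⟩
        · exact ENNReal.mul_lt_top (ENNReal.mul_lt_top (by finiteness)
            (ENNReal.pow_lt_top hB)) (by finiteness)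
        · finiteness

end BMO

/-! ### Local integrability -/

section LocalIntegrability

variable {d : ℕ} {f : EuclideanSpace ℝ (Fin d) → ℂ}

lemma MemWeighted.memLp_cube (hf : MemWeighted f) (c : EuclideanSpace ℝ (Fin d)) (l : ℝ) :
    MemLp f 2 (volume.restrict (cube c l)) := by
  refine memLp_two_of_lintegral hf.1.restrict ?_
  obtain ⟨R, hR⟩ := (isCompact_cube c l).isBounded.exists_norm_le
  have hpt : ∀ x ∈ cube c l, ‖f x‖ₑ ^ 2 ≤ ENNReal.ofReal ((1 + R) ^ (2 * order d)) *
      (‖f x‖ₑ ^ 2 * ENNReal.ofReal (decay (2 * order d) 1 x)) := by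
    intro x hx
    have h1 : (1 : ℝ) ≤ (1 + R) ^ (2 * order d) * decay (2 * order d) 1 x := by
      unfold decay
      rw [div_one, le_mul_inv_iff₀ (by positivity), one_mul]
      gcongr
      exact hR x hx
    calc ‖f x‖ₑ ^ 2 = ENNReal.ofReal 1 * ‖f x‖ₑ ^ 2 := by simp
      _ ≤ ENNReal.ofReal ((1 + R) ^ (2 * order d) * decay (2 * order d) 1 x) * ‖f x‖ₑ ^ 2 := by
          gcongr
      _ = _ := by
          rw [ENNReal.ofReal_mul' (decay_pos _ one_pos _).le]; ring
  calc ∫⁻ x in cube c l, ‖f x‖ₑ ^ 2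
      ≤ ∫⁻ x in cube c l, ENNReal.ofReal ((1 + R) ^ (2 * order d)) *
          (‖f x‖ₑ ^ 2 * ENNReal.ofReal (decay (2 * order d) 1 x)) :=
        setLIntegral_mono' (measurableSet_cube c l) hpt
    _ ≤ ∫⁻ x, ENNReal.ofReal ((1 + R) ^ (2 * order d)) *
          (‖f x‖ₑ ^ 2 * ENNReal.ofReal (decay (2 * order d) 1 x)) := setLIntegral_le_lintegral _ _
    _ = ENNReal.ofReal ((1 + R) ^ (2 * order d)) * weightedEnergy f :=
        lintegral_const_mul' _ _ (by finiteness)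
    _ < ⊤ := ENNReal.mul_lt_top (by finiteness) hf.weightedEnergy_lt_top

lemma isFiniteMeasure_restrict_cube (c : EuclideanSpace ℝ (Fin d)) (l : ℝ) :
    IsFiniteMeasure (volume.restrict (cube c l)) :=
  ⟨by rw [Measure.restrict_apply_univ]; exact (isCompact_cube c l).measure_lt_top⟩

lemma MemWeighted.integrableOn_cube (hf : MemWeighted f) (c : EuclideanSpace ℝ (Fin d)) (l : ℝ) :
    IntegrableOn f (cube c l) :=
  have := isFiniteMeasure_restrict_cube c l
  (hf.memLp_cube c l).integrable (by norm_num)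

lemma MemWeighted.memLp_indicator_sub (hf : MemWeighted f) (b : ℂ)
    (c : EuclideanSpace ℝ (Fin d)) (l : ℝ) : MemLp ((cube c l).indicator fun x => f x - b) 2 := by
  have := isFiniteMeasure_restrict_cube c l
  rw [memLp_indicator_iff_restrict (measurableSet_cube c l)]
  exact (hf.memLp_cube c l).sub (memLp_const b)

lemma MemWeighted.integrable_indicator_sub (hf : MemWeighted f) (b : ℂ)
    (c : EuclideanSpace ℝ (Fin d)) (l : ℝ) :
    Integrable ((cube c l).indicator fun x => f x - b) := by
  have := isFiniteMeasure_restrict_cube c l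
  rw [integrable_indicator_iff (measurableSet_cube c l)]
  exact (hf.integrableOn_cube c l).sub (integrable_const b)

end LocalIntegrability

/-! ### The bound of `‖f‖_D` by `‖f‖_BMO` -/

section UpperBound

variable {d : ℕ} {K M : ℝ} {ψ : ℤ → EuclideanSpace ℝ (Fin d) → ℂ}

/-- At most two of the symbols are nonzero at any given point. -/
lemma IsSymbolSystem.tsum_enorm_sq_le (h : IsSymbolSystem d K M ψ)
    (ξ : EuclideanSpace ℝ (Fin d)) :
    ∑' n, ‖ψ n ξ‖ₑ ^ 2 ≤ 2 * ENNReal.ofReal M ^ 2 := by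
  rcases eq_or_ne ξ 0 with rfl | hξ
  · have : ∀ n, ψ n (0 : EuclideanSpace ℝ (Fin d)) = 0 := fun n =>
      h.eq_zero_of_lt n (by rw [norm_zero]; positivity)
    simp [this]
  obtain ⟨m, hm1, hm2⟩ := exists_mem_Ico_zpow (norm_pos_iff.2 hξ) (one_lt_two (α := ℝ))
  have hz : ∀ n ∉ ({m, m + 1} : Finset ℤ), ‖ψ n ξ‖ₑ ^ 2 = 0 := by
    intro n hn
    have : ψ n ξ = 0 := by
      by_contra hne
      obtain ⟨h1, h2⟩ := h.support_subset n hne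
      have h3 := (zpow_lt_zpow_iff_right₀ (one_lt_two (α := ℝ))).1 (h1.trans_lt hm2)
      have h4 := (zpow_lt_zpow_iff_right₀ (one_lt_two (α := ℝ))).1 (hm1.trans_lt h2)
      simp only [Finset.mem_insert, Finset.mem_singleton, not_or] at hn
      omega
    simp [this]
  rw [tsum_eq_sum hz, Finset.sum_pair (by omega), two_mul]
  have hb : ∀ n, ‖ψ n ξ‖ₑ ≤ ENNReal.ofReal M := fun n => by
    rw [← ofReal_norm]; exact ENNReal.ofReal_le_ofReal (h.bounded n ξ)
  gcongr <;> exact hb _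

/-- The square function is bounded on `L²`. -/
lemma IsSymbolSystem.lintegral_tsum_multiplier_sq_le (h : IsSymbolSystem d K M ψ)
    {g : EuclideanSpace ℝ (Fin d) → ℂ} (hg : Integrable g) (hg2 : MemLp g 2) :
    ∫⁻ x, ∑' n, ‖multiplier (ψ n) g x‖ₑ ^ 2 ≤ 2 * ENNReal.ofReal M ^ 2 * ∫⁻ x, ‖g x‖ₑ ^ 2 := by
  have hFc := continuous_fourier hg
  have hprod : ∀ n, Integrable fun ξ => ψ n ξ * 𝓕 g ξ := fun n =>
    (h.integrable n).mul_bdd (c := ∫ x, ‖g x‖) hFc.aestronglyMeasurable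
      (.of_forall fun ξ => VectorFourier.norm_fourierIntegral_le_integral_norm _ _ _ _ _)
  have hF2 := lintegral_enorm_sq_lt_top (memLp_fourier hg hg2)
  have hM : ∀ n ξ, ‖ψ n ξ‖ₑ ≤ ENNReal.ofReal M := fun n ξ => by
    rw [← ofReal_norm]; exact ENNReal.ofReal_le_ofReal (h.bounded n ξ)
  have hprod2 : ∀ n, MemLp (fun ξ => ψ n ξ * 𝓕 g ξ) 2 := fun n => by
    refine memLp_two_of_lintegral (hprod n).1 ?_
    calc ∫⁻ ξ, ‖ψ n ξ * 𝓕 g ξ‖ₑ ^ 2 ≤ ∫⁻ ξ, ENNReal.ofReal M ^ 2 * ‖𝓕 g ξ‖ₑ ^ 2 := by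
          refine lintegral_mono fun ξ => ?_
          rw [enorm_mul, mul_pow]
          gcongr
          exact hM n ξ
      _ = ENNReal.ofReal M ^ 2 * ∫⁻ ξ, ‖𝓕 g ξ‖ₑ ^ 2 := lintegral_const_mul' _ _ (by finiteness)
      _ < ⊤ := ENNReal.mul_lt_top (by finiteness) hF2
  have heq : ∀ n, multiplier (ψ n) g = 𝓕⁻ fun ξ => ψ n ξ * 𝓕 g ξ := fun n => by
    ext x; exact integral_fourierInv_sub_mul (h.integrable n) hg x
  calc ∫⁻ x, ∑' n, ‖multiplier (ψ n) g x‖ₑ ^ 2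
      = ∑' n, ∫⁻ x, ‖multiplier (ψ n) g x‖ₑ ^ 2 := lintegral_tsum fun n =>
        (aestronglyMeasurable_multiplier (h.integrable n) hg.1).enorm.pow_const 2
    _ = ∑' n, ∫⁻ ξ, ‖ψ n ξ * 𝓕 g ξ‖ₑ ^ 2 := by
        congr 1; ext n; rw [heq, lintegral_enorm_fourierInv_sq (hprod n) (hprod2 n)]
    _ = ∫⁻ ξ, ∑' n, ‖ψ n ξ * 𝓕 g ξ‖ₑ ^ 2 :=
        (lintegral_tsum fun n => (hprod n).1.enorm.pow_const 2).symm
    _ ≤ ∫⁻ ξ, 2 * ENNReal.ofReal M ^ 2 * ‖𝓕 g ξ‖ₑ ^ 2 := by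
        refine lintegral_mono fun ξ => ?_
        simp_rw [enorm_mul, mul_pow]
        rw [ENNReal.tsum_mul_right]
        gcongr
        exact h.tsum_enorm_sq_le ξ
    _ = _ := by
        rw [lintegral_const_mul' _ _ (by finiteness), lintegral_enorm_fourier_sq hg hg2]

/-- Since the kernels have mean zero, a function may be replaced by its oscillation about a
constant, split into the parts inside and outside of a cube. -/
lemma IsSymbolSystem.multiplier_eq_add (hd : 1 ≤ d) (h : IsSymbolSystem d K M ψ) (n : ℤ)
    {f : EuclideanSpace ℝ (Fin d) → ℂ} (hf : MemWeighted f) (b : ℂ)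
    (c : EuclideanSpace ℝ (Fin d)) (l : ℝ) (x : EuclideanSpace ℝ (Fin d)) :
    multiplier (ψ n) f x = multiplier (ψ n) ((cube c l).indicator fun y => f y - b) x +
      multiplier (ψ n) ((cube c l)ᶜ.indicator fun y => f y - b) x := by
  have hk := h.integrable_kernel hd n
  have hkx : Integrable fun y => 𝓕⁻ (ψ n) (x - y) := hk.comp_sub_left x
  have hkf := integrable_kernel_mul (h.integrable n) (h.kernelEnergy_lt_top hd n) hf x
  have hdiff : Integrable fun y => 𝓕⁻ (ψ n) (x - y) * (f y - b) := by
    simp_rw [mul_sub]; exact hkf.sub (hkx.mul_const b)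
  have hind : ∀ S : Set (EuclideanSpace ℝ (Fin d)),
      (fun y => 𝓕⁻ (ψ n) (x - y) * S.indicator (fun y => f y - b) y) =
        S.indicator fun y => 𝓕⁻ (ψ n) (x - y) * (f y - b) := by
    intro S; ext y
    by_cases hy : y ∈ S <;> simp [hy]
  unfold multiplier
  rw [hind, hind, integral_indicator (measurableSet_cube c l),
    integral_indicator (measurableSet_cube c l).compl,
    integral_add_compl (measurableSet_cube c l) hdiff]
  simp_rw [mul_sub]
  rw [integral_sub hkf (hkx.mul_const b), integral_mul_const,
    integral_sub_left_eq_self (fun y => 𝓕⁻ (ψ n) y), h.integral_kernel hd n]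
  simp

/-- The distance between a point `x` of a cube and a point `y` off the doubled cube is at least half
the edge, and comparable to the distance of `y` from the centre. -/
lemma norm_sub_bounds_of_mem_of_notMem_cube {l : ℝ} (hl : 0 < l) {c x y : EuclideanSpace ℝ (Fin d)}
    (hx : x ∈ cube c l) (hy : y ∉ cube c (2 * l)) :
    l / 2 ≤ ‖x - y‖ ∧ 1 + ‖y - c‖ / (2 * l) ≤ (3 + d) * (‖x - y‖ / l) := by
  have h1 : l / 2 ≤ ‖x - y‖ := by
    simp only [cube, Set.mem_ofPred_eq, not_forall, not_le] at hy
    obtain ⟨i, hi⟩ := hy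
    have h2 := hx i
    have h3 := abs_apply_le_norm (x - y) i
    have h4 := abs_sub_le (y i) (x i) (c i)
    rw [PiLp.sub_apply, abs_sub_comm] at h3
    linarith
  refine ⟨h1, ?_⟩
  have h2 := norm_sub_le_of_mem_cube hx
  have h3 : ‖y - c‖ ≤ ‖x - y‖ + ‖x - c‖ := by
    calc ‖y - c‖ = ‖(x - c) - (x - y)‖ := by congr 1; abel
      _ ≤ _ := by rw [add_comm]; exact norm_sub_le _ _
  set t := ‖x - y‖ / l with ht
  have h4 : 1 / 2 ≤ t := by rw [ht, le_div_iff₀ hl]; linarith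
  have h5 : ‖y - c‖ / (2 * l) ≤ t / 2 + d / 4 := by
    rw [div_le_iff₀ (by positivity)]
    have : ‖x - y‖ = t * l := by rw [ht]; field_simp
    rw [this] at h3
    nlinarith
  have hd0 : (0 : ℝ) ≤ d := Nat.cast_nonneg d
  nlinarith

/-- The part of `f` away from a cube contributes little on the cube to the frequencies above the
reciprocal of its edge. -/
lemma exists_enorm_multiplier_far_sq_le (d : ℕ) (hd : 1 ≤ d) (K M : ℝ) : ∃ C : ℝ≥0,
    ∀ ψ : ℤ → EuclideanSpace ℝ (Fin d) → ℂ, IsSymbolSystem d K M ψ →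
    ∀ f : EuclideanSpace ℝ (Fin d) → ℂ, AEStronglyMeasurable f →
    ∀ (c : EuclideanSpace ℝ (Fin d)) (l : ℝ), 0 < l → ∀ x ∈ cube c l, ∀ n : ℤ, 1 ≤ 2 ^ n * l →
      ‖multiplier (ψ n) ((cube c (2 * l))ᶜ.indicator
        fun y => f y - ⨍ z in cube c (2 * l), f z) x‖ₑ ^ 2 ≤
        C * bmoNorm f ^ 2 * ENNReal.ofReal ((2 ^ n * l)⁻¹) := by
  obtain ⟨C₀, hC₀⟩ := lintegral_sub_average_mul_decay_le d
  set C₁ : ℝ≥0∞ := (d : ℝ≥0∞) ^ (2 * order d) * d * ENNReal.ofReal K ^ 2 with hC₁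
  refine ⟨(C₁ * ENNReal.ofReal ((3 + d) ^ (2 * order d) * 2 ^ d) * C₀).toNNReal, ?_⟩
  intro ψ h f hf c l hl x hx n hn
  rw [ENNReal.coe_toNNReal (by finiteness)]
  set b := ⨍ z in cube c (2 * l), f z with hb
  set k := 𝓕⁻ (ψ n) with hk
  have hkc : Continuous k := continuous_fourierInv (h.integrable n)
  have hC := hC₀ f hf c (2 * l) (by positivity)
  rw [← hb] at hC
  -- For `x` in the cube, `|x - y|^a w(y) ≥ 1` off the doubled cube. In the Cauchy–Schwarz
  -- inequality the first factor goes to the kernel and `w` to the oscillation of `f`.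
  set w : EuclideanSpace ℝ (Fin d) → ℝ := fun y =>
    ((3 + d) / l) ^ order d * decay (order d) (2 * l) (y - c) with hw
  have hwpos : ∀ y, 0 ≤ w y := fun y =>
    mul_nonneg (by positivity) (decay_pos _ (by positivity) _).le
  have hwc : Continuous w := by
    have := continuous_decay (d := d) (order d) (by positivity : 0 < 2 * l)
    fun_prop
  have hw2 : ∀ y, ENNReal.ofReal (w y) ^ 2 = ENNReal.ofReal (((3 + d) / l) ^ (2 * order d)) *
      ENNReal.ofReal (decay (2 * order d) (2 * l) (y - c)) := by
    intro y
    rw [← ENNReal.ofReal_pow (hwpos y), ← ENNReal.ofReal_mul (by positivity)]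
    congr 1
    simp only [hw, decay]
    rw [mul_pow, inv_pow, ← pow_mul, ← pow_mul, mul_comm (order d) 2]
  have hw1 : ∀ y ∉ cube c (2 * l), 1 ≤ ‖x - y‖ₑ ^ order d * ENNReal.ofReal (w y) := by
    intro y hy
    obtain ⟨h1, h2⟩ := norm_sub_bounds_of_mem_of_notMem_cube hl hx hy
    rw [← ofReal_norm, ← ENNReal.ofReal_pow (norm_nonneg _),
      ← ENNReal.ofReal_mul (by positivity), ← ENNReal.ofReal_one]
    refine ENNReal.ofReal_le_ofReal ?_
    simp only [hw, decay]
    rw [← mul_assoc, le_mul_inv_iff₀ (by positivity), one_mul, ← mul_pow]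
    gcongr
    exact h2.trans (le_of_eq (by ring))
  have hfar : ‖multiplier (ψ n) ((cube c (2 * l))ᶜ.indicator fun y => f y - b) x‖ₑ ≤
      ∫⁻ y, (‖x - y‖ₑ ^ order d * ‖k (x - y)‖ₑ) * (‖f y - b‖ₑ * ENNReal.ofReal (w y)) := by
    refine (enorm_integral_le_lintegral_enorm _).trans (lintegral_mono fun y => ?_)
    by_cases hy : y ∈ cube c (2 * l)
    · simp [hy]
    · rw [Set.indicator_of_mem (by simpa using hy), enorm_mul]
      calc ‖k (x - y)‖ₑ * ‖f y - b‖ₑ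
          ≤ (‖k (x - y)‖ₑ * ‖f y - b‖ₑ) * (‖x - y‖ₑ ^ order d * ENNReal.ofReal (w y)) :=
            le_mul_of_one_le_right' (hw1 y hy)
        _ = _ := by ring
  calc _ ≤ (∫⁻ y, (‖x - y‖ₑ ^ order d * ‖k (x - y)‖ₑ) *
          (‖f y - b‖ₑ * ENNReal.ofReal (w y))) ^ 2 := by gcongr
    _ ≤ (∫⁻ y, (‖x - y‖ₑ ^ order d * ‖k (x - y)‖ₑ) ^ 2) *
          ∫⁻ y, (‖f y - b‖ₑ * ENNReal.ofReal (w y)) ^ 2 := by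
        refine lintegral_mul_sq_le ?_ ?_
        · exact Measurable.aemeasurable (by have := hkc.measurable; fun_prop)
        · exact (hf.sub aestronglyMeasurable_const).enorm.mul
            hwc.measurable.ennreal_ofReal.aemeasurable
    _ = (∫⁻ y, (‖y‖ₑ ^ order d * ‖k y‖ₑ) ^ 2) *
          (ENNReal.ofReal (((3 + d) / l) ^ (2 * order d)) *
          ∫⁻ y, ‖f y - b‖ₑ ^ 2 * ENNReal.ofReal (decay (2 * order d) (2 * l) (y - c))) := by
        congr 1
        · exact lintegral_sub_left_eq_self (fun y => (‖y‖ₑ ^ order d * ‖k y‖ₑ) ^ 2) x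
        · rw [← lintegral_const_mul' _ _ (by finiteness)]
          congr 1; ext y
          rw [mul_pow, hw2]; ring
    _ ≤ (C₁ * ENNReal.ofReal (((2 : ℝ) ^ n) ^ d * (((2 : ℝ) ^ n) ^ (2 * order d))⁻¹)) *
          (ENNReal.ofReal (((3 + d) / l) ^ (2 * order d)) *
          (C₀ * bmoNorm f ^ 2 * ENNReal.ofReal (2 * l) ^ d)) := by
        gcongr
        exact h.lintegral_pow_mul_kernel_le hd n
    _ = (C₁ * C₀ * bmoNorm f ^ 2) *
          ENNReal.ofReal ((((2 : ℝ) ^ n) ^ d * (((2 : ℝ) ^ n) ^ (2 * order d))⁻¹) *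
            ((3 + d) / l) ^ (2 * order d) * (2 * l) ^ d) := by
        rw [← ENNReal.ofReal_pow (by positivity : 0 ≤ 2 * l),
          ENNReal.ofReal_mul (q := (2 * l) ^ d) (by positivity),
          ENNReal.ofReal_mul (q := ((3 + d) / l) ^ (2 * order d)) (by positivity)]
        ring
    _ ≤ (C₁ * C₀ * bmoNorm f ^ 2) *
          ENNReal.ofReal (((3 + d) ^ (2 * order d) * 2 ^ d) * (2 ^ n * l)⁻¹) := by
        refine mul_le_mul_right (ENNReal.ofReal_le_ofReal ?_) _
        set t : ℝ := 2 ^ n * l with ht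
        have e : (((2 : ℝ) ^ n) ^ d * (((2 : ℝ) ^ n) ^ (2 * order d))⁻¹) *
            ((3 + d) / l) ^ (2 * order d) * (2 * l) ^ d =
            ((3 + d) ^ (2 * order d) * 2 ^ d) * (t ^ d * (t ^ (2 * order d))⁻¹) := by
          rw [ht, div_pow, mul_pow, mul_pow, mul_pow, mul_inv]; ring
        rw [e]
        gcongr
        have ht0 : 0 < t := by positivity
        rw [← div_eq_mul_inv, div_le_iff₀ (by positivity), inv_mul_eq_div, le_div_iff₀ ht0,
          ← pow_succ]
        exact pow_le_pow_right₀ hn (succ_le_two_mul_order d)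
    _ = _ := by
        rw [ENNReal.ofReal_mul (by positivity)]; ring

/-- On a cube `Q`, the part of the oscillation of `f` inside of `2Q` is handled by the `L²` bound
for the square function, and the part outside by the geometric decay in `n` of its contributions. -/
theorem dNorm_le_mul_bmoNorm (d : ℕ) (hd : 1 ≤ d) (K M : ℝ) : ∃ C : ℝ≥0,
    ∀ ψ : ℤ → EuclideanSpace ℝ (Fin d) → ℂ, IsSymbolSystem d K M ψ →
    ∀ f : EuclideanSpace ℝ (Fin d) → ℂ, MemWeighted f → dNorm ψ f ≤ C * bmoNorm f := by
  obtain ⟨C₀, hC₀⟩ := exists_enorm_multiplier_far_sq_le d hd K M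
  set A : ℝ≥0∞ := 2 * (2 * ENNReal.ofReal M ^ 2 * 2 ^ d + C₀ * 4) with hA
  have hAt : A ≠ ⊤ := by finiteness
  refine ⟨(1 + A).toNNReal, fun ψ h f hf => ?_⟩
  rw [ENNReal.coe_toNNReal (by finiteness), dNorm_le_iff]
  intro c l hl
  set b := ⨍ z in cube c (2 * l), f z with hb
  set g₁ := (cube c (2 * l)).indicator fun y => f y - b with hg₁
  set g₂ := (cube c (2 * l))ᶜ.indicator fun y => f y - b with hg₂
  obtain ⟨m, hm1, hm2⟩ := exists_int_two_zpow hl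
  have hmn : ∀ n : ℤ, (2 : ℝ) ^ (-n) ≤ l → 1 ≤ 2 ^ n * l ∧ m ≤ n := by
    intro n hn
    have h1 : 1 ≤ (2 : ℝ) ^ n * l := by
      rw [zpow_neg, inv_le_iff_one_le_mul₀' (by positivity)] at hn; exact hn
    refine ⟨h1, ?_⟩
    have h2 : (2 : ℝ) ^ m < 2 ^ (n + 1) := by
      rw [zpow_add₀ (by norm_num), zpow_one]
      nlinarith
    have := (zpow_lt_zpow_iff_right₀ (one_lt_two (α := ℝ))).1 h2
    omega
  have hfar : ∀ x ∈ cube c l, ∑' n : {n : ℤ // (2 : ℝ) ^ (-n) ≤ l}, ‖multiplier (ψ n) g₂ x‖ₑ ^ 2 ≤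
      C₀ * bmoNorm f ^ 2 * 4 := by
    intro x hx
    calc ∑' n : {n : ℤ // (2 : ℝ) ^ (-n) ≤ l}, ‖multiplier (ψ n) g₂ x‖ₑ ^ 2
        ≤ ∑' n : {n : ℤ // (2 : ℝ) ^ (-n) ≤ l},
            C₀ * bmoNorm f ^ 2 * 2⁻¹ ^ ((n : ℤ) - m).natAbs := by
          refine ENNReal.tsum_le_tsum fun n => ?_
          refine (hC₀ ψ h f hf.1 c l hl x hx n (hmn n n.2).1).trans ?_
          gcongr
          exact ofReal_inv_le_inv_two_pow hm1 (hmn n n.2).2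
      _ ≤ ∑' n : ℤ, C₀ * bmoNorm f ^ 2 * 2⁻¹ ^ (n - m).natAbs :=
          ENNReal.tsum_comp_le_tsum_of_injective Subtype.val_injective _
      _ ≤ C₀ * bmoNorm f ^ 2 * 4 := by
          rw [ENNReal.tsum_mul_left]
          gcongr
          exact tsum_int_inv_two_pow m
  have hnear : ∫⁻ x in cube c l, ∑' n : {n : ℤ // (2 : ℝ) ^ (-n) ≤ l},
      ‖multiplier (ψ n) g₁ x‖ₑ ^ 2 ≤
      2 * ENNReal.ofReal M ^ 2 * (volume (cube c (2 * l)) * bmoNorm f ^ 2) := by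
    calc ∫⁻ x in cube c l, ∑' n : {n : ℤ // (2 : ℝ) ^ (-n) ≤ l}, ‖multiplier (ψ n) g₁ x‖ₑ ^ 2
        ≤ ∫⁻ x, ∑' n, ‖multiplier (ψ n) g₁ x‖ₑ ^ 2 := by
          refine (setLIntegral_le_lintegral _ _).trans (lintegral_mono fun x => ?_)
          exact ENNReal.tsum_comp_le_tsum_of_injective Subtype.val_injective
            fun n => ‖multiplier (ψ n) g₁ x‖ₑ ^ 2
      _ ≤ 2 * ENNReal.ofReal M ^ 2 * ∫⁻ x, ‖g₁ x‖ₑ ^ 2 :=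
          h.lintegral_tsum_multiplier_sq_le (hf.integrable_indicator_sub b c _)
            (hf.memLp_indicator_sub b c _)
      _ = 2 * ENNReal.ofReal M ^ 2 * ∫⁻ x in cube c (2 * l), ‖f x - b‖ₑ ^ 2 := by
          rw [← lintegral_indicator (measurableSet_cube c _)]
          congr 2; ext x
          by_cases hx : x ∈ cube c (2 * l) <;> simp [hg₁, hx]
      _ ≤ _ := by
          gcongr
          exact bmoNorm_le_iff.1 (le_refl (bmoNorm f)) c _ (by positivity)
  have hvol : volume (cube c (2 * l)) = 2 ^ d * volume (cube c l) := by
    rw [volume_cube c _, volume_cube c _, ENNReal.ofReal_mul (by norm_num),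
      mul_pow]
    simp
  calc ∫⁻ x in cube c l, ∑' n : {n : ℤ // (2 : ℝ) ^ (-n) ≤ l}, ‖multiplier (ψ n) f x‖ₑ ^ 2
      ≤ ∫⁻ x in cube c l, 2 * ((∑' n : {n : ℤ // (2 : ℝ) ^ (-n) ≤ l},
          ‖multiplier (ψ n) g₁ x‖ₑ ^ 2) + C₀ * bmoNorm f ^ 2 * 4) := by
        refine setLIntegral_mono' (measurableSet_cube c l) fun x hx => ?_
        calc _ ≤ ∑' n : {n : ℤ // (2 : ℝ) ^ (-n) ≤ l}, 2 * (‖multiplier (ψ n) g₁ x‖ₑ ^ 2 +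
                ‖multiplier (ψ n) g₂ x‖ₑ ^ 2) := by
              refine ENNReal.tsum_le_tsum fun n => ?_
              rw [h.multiplier_eq_add hd n hf b c (2 * l) x]
              exact enorm_add_sq_le _ _
          _ ≤ _ := by
              rw [ENNReal.tsum_mul_left, ENNReal.tsum_add]
              gcongr
              exact hfar x hx
    _ = 2 * ((∫⁻ x in cube c l, ∑' n : {n : ℤ // (2 : ℝ) ^ (-n) ≤ l},
          ‖multiplier (ψ n) g₁ x‖ₑ ^ 2) + C₀ * bmoNorm f ^ 2 * 4 * volume (cube c l)) := by
        rw [lintegral_const_mul' _ _ (by norm_num), lintegral_add_right _ measurable_const,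
          setLIntegral_const]
    _ ≤ 2 * (2 * ENNReal.ofReal M ^ 2 * (2 ^ d * volume (cube c l) * bmoNorm f ^ 2) +
          C₀ * bmoNorm f ^ 2 * 4 * volume (cube c l)) := by
        rw [← hvol]; gcongr
    _ = volume (cube c l) * (A * bmoNorm f ^ 2) := by rw [hA]; ring
    _ ≤ volume (cube c l) * ((1 + A) * bmoNorm f) ^ 2 := by
        rw [mul_pow]
        gcongr
        calc A ≤ 1 + A := le_add_self
          _ ≤ (1 + A) ^ 2 := le_self_pow₀ le_self_add (by norm_num)

end UpperBound

/-! ### Smooth frequency cutoffs -/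

section LowPass

variable {d : ℕ}

/-- A smooth radial cutoff, equal to `1` on the unit ball and supported in the ball of radius
`2`. -/
noncomputable def cutoff (d : ℕ) : ContDiffBump (0 : EuclideanSpace ℝ (Fin d)) :=
  ⟨1, 2, one_pos, one_lt_two⟩

/-- The cutoff at frequency `2 ^ N`. -/
noncomputable def dyadicCutoff (N : ℤ) (ξ : EuclideanSpace ℝ (Fin d)) : ℂ :=
  (cutoff d (((2 : ℝ) ^ N)⁻¹ • ξ) : ℝ)

lemma norm_inv_zpow_smul (N : ℤ) (ξ : EuclideanSpace ℝ (Fin d)) :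
    ‖((2 : ℝ) ^ N)⁻¹ • ξ‖ = ‖ξ‖ / 2 ^ N := by
  rw [norm_smul, norm_inv, Real.norm_of_nonneg (by positivity), inv_mul_eq_div]

lemma dyadicCutoff_eq_one {N : ℤ} {ξ : EuclideanSpace ℝ (Fin d)} (h : ‖ξ‖ ≤ 2 ^ N) :
    dyadicCutoff N ξ = 1 := by
  unfold dyadicCutoff
  rw [(cutoff d).one_of_mem_closedBall, Complex.ofReal_one]
  rw [mem_closedBall_zero_iff, norm_inv_zpow_smul, div_le_iff₀ (by positivity)]
  change ‖ξ‖ ≤ 1 * _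
  linarith

lemma dyadicCutoff_eq_zero {N : ℤ} {ξ : EuclideanSpace ℝ (Fin d)} (h : 2 ^ (N + 1) ≤ ‖ξ‖) :
    dyadicCutoff N ξ = 0 := by
  unfold dyadicCutoff
  rw [(cutoff d).zero_of_le_dist, Complex.ofReal_zero]
  rw [dist_zero_right, norm_inv_zpow_smul, le_div_iff₀ (by positivity)]
  change 2 * _ ≤ _
  rw [zpow_add₀ (by norm_num), zpow_one] at h
  linarith

lemma norm_dyadicCutoff_le (N : ℤ) (ξ : EuclideanSpace ℝ (Fin d)) : ‖dyadicCutoff N ξ‖ ≤ 1 := by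
  unfold dyadicCutoff
  rw [Complex.norm_real, Real.norm_of_nonneg (cutoff d).nonneg]
  exact (cutoff d).le_one

lemma contDiff_dyadicCutoff (N : ℤ) :
    ContDiff ℝ (⊤ : ℕ∞) (dyadicCutoff N : EuclideanSpace ℝ (Fin d) → ℂ) := by
  unfold dyadicCutoff
  exact Complex.ofRealCLM.contDiff.comp ((cutoff d).contDiff.comp (by fun_prop))

lemma hasCompactSupport_dyadicCutoff (N : ℤ) :
    HasCompactSupport (dyadicCutoff N : EuclideanSpace ℝ (Fin d) → ℂ) := by
  refine HasCompactSupport.of_support_subset_isCompact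
    (isCompact_closedBall 0 ((2 : ℝ) ^ (N + 1))) fun ξ hξ => ?_
  by_contra hn
  refine hξ (dyadicCutoff_eq_zero ?_)
  rw [mem_closedBall_zero_iff, not_le] at hn
  exact hn.le

lemma integrable_dyadicCutoff (N : ℤ) :
    Integrable (dyadicCutoff N : EuclideanSpace ℝ (Fin d) → ℂ) :=
  (contDiff_dyadicCutoff N).continuous.integrable_of_hasCompactSupport
    (hasCompactSupport_dyadicCutoff N)

/-- The Fourier transform of the cutoff at frequency one, a Schwartz function. -/
noncomputable def cutoffKernel (d : ℕ) : 𝓢(EuclideanSpace ℝ (Fin d), ℂ) :=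
  𝓕 ((hasCompactSupport_dyadicCutoff 0).toSchwartzMap (contDiff_dyadicCutoff 0))

lemma fourier_dyadicCutoff (N : ℤ) (x : EuclideanSpace ℝ (Fin d)) :
    𝓕 (dyadicCutoff N) x = (((2 : ℝ) ^ N : ℝ) : ℂ) ^ d * cutoffKernel d ((2 : ℝ) ^ N • x) := by
  have e : cutoffKernel d ((2 : ℝ) ^ N • x) = 𝓕 (dyadicCutoff 0) ((2 : ℝ) ^ N • x) := rfl
  rw [e, Real.fourier_eq', Real.fourier_eq']
  have h := Measure.integral_comp_inv_smul_of_nonneg (volume : Measure (EuclideanSpace ℝ (Fin d)))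
    (fun v => Complex.exp (↑(-2 * Real.pi * inner ℝ v ((2 : ℝ) ^ N • x)) * Complex.I) •
      dyadicCutoff 0 v) (by positivity : (0 : ℝ) ≤ 2 ^ N)
  rw [finrank_euclideanSpace_fin, Complex.real_smul] at h
  push_cast at h ⊢
  rw [← h]
  congr 1
  ext v
  have h1 : inner ℝ (((2 : ℝ) ^ N)⁻¹ • v) ((2 : ℝ) ^ N • x) = inner ℝ v x := by
    rw [real_inner_smul_left, real_inner_smul_right, inv_mul_cancel_left₀ (by positivity)]
  rw [h1]
  simp [dyadicCutoff]

/-- The smooth restriction of `h` to the frequencies up to `2 ^ N`. -/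
noncomputable def lowPass (N : ℤ) (h : EuclideanSpace ℝ (Fin d) → ℂ) :
    EuclideanSpace ℝ (Fin d) → ℂ :=
  𝓕 fun ξ => dyadicCutoff N ξ * 𝓕⁻ h ξ

lemma lowPass_eq_integral (N : ℤ) {h : EuclideanSpace ℝ (Fin d) → ℂ} (hh : Integrable h)
    (x : EuclideanSpace ℝ (Fin d)) :
    lowPass N h x =
      ∫ y, ((((2 : ℝ) ^ N : ℝ) : ℂ) ^ d * cutoffKernel d ((2 : ℝ) ^ N • (x - y))) * h y := by
  rw [lowPass, ← integral_fourier_sub_mul (integrable_dyadicCutoff N) hh]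
  simp_rw [fourier_dyadicCutoff]

/-- A Schwartz function and its gradient are dominated by every decay profile. -/
lemma exists_schwartz_bound (Φ : 𝓢(EuclideanSpace ℝ (Fin d), ℂ)) (s : ℕ) :
    ∃ C : ℝ, 0 < C ∧ (∀ z, ‖Φ z‖ ≤ C * decay s 1 z) ∧ ∀ z, ‖fderiv ℝ Φ z‖ ≤ C * decay s 1 z := by
  set C := 2 ^ s * ((Finset.Iic (s, 1)).sup fun m => SchwartzMap.seminorm ℝ m.1 m.2) Φ with hC
  have hC0 : 0 ≤ C := by positivity
  have h := fun (n : ℕ) (hn : n ≤ 1) z =>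
    Φ.one_add_le_sup_seminorm_apply (𝕜 := ℝ) (m := (s, 1)) (k := s) (n := n) le_rfl hn z
  have hd : ∀ {a : ℝ} z, (1 + ‖z‖) ^ s * a ≤ C →
      a ≤ (C + 1) * decay s 1 (z : EuclideanSpace ℝ (Fin d)) := by
    intro a z ha
    unfold decay
    rw [div_one, le_mul_inv_iff₀ (by positivity), mul_comm]
    linarith
  refine ⟨C + 1, by positivity, fun z => hd z ?_, fun z => hd z ?_⟩
  · simpa using h 0 (by norm_num) z
  · have := h 1 le_rfl z
    rwa [← norm_iteratedFDeriv_fderiv, norm_iteratedFDeriv_zero] at this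

lemma decay_zpow_smul (s : ℕ) (N : ℤ) (z : EuclideanSpace ℝ (Fin d)) :
    decay s 1 ((2 : ℝ) ^ N • z) = decay s (2 ^ (-N)) z := by
  unfold decay
  rw [norm_smul, Real.norm_of_nonneg (by positivity), zpow_neg, div_inv_eq_mul, div_one, mul_comm]

/-- At low frequencies, the cancellation of `h` gains a factor from the size of its support. -/
lemma norm_lowPass_le_of_integral_eq_zero (d : ℕ) : ∃ C : ℝ, 0 < C ∧
    ∀ (h : EuclideanSpace ℝ (Fin d) → ℂ) (c : EuclideanSpace ℝ (Fin d)) (l : ℝ) (N : ℤ),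
      Integrable h → (∀ x ∉ cube c l, h x = 0) → ∫ x, h x = 0 → 0 < l → 2 ^ N * l ≤ 2 →
      ∀ x, ‖lowPass N h x‖ ≤ C * (((2 : ℝ) ^ N) ^ d * (2 ^ N * l) *
        decay (2 * order d) (2 ^ (-N)) (x - c)) * ∫ y, ‖h y‖ := by
  obtain ⟨C, hC0, -, hC⟩ := exists_schwartz_bound (cutoffKernel d) (2 * order d)
  refine ⟨C * (1 + d) ^ (2 * order d) * (d + 1), by positivity, ?_⟩
  intro h c l N hh hsupp hint hl hN x
  set R : ℝ := 2 ^ N with hR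
  have hR0 : 0 < R := by positivity
  set Φ := cutoffKernel d with hΦ
  have hbd : ∃ B, ∀ z, ‖Φ z‖ ≤ B := by
    obtain ⟨B, hB⟩ := Φ.decay 0 0
    exact ⟨B, fun z => by simpa using hB.2 z⟩
  obtain ⟨B, hB⟩ := hbd
  have hi : ∀ g : EuclideanSpace ℝ (Fin d) → EuclideanSpace ℝ (Fin d), Continuous g →
      Integrable fun y => ((R : ℂ) ^ d * Φ (g y)) * h y := by
    intro g hg
    refine hh.bdd_mul (c := R ^ d * B) ?_ (.of_forall fun y => ?_)
    · have := Φ.continuous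
      exact (by fun_prop : Continuous fun y => (R : ℂ) ^ d * Φ (g y)).aestronglyMeasurable
    · rw [norm_mul, norm_pow, Complex.norm_real, Real.norm_of_nonneg hR0.le]
      gcongr
      exact hB _
  -- Subtracting the value of the kernel at the centre does not change the integral.
  have e : lowPass N h x = ∫ y, ((R : ℂ) ^ d * (Φ (R • (x - y)) - Φ (R • (x - c)))) * h y := by
    rw [lowPass_eq_integral N hh, ← hR, ← hΦ]
    have h1 : ∫ y, ((R : ℂ) ^ d * Φ (R • (x - c))) * h y = 0 := by
      rw [integral_const_mul, hint, mul_zero]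
    simp_rw [mul_sub, sub_mul]
    rw [integral_sub (hi (fun y => R • (x - y)) (by fun_prop))
      (hi (fun _ => R • (x - c)) continuous_const), h1, sub_zero]
  rw [e, ← integral_const_mul]
  refine norm_integral_le_of_norm_le (hh.norm.const_mul _) (.of_forall fun y => ?_)
  by_cases hy : y ∈ cube c l
  swap
  · simp [hsupp y hy]
  rw [norm_mul, norm_mul, norm_pow, Complex.norm_real, Real.norm_of_nonneg hR0.le]
  refine mul_le_mul_of_nonneg_right ?_ (norm_nonneg _)
  have hyc := norm_sub_le_of_mem_cube hy
  have huv : ‖R • (x - y) - R • (x - c)‖ ≤ d * (R * l / 2) := by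
    rw [← smul_sub, norm_smul, Real.norm_of_nonneg hR0.le, sub_sub_sub_cancel_left, norm_sub_rev]
    calc R * ‖y - c‖ ≤ R * (d * (l / 2)) := by gcongr
      _ = _ := by ring
  have hd0 : (0 : ℝ) ≤ d := Nat.cast_nonneg d
  have huv' : ‖R • (x - y) - R • (x - c)‖ ≤ d := huv.trans (by nlinarith)
  have hmv : ‖Φ (R • (x - y)) - Φ (R • (x - c))‖ ≤
      (C * ((1 + d) ^ (2 * order d) * decay (2 * order d) 1 (R • (x - c)))) *
        ‖R • (x - y) - R • (x - c)‖ := by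
    refine (convex_segment (𝕜 := ℝ) (R • (x - c)) (R • (x - y))).norm_image_sub_le_of_norm_fderiv_le
      (𝕜 := ℝ) (fun z _ => Φ.differentiableAt) (fun z hz => ?_) (left_mem_segment _ _ _)
      (right_mem_segment _ _ _)
    refine (hC z).trans ?_
    gcongr
    refine decay_le_mul_decay one_pos one_pos ?_
    have h1 : ‖z - R • (x - c)‖ ≤ d := by
      refine le_trans ?_ huv'
      have := norm_sub_le_of_mem_segment hz
      exact this
    have h2 : ‖R • (x - c)‖ ≤ ‖z‖ + d := by
      calc ‖R • (x - c)‖ = ‖z - (z - R • (x - c))‖ := by congr 1; abel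
        _ ≤ ‖z‖ + ‖z - R • (x - c)‖ := norm_sub_le _ _
        _ ≤ _ := by gcongr
    rw [div_one, div_one]
    nlinarith [norm_nonneg z]
  rw [hR, decay_zpow_smul, ← hR] at hmv
  have hdec := (decay_pos (2 * order d) (by positivity : (0 : ℝ) < 2 ^ (-N)) (x - c)).le
  calc R ^ d * ‖Φ (R • (x - y)) - Φ (R • (x - c))‖
      ≤ R ^ d * ((C * ((1 + d) ^ (2 * order d) * decay (2 * order d) (2 ^ (-N)) (x - c))) *
          ((d + 1) * (R * l))) := by
        gcongr
        refine hmv.trans ?_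
        gcongr
        refine huv.trans ?_
        nlinarith [mul_pos hR0 hl]
    _ = _ := by ring

/-- Away from the support of `h`, the rapid decay of the kernel gains a negative power of the
frequency. -/
lemma norm_lowPass_le_of_notMem (d : ℕ) : ∃ C : ℝ, 0 < C ∧
    ∀ (h : EuclideanSpace ℝ (Fin d) → ℂ) (c : EuclideanSpace ℝ (Fin d)) (l : ℝ) (N : ℤ),
      Integrable h → (∀ x ∉ cube c l, h x = 0) → 0 < l →
      ∀ x ∉ cube c (2 * l), ‖lowPass N h x‖ ≤ C * (((2 : ℝ) ^ N) ^ d * (2 ^ N * l)⁻¹ *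
        decay (2 * order d) (2 ^ (-N)) (x - c)) * ∫ y, ‖h y‖ := by
  obtain ⟨C, hC0, hC, -⟩ := exists_schwartz_bound (cutoffKernel d) (2 * order d + 1)
  refine ⟨C * (1 + d) ^ (2 * order d) * 2, by positivity, ?_⟩
  intro h c l N hh hsupp hl x hx
  set R : ℝ := 2 ^ N with hR
  have hR0 : 0 < R := by positivity
  rw [lowPass_eq_integral N hh, ← hR, ← integral_const_mul]
  refine norm_integral_le_of_norm_le (hh.norm.const_mul _) (.of_forall fun y => ?_)
  by_cases hy : y ∈ cube c l
  swap
  · simp [hsupp y hy]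
  rw [norm_mul, norm_mul, norm_pow, Complex.norm_real, Real.norm_of_nonneg hR0.le]
  refine mul_le_mul_of_nonneg_right ?_ (norm_nonneg _)
  obtain ⟨h1, -⟩ := norm_sub_bounds_of_mem_of_notMem_cube hl hy hx
  rw [norm_sub_rev] at h1
  have h2 := norm_sub_le_of_mem_cube hy
  have h3 : ‖x - c‖ ≤ (1 + d) * ‖x - y‖ := by
    have : ‖x - c‖ ≤ ‖x - y‖ + ‖y - c‖ := by
      rw [← sub_add_sub_cancel x y c]; exact norm_add_le _ _
    nlinarith [(Nat.cast_nonneg d : (0 : ℝ) ≤ d)]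
  have hsplit : decay (2 * order d + 1) 1 (R • (x - y)) ≤
      (2 * (R * l)⁻¹) * ((1 + d) ^ (2 * order d) * decay (2 * order d) 1 (R • (x - c))) := by
    have e1 : decay (2 * order d + 1) 1 (R • (x - y)) =
        (1 + R * ‖x - y‖)⁻¹ * decay (2 * order d) 1 (R • (x - y)) := by
      unfold decay
      rw [pow_succ, mul_inv, norm_smul, Real.norm_of_nonneg hR0.le, div_one, mul_comm]
    rw [e1]
    gcongr
    · exact (decay_pos _ one_pos _).le
    · rw [← div_eq_mul_inv, le_div_iff₀ (by positivity), inv_mul_le_iff₀ (by positivity)]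
      nlinarith
    · refine decay_le_mul_decay one_pos one_pos ?_
      rw [norm_smul, norm_smul, Real.norm_of_nonneg hR0.le, div_one, div_one]
      nlinarith [mul_nonneg hR0.le (norm_nonneg (x - y)), (Nat.cast_nonneg d : (0 : ℝ) ≤ d)]
  rw [hR, decay_zpow_smul _ _ (x - c), ← hR] at hsplit
  calc R ^ d * ‖cutoffKernel d (R • (x - y))‖
      ≤ R ^ d * (C * ((2 * (R * l)⁻¹) * ((1 + d) ^ (2 * order d) *
          decay (2 * order d) (2 ^ (-N)) (x - c)))) := by
        gcongr
        exact (hC _).trans (by gcongr)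
    _ = _ := by ring

end LowPass

/-! ### Frequency bands and duality -/

section FrequencyLocalization

variable {d : ℕ} {f h : EuclideanSpace ℝ (Fin d) → ℂ} {c : EuclideanSpace ℝ (Fin d)} {l : ℝ}

lemma contDiff_fourierInv_of_support_subset_cube (hh : Integrable h)
    (hsupp : ∀ x ∉ cube c l, h x = 0) : ContDiff ℝ (⊤ : ℕ∞) (𝓕⁻ h) := by
  obtain ⟨B, hB⟩ := (isCompact_cube c l).isBounded.exists_norm_le
  have h1 : ContDiff ℝ (⊤ : ℕ∞) (𝓕 h) := by
    refine Real.contDiff_fourier fun n _ => ?_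
    refine (hh.norm.const_mul (B ^ n)).mono' ?_ (.of_forall fun x => ?_)
    · exact (by fun_prop : Continuous fun v : EuclideanSpace ℝ (Fin d) =>
        ‖v‖ ^ n).aestronglyMeasurable.mul hh.norm.1
    · by_cases hx : x ∈ cube c l
      · rw [Real.norm_of_nonneg (by positivity)]
        gcongr
        exact hB x hx
      · simp [hsupp x hx]
  have h2 : 𝓕⁻ h = fun x => 𝓕 h (-x) := by
    ext x; exact Real.fourierInv_eq_fourier_neg h x
  rw [h2]
  exact h1.comp contDiff_neg

/-- The low frequencies of a function with compact support have a Schwartz Fourier transform. -/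
lemma exists_schwartz_lowPass (hh : Integrable h) (hsupp : ∀ x ∉ cube c l, h x = 0) (N : ℤ) :
    ∃ S : 𝓢(EuclideanSpace ℝ (Fin d), ℂ), ∀ ξ, S ξ = dyadicCutoff N ξ * 𝓕⁻ h ξ :=
  ⟨((hasCompactSupport_dyadicCutoff N).mul_right).toSchwartzMap
    ((contDiff_dyadicCutoff N).mul (contDiff_fourierInv_of_support_subset_cube hh hsupp)),
    fun _ => rfl⟩

lemma lowPass_eq_schwartz (hh : Integrable h) (hsupp : ∀ x ∉ cube c l, h x = 0) (N : ℤ) :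
    ∃ S : 𝓢(EuclideanSpace ℝ (Fin d), ℂ), ∀ x, S x = lowPass N h x := by
  obtain ⟨S, hS⟩ := exists_schwartz_lowPass hh hsupp N
  refine ⟨𝓕 S, fun x => ?_⟩
  have : lowPass N h = 𝓕 (S : EuclideanSpace ℝ (Fin d) → ℂ) := by
    rw [lowPass]; congr 1; ext ξ; exact (hS ξ).symm
  rw [this]; rfl

/-- The part of `h` with frequencies between `2 ^ j` and `2 ^ (j + 2)`. -/
noncomputable def band (j : ℤ) (h : EuclideanSpace ℝ (Fin d) → ℂ)
    (x : EuclideanSpace ℝ (Fin d)) : ℂ :=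
  lowPass (j + 1) h x - lowPass j h x

lemma exists_schwartz_band (hh : Integrable h) (hsupp : ∀ x ∉ cube c l, h x = 0) (j : ℤ) :
    ∃ φ : 𝓢(EuclideanSpace ℝ (Fin d), ℂ),
      (∀ ξ, φ ξ = (dyadicCutoff (j + 1) ξ - dyadicCutoff j ξ) * 𝓕⁻ h ξ) ∧
      𝓕 (fun ξ => φ ξ) = band j h := by
  obtain ⟨S, hS⟩ := exists_schwartz_lowPass hh hsupp (j + 1)
  obtain ⟨T, hT⟩ := exists_schwartz_lowPass hh hsupp j
  refine ⟨S - T, fun ξ => by rw [sub_apply, hS, hT, sub_mul], ?_⟩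
  have e1 : lowPass (j + 1) h = 𝓕 (S : EuclideanSpace ℝ (Fin d) → ℂ) := by
    rw [lowPass]; congr 1; ext ξ; exact (hS ξ).symm
  have e2 : lowPass j h = 𝓕 (T : EuclideanSpace ℝ (Fin d) → ℂ) := by
    rw [lowPass]; congr 1; ext ξ; exact (hT ξ).symm
  have e3 : 𝓕 (S - T) = 𝓕 S - 𝓕 T := by
    rw [← SchwartzMap.fourierTransformCLM_apply ℂ, map_sub]; rfl
  ext x
  rw [band, e1, e2]
  have := congrArg (fun F : 𝓢(EuclideanSpace ℝ (Fin d), ℂ) => F x) e3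
  exact this

lemma two_zpow_lt_of_band_ne_zero {j : ℤ} {ξ : EuclideanSpace ℝ (Fin d)}
    (hne : (dyadicCutoff (j + 1) ξ - dyadicCutoff j ξ : ℂ) ≠ 0) :
    2 ^ j < ‖ξ‖ ∧ ‖ξ‖ < 2 ^ (j + 2) := by
  constructor
  · by_contra hle
    rw [not_lt] at hle
    have h1 : ‖ξ‖ ≤ 2 ^ (j + 1) := hle.trans (zpow_le_zpow_right₀ one_le_two (by omega))
    exact hne (by rw [dyadicCutoff_eq_one hle, dyadicCutoff_eq_one h1, sub_self])
  · by_contra hle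
    rw [not_lt] at hle
    have h1 : (2 : ℝ) ^ (j + 1) ≤ ‖ξ‖ := le_trans (zpow_le_zpow_right₀ one_le_two (by omega)) hle
    exact hne (by
      rw [dyadicCutoff_eq_zero h1, dyadicCutoff_eq_zero (by rwa [add_assoc]), sub_self])

lemma tsum_enorm_band_symbol_sq_le (ξ : EuclideanSpace ℝ (Fin d)) :
    ∑' j : ℤ, ‖(dyadicCutoff (j + 1) ξ - dyadicCutoff j ξ : ℂ)‖ₑ ^ 2 ≤ 8 := by
  rcases eq_or_ne ξ 0 with rfl | hξ
  · have : ∀ j : ℤ, (dyadicCutoff (j + 1) (0 : EuclideanSpace ℝ (Fin d)) -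
        dyadicCutoff j (0 : EuclideanSpace ℝ (Fin d)) : ℂ) = 0 := fun j => by
      by_contra hne
      have := (two_zpow_lt_of_band_ne_zero hne).1
      rw [norm_zero] at this
      exact absurd this (not_lt.2 (by positivity))
    simp [this]
  obtain ⟨m, hm1, hm2⟩ := exists_mem_Ico_zpow (norm_pos_iff.2 hξ) (one_lt_two (α := ℝ))
  have hz : ∀ j ∉ ({m, m - 1} : Finset ℤ),
      ‖(dyadicCutoff (j + 1) ξ - dyadicCutoff j ξ : ℂ)‖ₑ ^ 2 = 0 := by
    intro j hj
    have : (dyadicCutoff (j + 1) ξ - dyadicCutoff j ξ : ℂ) = 0 := by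
      by_contra hne
      obtain ⟨h1, h2⟩ := two_zpow_lt_of_band_ne_zero hne
      have h3 := (zpow_lt_zpow_iff_right₀ (one_lt_two (α := ℝ))).1 (h1.trans hm2)
      have h4 := (zpow_lt_zpow_iff_right₀ (one_lt_two (α := ℝ))).1 (hm1.trans_lt h2)
      simp only [Finset.mem_insert, Finset.mem_singleton, not_or] at hj
      omega
    simp [this]
  have hb : ∀ j : ℤ, ‖(dyadicCutoff (j + 1) ξ - dyadicCutoff j ξ : ℂ)‖ₑ ≤ 2 := fun j => by
    rw [← ofReal_norm]
    refine (ENNReal.ofReal_le_ofReal ((norm_sub_le _ _).trans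
      (add_le_add (norm_dyadicCutoff_le _ _) (norm_dyadicCutoff_le _ _)))).trans ?_
    norm_num
  rw [tsum_eq_sum hz, Finset.sum_pair (by omega)]
  calc _ ≤ (2 : ℝ≥0∞) ^ 2 + 2 ^ 2 := by gcongr <;> exact hb _
    _ = 8 := by norm_num

/-- At most two of the bands overlap at any frequency. -/
lemma tsum_lintegral_band_sq_le (hh : Integrable h) (hh2 : MemLp h 2)
    (hsupp : ∀ x ∉ cube c l, h x = 0) :
    ∑' j : ℤ, ∫⁻ x, ‖band j h x‖ₑ ^ 2 ≤ 8 * ∫⁻ x, ‖h x‖ₑ ^ 2 := by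
  have hFc := continuous_fourierInv hh
  calc ∑' j : ℤ, ∫⁻ x, ‖band j h x‖ₑ ^ 2
      = ∑' j : ℤ, ∫⁻ ξ, ‖(dyadicCutoff (j + 1) ξ - dyadicCutoff j ξ) * 𝓕⁻ h ξ‖ₑ ^ 2 := by
        congr 1; ext j
        obtain ⟨φ, hφ, hφb⟩ := exists_schwartz_band hh hsupp j
        simp_rw [← hφ]
        rw [← hφb, lintegral_enorm_fourier_sq φ.integrable (φ.memLp 2)]
    _ = ∫⁻ ξ, ∑' j : ℤ, ‖(dyadicCutoff (j + 1) ξ - dyadicCutoff j ξ) * 𝓕⁻ h ξ‖ₑ ^ 2 := by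
        refine (lintegral_tsum fun j => ?_).symm
        have h1 := (contDiff_dyadicCutoff (d := d) (j + 1)).continuous
        have h2 := (contDiff_dyadicCutoff (d := d) j).continuous
        exact (by fun_prop : Continuous fun ξ : EuclideanSpace ℝ (Fin d) =>
          (dyadicCutoff (j + 1) ξ - dyadicCutoff j ξ) * 𝓕⁻ h ξ
          ).aestronglyMeasurable.enorm.pow_const 2
    _ ≤ ∫⁻ ξ, 8 * ‖𝓕⁻ h ξ‖ₑ ^ 2 := by
        refine lintegral_mono fun ξ => ?_
        simp_rw [enorm_mul, mul_pow]
        rw [ENNReal.tsum_mul_right]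
        gcongr
        exact tsum_enorm_band_symbol_sq_le ξ
    _ = _ := by rw [lintegral_const_mul' _ _ (by norm_num), lintegral_enorm_fourierInv_sq hh hh2]

lemma MemWeighted.lintegral_mul_decay_lt_top (hf : MemWeighted f) :
    ∫⁻ x, ‖f x‖ₑ * ENNReal.ofReal (decay (2 * order d) 1 x) < ⊤ := by
  have h2 := lintegral_decay_le (succ_le_two_mul_order d) one_pos (0 : EuclideanSpace ℝ (Fin d))
  simp only [sub_zero] at h2
  calc ∫⁻ x, ‖f x‖ₑ * ENNReal.ofReal (decay (2 * order d) 1 x)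
      ≤ ∫⁻ x, (‖f x‖ₑ ^ 2 * ENNReal.ofReal (decay (2 * order d) 1 x) +
          ENNReal.ofReal (decay (2 * order d) 1 x)) := by
        refine lintegral_mono fun x => ?_
        rw [← add_one_mul]
        gcongr
        simpa using ennreal_mul_le_sq_add_sq ‖f x‖ₑ 1
    _ = weightedEnergy f + ∫⁻ x : EuclideanSpace ℝ (Fin d),
          ENNReal.ofReal (decay (2 * order d) 1 x) := by
        rw [lintegral_add_right _ (continuous_decay _ one_pos).measurable.ennreal_ofReal]
        rfl
    _ < ⊤ := ENNReal.add_lt_top.2 ⟨hf.weightedEnergy_lt_top, h2.trans_lt (by finiteness)⟩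

lemma MemWeighted.integrable_mul_schwartz (hf : MemWeighted f)
    (S : 𝓢(EuclideanSpace ℝ (Fin d), ℂ)) : Integrable fun x => f x * S x := by
  obtain ⟨C, hC0, hC, -⟩ := exists_schwartz_bound S (2 * order d)
  refine ⟨hf.1.mul S.continuous.aestronglyMeasurable, ?_⟩
  rw [hasFiniteIntegral_iff_enorm]
  calc ∫⁻ x, ‖f x * S x‖ₑ
      ≤ ∫⁻ x, ENNReal.ofReal C * (‖f x‖ₑ * ENNReal.ofReal (decay (2 * order d) 1 x)) := by
        refine lintegral_mono fun x => ?_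
        rw [enorm_mul, mul_left_comm, ← ENNReal.ofReal_mul hC0.le, ← ofReal_norm (S x)]
        gcongr
        exact hC x
    _ = ENNReal.ofReal C * ∫⁻ x, ‖f x‖ₑ * ENNReal.ofReal (decay (2 * order d) 1 x) :=
        lintegral_const_mul' _ _ (by finiteness)
    _ < ⊤ := ENNReal.mul_lt_top (by finiteness) hf.lintegral_mul_decay_lt_top

lemma MemWeighted.integrable_mul_lowPass (hf : MemWeighted f) (hh : Integrable h)
    (hsupp : ∀ x ∉ cube c l, h x = 0) (N : ℤ) : Integrable fun x => f x * lowPass N h x := by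
  obtain ⟨S, hS⟩ := lowPass_eq_schwartz hh hsupp N
  simp_rw [← hS]
  exact hf.integrable_mul_schwartz S

/-- The pairing of `f` with a frequency band of `h` only involves three of the pieces of `f`. -/
lemma integral_mul_band_eq {K M : ℝ} {ψ : ℤ → EuclideanSpace ℝ (Fin d) → ℂ} (hd : 1 ≤ d)
    (hψ : IsSymbolSystem d K M ψ) (hf : MemWeighted f) (hh : Integrable h)
    (hsupp : ∀ x ∉ cube c l, h x = 0) (j : ℤ) :
    ∫ x, f x * band j h x =
      ∑ i ∈ Finset.range 3, ∫ x, multiplier (ψ (j + i)) f x * band j h x := by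
  obtain ⟨φ, hφ, hφb⟩ := exists_schwartz_band hh hsupp j
  have hF := fun n => fourierEq_multiplier (hψ.integrable n) (hψ.kernelEnergy_lt_top hd n) hf φ
  rw [← hφb]
  have e1 : ∀ i ∈ Finset.range 3, ∫ x, multiplier (ψ (j + i)) f x * 𝓕 (fun ξ => φ ξ) x =
      ∫ x, f x * 𝓕 (fun ξ => ψ (j + i) ξ * φ ξ) x := fun i _ => (hF (j + i)).2.2.2
  rw [Finset.sum_congr rfl e1, ← integral_finsetSum (Finset.range 3)
    (f := fun (i : ℕ) x => f x * 𝓕 (fun ξ => ψ (j + i) ξ * φ ξ) x)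
    fun i _ => (hF (j + i)).2.2.1]
  have hsum : ∀ ξ, ∑ i ∈ Finset.range 3, ψ (j + i) ξ * φ ξ = φ ξ := by
    intro ξ
    by_cases h0 : φ ξ = 0
    · simp [h0]
    rw [hφ] at h0
    obtain ⟨h1, h2⟩ := two_zpow_lt_of_band_ne_zero (left_ne_zero_of_mul h0)
    have hξ : ξ ≠ 0 := by
      rintro rfl
      rw [norm_zero] at h1
      exact absurd h1 (not_lt.2 (by positivity))
    have hs := hψ.sum_eq_one ξ hξ
    have hfin : ∀ n ∉ (Finset.range 3).map ⟨fun i : ℕ => j + i, fun a b hab => by simpa using hab⟩,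
        ψ n ξ = 0 := by
      intro n hn
      by_contra hne
      obtain ⟨h3, h4⟩ := hψ.support_subset n hne
      have h5 := (zpow_lt_zpow_iff_right₀ (one_lt_two (α := ℝ))).1 (h1.trans h4)
      have h6 := (zpow_lt_zpow_iff_right₀ (one_lt_two (α := ℝ))).1 (h3.trans_lt h2)
      refine hn (Finset.mem_map.2 ⟨(n - j).toNat, ?_, ?_⟩)
      · rw [Finset.mem_range]; omega
      · change j + ((n - j).toNat : ℤ) = n
        omega
    have hs2 : 1 = ∑ i ∈ Finset.range 3, ψ (j + i) ξ :=
      (hs.unique (hasSum_sum_of_ne_finset_zero hfin)).trans (Finset.sum_map _ _ _)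
    rw [← Finset.sum_mul, ← hs2, one_mul]
  congr 1
  ext x
  rw [← Finset.mul_sum]
  congr 1
  rw [Real.fourier_eq']
  simp_rw [Real.fourier_eq']
  rw [← integral_finsetSum]
  · congr 1; ext ξ
    rw [← Finset.smul_sum, hsum]
  · intro i _
    simpa using integrable_exp_mul (hF (j + i)).1 x

lemma tendsto_dyadicCutoff (ξ : EuclideanSpace ℝ (Fin d)) :
    Filter.Tendsto (fun N : ℕ => (dyadicCutoff N ξ : ℂ)) Filter.atTop (nhds 1) := by
  obtain ⟨k, hk⟩ := pow_unbounded_of_one_lt ‖ξ‖ (one_lt_two (α := ℝ))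
  refine tendsto_const_nhds.congr' ?_
  filter_upwards [Filter.eventually_ge_atTop k] with N hN
  rw [dyadicCutoff_eq_one]
  rw [zpow_natCast]
  exact hk.le.trans (pow_le_pow_right₀ one_le_two hN)

/-- The frequency restrictions converge weakly against square integrable functions. -/
lemma tendsto_integral_mul_lowPass_of_memLp {u : EuclideanSpace ℝ (Fin d) → ℂ}
    (hu : Integrable u) (hu2 : MemLp u 2) (hh : Integrable h) (hh2 : MemLp h 2) :
    Filter.Tendsto (fun N : ℕ => ∫ x, u x * lowPass N h x) Filter.atTop
      (nhds (∫ x, u x * h x)) := by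
  have hc1 := continuous_fourier hu
  have hc2 := continuous_fourierInv hh
  have hint : ∀ N : ℤ, Integrable fun ξ => dyadicCutoff N ξ * 𝓕⁻ h ξ := by
    intro N
    refine (integrable_dyadicCutoff N).mul_bdd (c := ∫ x, ‖h x‖) hc2.aestronglyMeasurable
      (.of_forall fun ξ => ?_)
    rw [Real.fourierInv_eq_fourier_neg]
    exact VectorFourier.norm_fourierIntegral_le_integral_norm _ _ _ _ _
  have e1 : ∀ N : ℕ, ∫ x, u x * lowPass N h x =
      ∫ ξ, 𝓕 u ξ * (dyadicCutoff N ξ * 𝓕⁻ h ξ) := fun N => by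
    rw [integral_fourier_mul hu (hint N)]; rfl
  have e2 : ∫ x, u x * h x = ∫ ξ, 𝓕 u ξ * 𝓕⁻ h ξ := by
    have hw : Integrable fun x => starRingEnd ℂ (h x) :=
      (LinearIsometryEquiv.integrable_comp_iff Complex.conjLIE).2 hh
    have hw2 : MemLp (fun x => starRingEnd ℂ (h x)) 2 := hh2.star
    have := integral_conj_fourier_mul_fourier hw hw2 hu hu2
    simp_rw [← fourierInv_conj] at this
    simp only [Complex.conj_conj] at this
    simp_rw [mul_comm (u _), mul_comm (𝓕 u _)]
    exact this.symm
  rw [e2]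
  simp_rw [e1]
  refine tendsto_integral_of_dominated_convergence (fun ξ => ‖𝓕 u ξ * 𝓕⁻ h ξ‖) ?_ ?_ ?_ ?_
  · intro N
    have := (contDiff_dyadicCutoff (d := d) N).continuous
    exact (by fun_prop : Continuous fun ξ => 𝓕 u ξ * (dyadicCutoff N ξ * 𝓕⁻ h ξ)
      ).aestronglyMeasurable
  · exact ((memLp_fourier hu hu2).integrable_mul (memLp_fourierInv hh hh2)).norm
  · intro N
    refine .of_forall fun ξ => ?_
    rw [norm_mul, norm_mul, norm_mul]
    gcongr
    exact mul_le_of_le_one_left (norm_nonneg _) (norm_dyadicCutoff_le _ _)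
  · refine .of_forall fun ξ => ?_
    have := ((tendsto_dyadicCutoff ξ).mul_const (𝓕⁻ h ξ)).const_mul (𝓕 u ξ)
    simpa using this

end FrequencyLocalization

/-! ### The limits of high and low frequencies -/

section Limits

variable {d : ℕ} {f h : EuclideanSpace ℝ (Fin d) → ℂ} {c : EuclideanSpace ℝ (Fin d)} {l : ℝ}

lemma MemWeighted.integrable_norm_mul_decay (hf : MemWeighted f) :
    Integrable fun x => ‖f x‖ * decay (2 * order d) 1 x := by
  refine ⟨hf.1.norm.mul (continuous_decay _ one_pos).aestronglyMeasurable, ?_⟩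
  rw [hasFiniteIntegral_iff_enorm]
  refine lt_of_eq_of_lt (lintegral_congr fun x => ?_) hf.lintegral_mul_decay_lt_top
  rw [enorm_mul, enorm_norm, ← ofReal_norm (decay _ _ _),
    Real.norm_of_nonneg (decay_pos _ one_pos _).le]

/-- The frequency restrictions of `h` converge to `h` weakly against the weighted space. -/
lemma tendsto_integral_mul_lowPass_atTop (hf : MemWeighted f) (hh : Integrable h)
    (hh2 : MemLp h 2) (hl : 0 < l) (hsupp : ∀ x ∉ cube c l, h x = 0) :
    Filter.Tendsto (fun N : ℕ => ∫ x, f x * lowPass N h x) Filter.atTop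
      (nhds (∫ x, f x * h x)) := by
  set S := cube c (2 * l) with hS
  have hSm : MeasurableSet S := measurableSet_cube c _
  have hu : Integrable (S.indicator f) := by
    simpa using hf.integrable_indicator_sub 0 c (2 * l)
  have hu2 : MemLp (S.indicator f) 2 := by simpa using hf.memLp_indicator_sub 0 c (2 * l)
  have h1 := tendsto_integral_mul_lowPass_of_memLp hu hu2 hh hh2
  have e1 : ∫ x, S.indicator f x * h x = ∫ x, f x * h x := by
    congr 1; ext x
    by_cases hx : x ∈ S
    · rw [Set.indicator_of_mem hx]
    · rw [hsupp x fun hx' => hx (cube_mono c (by linarith) hx'), mul_zero, mul_zero]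
  have e2 : ∀ N : ℕ, ∫ x, f x * lowPass N h x =
      (∫ x, S.indicator f x * lowPass N h x) + ∫ x in Sᶜ, f x * lowPass N h x := by
    intro N
    rw [← integral_add_compl hSm (hf.integrable_mul_lowPass hh hsupp N), ← integral_indicator hSm]
    congr 2; ext x
    by_cases hx : x ∈ S <;> simp [hx]
  rw [e1] at h1
  simp_rw [e2]
  rw [← add_zero (∫ x, f x * h x)]
  refine h1.add ?_
  obtain ⟨C, hC0, hC⟩ := norm_lowPass_le_of_notMem d
  set G : EuclideanSpace ℝ (Fin d) → ℝ := fun x => ‖f x‖ * decay (2 * order d) 1 x with hG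
  have hGi : Integrable G := hf.integrable_norm_mul_decay
  set B : ℝ := (1 + ‖c‖) / l + 1 with hB
  set A : ℝ := C * (l⁻¹ * B ^ (2 * order d)) * ∫ y, ‖h y‖ with hA
  have hh0 : 0 ≤ ∫ y, ‖h y‖ := integral_nonneg fun y => norm_nonneg _
  -- Away from the support of `h` the restrictions decay rapidly and tend to zero.
  have hbound : ∀ N : ℕ, ‖∫ x in Sᶜ, f x * lowPass N h x‖ ≤ A * (1 / 2) ^ N * ∫ x in Sᶜ, G x := by
    intro N
    rw [← integral_const_mul]
    refine norm_integral_le_of_norm_le (hGi.integrableOn.const_mul _) ?_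
    refine (ae_restrict_iff' hSm.compl).2 (.of_forall fun x hx => ?_)
    have h2 := hC h c l N hh hsupp hl x hx
    have hlx : l ≤ ‖x - c‖ := by
      have := lt_norm_sub_of_notMem_cube hx
      linarith
    set R : ℝ := (2 : ℝ) ^ (N : ℤ) with hR
    have hR0 : 0 < R := by positivity
    have hR1 : 1 ≤ R := by rw [hR, zpow_natCast]; exact one_le_pow₀ one_le_two
    have hdec : decay (2 * order d) (2 ^ (-(N : ℤ))) (x - c) ≤
        (B / R) ^ (2 * order d) * decay (2 * order d) 1 x := by
      refine decay_le_mul_decay (by positivity) one_pos ?_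
      rw [zpow_neg, div_inv_eq_mul, div_one, ← hR]
      have h3 : 1 + ‖x‖ ≤ B * ‖x - c‖ := by
        have h4 : ‖x‖ ≤ ‖x - c‖ + ‖c‖ := by
          calc ‖x‖ = ‖(x - c) + c‖ := by rw [sub_add_cancel]
            _ ≤ _ := norm_add_le _ _
        have h5 : 1 + ‖c‖ ≤ (1 + ‖c‖) / l * ‖x - c‖ := by
          rw [div_mul_eq_mul_div, le_div_iff₀ hl]
          gcongr
        rw [hB]; linarith
      calc 1 + ‖x‖ ≤ B * ‖x - c‖ := h3
        _ = B / R * (‖x - c‖ * R) := by field_simp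
        _ ≤ B / R * (1 + ‖x - c‖ * R) := by
            gcongr
            linarith
    have hRa : R ^ d * (R * l)⁻¹ * (B / R) ^ (2 * order d) ≤
        (l⁻¹ * B ^ (2 * order d)) * (1 / 2) ^ N := by
      have e3 : (1 / 2 : ℝ) ^ N = R⁻¹ := by rw [hR, zpow_natCast, one_div, inv_pow]
      rw [e3, div_pow, mul_inv]
      have h6 : R ^ d ≤ R ^ (2 * order d) :=
        pow_le_pow_right₀ hR1 (by have := succ_le_two_mul_order d; omega)
      calc R ^ d * (R⁻¹ * l⁻¹) * (B ^ (2 * order d) / R ^ (2 * order d))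
          = (R ^ d / R ^ (2 * order d)) * ((l⁻¹ * B ^ (2 * order d)) * R⁻¹) := by ring
        _ ≤ 1 * ((l⁻¹ * B ^ (2 * order d)) * R⁻¹) := by
            gcongr
            rw [div_le_one (by positivity)]; exact h6
        _ = _ := one_mul _
    have hdec0 := (decay_pos (2 * order d) one_pos x).le
    rw [norm_mul]
    calc ‖f x‖ * ‖lowPass N h x‖
        ≤ ‖f x‖ * (C * (R ^ d * (R * l)⁻¹ *
            ((B / R) ^ (2 * order d) * decay (2 * order d) 1 x)) * ∫ y, ‖h y‖) := by
          gcongr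
          exact h2.trans (by gcongr)
      _ = (R ^ d * (R * l)⁻¹ * (B / R) ^ (2 * order d)) * (C * (∫ y, ‖h y‖) * G x) := by
          rw [hG]; ring
      _ ≤ ((l⁻¹ * B ^ (2 * order d)) * (1 / 2) ^ N) * (C * (∫ y, ‖h y‖) * G x) := by
          have : 0 ≤ G x := mul_nonneg (norm_nonneg _) hdec0
          gcongr
      _ = _ := by rw [hA]; ring
  refine squeeze_zero_norm hbound ?_
  have := ((tendsto_pow_atTop_nhds_zero_of_lt_one (by norm_num : (0 : ℝ) ≤ 1 / 2)
    (by norm_num)).const_mul A).mul_const (∫ x in Sᶜ, G x)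
  simpa using this

/-- The mean of `|f|` against the normalized decay profile of scale `R` is `o(R)` as `R → ∞` along
the powers of two. For even `d` the Cauchy–Schwarz inequality alone gives `O(R)`, and the
improvement comes from the factor `(1 + |x|) / (R + |x|)`, which tends to zero pointwise. -/
lemma MemWeighted.tendsto_lintegral_mul_decay (hf : MemWeighted f) :
    Filter.Tendsto (fun N : ℕ => ∫⁻ x, ‖f x‖ₑ *
      ENNReal.ofReal ((((2 : ℝ) ^ N) ^ (d + 1))⁻¹ * decay (2 * order d) (2 ^ N) x))
      Filter.atTop (nhds 0) := by
  obtain ⟨a', ha'⟩ : ∃ a', order d = a' + 1 := ⟨d / 2, rfl⟩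
  set p : ℕ → EuclideanSpace ℝ (Fin d) → ℝ := fun N x =>
    ((1 + ‖x‖) ^ a')⁻¹ * (2 ^ N + ‖x‖)⁻¹ with hp
  set q : ℕ → EuclideanSpace ℝ (Fin d) → ℝ := fun N x =>
    (((2 : ℝ) ^ N) ^ (d + 1))⁻¹ * (2 ^ N) ^ order d * decay (order d) (2 ^ N) x with hq
  have hp0 : ∀ N x, 0 ≤ p N x := fun N x => by positivity
  have hq0 : ∀ N x, 0 ≤ q N x := fun N x =>
    mul_nonneg (by positivity) (decay_pos _ (by positivity) _).le
  have hpc : ∀ N, Continuous (p N) := fun N => by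
    refine Continuous.mul (Continuous.inv₀ (by fun_prop) fun x => by positivity)
      (Continuous.inv₀ (by fun_prop) fun x => by positivity)
  have hqc : ∀ N, Continuous (q N) := fun N =>
    continuous_const.mul (continuous_decay _ (by positivity))
  have hR1 : ∀ N : ℕ, (1 : ℝ) ≤ 2 ^ N := fun N => one_le_pow₀ one_le_two
  have hpq : ∀ N x, (((2 : ℝ) ^ N) ^ (d + 1))⁻¹ * decay (2 * order d) (2 ^ N) x ≤
      p N x * q N x := by
    intro N x
    set R : ℝ := 2 ^ N with hR
    have hR0 : 0 < R := by positivity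
    have e1 : decay (2 * order d) R x = decay (order d) R x * decay (order d) R x := by
      unfold decay; rw [two_mul, pow_add, mul_inv]
    have e2 : decay (order d) R x ≤ p N x * R ^ order d := by
      have h1 : (1 + ‖x‖ / R) = (R + ‖x‖) / R := by field_simp
      simp only [decay, hp]
      rw [h1, div_pow, inv_div, ← hR, ha', pow_succ (R + ‖x‖)]
      have h2 : (1 + ‖x‖) ^ a' ≤ (R + ‖x‖) ^ a' := by gcongr; exact hR1 N
      rw [div_eq_inv_mul, mul_inv]
      gcongr
    have hdec := (decay_pos (order d) hR0 x).le
    rw [e1]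
    calc (R ^ (d + 1))⁻¹ * (decay (order d) R x * decay (order d) R x)
        ≤ (R ^ (d + 1))⁻¹ * ((p N x * R ^ order d) * decay (order d) R x) := by gcongr
      _ = _ := by simp only [hq]; ring
  have hQ : ∀ N, ∫⁻ x, ENNReal.ofReal (q N x) ^ 2 ≤ 4 ^ (2 * order d) * 2 := by
    intro N
    set R : ℝ := 2 ^ N with hR
    have hR0 : 0 < R := by positivity
    have e1 : ∀ x : EuclideanSpace ℝ (Fin d), ENNReal.ofReal (q N x) ^ 2 =
        ENNReal.ofReal (((R ^ (d + 1))⁻¹ * R ^ order d) ^ 2) *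
          ENNReal.ofReal (decay (2 * order d) R (x - 0)) := by
      intro x
      rw [← ENNReal.ofReal_pow (hq0 N x), ← ENNReal.ofReal_mul (by positivity)]
      congr 1
      simp only [hq, decay, sub_zero]
      rw [← hR, mul_pow _ (_⁻¹) 2, inv_pow _ 2, ← pow_mul (1 + ‖x‖ / R), mul_comm 2 (order d)]
    simp_rw [e1]
    rw [lintegral_const_mul' _ _ (by finiteness)]
    calc _ ≤ ENNReal.ofReal (((R ^ (d + 1))⁻¹ * R ^ order d) ^ 2) *
          (4 ^ (2 * order d) * 2 * ENNReal.ofReal R ^ d) := by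
          gcongr
          exact lintegral_decay_le (succ_le_two_mul_order d) hR0 0
      _ = (4 ^ (2 * order d) * 2) *
          ENNReal.ofReal (((R ^ (d + 1))⁻¹ * R ^ order d) ^ 2 * R ^ d) := by
          rw [ENNReal.ofReal_mul (by positivity), ENNReal.ofReal_pow (by positivity : 0 ≤ R)]
          ring
      _ ≤ (4 ^ (2 * order d) * 2) * 1 := by
          gcongr
          rw [ENNReal.ofReal_le_one]
          have : ((R ^ (d + 1))⁻¹ * R ^ order d) ^ 2 * R ^ d =
              R ^ (2 * order d + d) / R ^ (2 * d + 2) := by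
            clear_value R
            rw [inv_mul_eq_div, div_pow, div_mul_eq_mul_div]
            congr 1 <;> ring
          rw [this, div_le_one (by positivity)]
          exact pow_le_pow_right₀ (hR1 N) (by have := two_mul_order_le d; omega)
      _ = _ := mul_one _
  have hP : Filter.Tendsto (fun N : ℕ => ∫⁻ x, (‖f x‖ₑ * ENNReal.ofReal (p N x)) ^ 2)
      Filter.atTop (nhds 0) := by
    have h0 : ∫⁻ _x : EuclideanSpace ℝ (Fin d), (0 : ℝ≥0∞) = 0 := lintegral_zero
    rw [← h0]
    refine tendsto_lintegral_of_dominated_convergence'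
      (fun x => ‖f x‖ₑ ^ 2 * ENNReal.ofReal (decay (2 * order d) 1 x)) ?_ ?_ ?_ ?_
    · intro N
      exact (hf.1.enorm.mul (hpc N).measurable.ennreal_ofReal.aemeasurable).pow_const 2
    · intro N
      refine .of_forall fun x => ?_
      dsimp only
      rw [mul_pow, ← ENNReal.ofReal_pow (hp0 N x)]
      gcongr
      have : p N x ≤ decay (order d) 1 x := by
        simp only [hp, decay]
        rw [div_one, ha', pow_succ, mul_inv]
        gcongr
        exact hR1 N
      calc p N x ^ 2 ≤ decay (order d) 1 x ^ 2 := by gcongr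
        _ = decay (2 * order d) 1 x := by
            unfold decay; rw [inv_pow, ← pow_mul, mul_comm]
    · exact hf.weightedEnergy_lt_top.ne
    · refine .of_forall fun x => ?_
      have h1 : Filter.Tendsto (fun N : ℕ => p N x) Filter.atTop (nhds 0) := by
        have h2 : Filter.Tendsto (fun N : ℕ => ((2 : ℝ) ^ N + ‖x‖)⁻¹) Filter.atTop (nhds 0) :=
          tendsto_inv_atTop_zero.comp (Filter.tendsto_atTop_add_const_right _ _
            (tendsto_pow_atTop_atTop_of_one_lt one_lt_two))
        simpa using h2.const_mul ((1 + ‖x‖) ^ a')⁻¹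
      have h3 := ENNReal.tendsto_ofReal h1
      rw [ENNReal.ofReal_zero] at h3
      have h4 := ENNReal.Tendsto.pow (n := 2)
        (ENNReal.Tendsto.const_mul (a := ‖f x‖ₑ) h3 (Or.inr enorm_ne_top))
      simpa using h4
  have hsq : Filter.Tendsto (fun N : ℕ => (∫⁻ x, ‖f x‖ₑ *
      ENNReal.ofReal ((((2 : ℝ) ^ N) ^ (d + 1))⁻¹ * decay (2 * order d) (2 ^ N) x)) ^ 2)
      Filter.atTop (nhds 0) := by
    have h1 := ENNReal.Tendsto.mul_const (b := 4 ^ (2 * order d) * 2) hP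
      (Or.inr (by finiteness))
    rw [zero_mul] at h1
    refine tendsto_of_tendsto_of_tendsto_of_le_of_le tendsto_const_nhds h1
      (fun _ => zero_le) fun N => ?_
    calc _ ≤ (∫⁻ x, (‖f x‖ₑ * ENNReal.ofReal (p N x)) * ENNReal.ofReal (q N x)) ^ 2 := by
          refine pow_le_pow_left' (lintegral_mono fun x => ?_) 2
          rw [mul_assoc, ← ENNReal.ofReal_mul (hp0 N x)]
          exact mul_le_mul_right (ENNReal.ofReal_le_ofReal (hpq N x)) _
      _ ≤ (∫⁻ x, (‖f x‖ₑ * ENNReal.ofReal (p N x)) ^ 2) * ∫⁻ x, ENNReal.ofReal (q N x) ^ 2 :=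
          lintegral_mul_sq_le (hf.1.enorm.mul (hpc N).measurable.ennreal_ofReal.aemeasurable)
            (hqc N).measurable.ennreal_ofReal.aemeasurable
      _ ≤ _ := by gcongr; exact hQ N
  have hrt := ((ENNReal.continuous_rpow_const (y := (1 / 2 : ℝ))).tendsto 0).comp hsq
  rw [ENNReal.zero_rpow_of_pos (by norm_num)] at hrt
  refine hrt.congr fun N => ?_
  simp only [Function.comp_apply]
  rw [← ENNReal.rpow_natCast, ← ENNReal.rpow_mul]
  norm_num

/-- The low frequencies of a function with mean zero vanish weakly against the weighted space. -/
lemma tendsto_integral_mul_lowPass_neg (hf : MemWeighted f) (hh : Integrable h) (hl : 0 < l)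
    (hsupp : ∀ x ∉ cube c l, h x = 0) (hint : ∫ x, h x = 0) :
    Filter.Tendsto (fun N : ℕ => ∫ x, f x * lowPass (-N) h x) Filter.atTop (nhds 0) := by
  obtain ⟨C, hC0, hC⟩ := norm_lowPass_le_of_integral_eq_zero d
  have hh0 : 0 ≤ ∫ y, ‖h y‖ := integral_nonneg fun y => norm_nonneg _
  set A : ℝ := C * l * (1 + ‖c‖) ^ (2 * order d) * ∫ y, ‖h y‖ with hA
  have hA0 : 0 ≤ A := by positivity
  rw [tendsto_iff_edist_tendsto_0]
  have h1 := ENNReal.Tendsto.const_mul (a := ENNReal.ofReal A) hf.tendsto_lintegral_mul_decay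
    (Or.inr (by finiteness))
  rw [mul_zero] at h1
  refine tendsto_of_tendsto_of_tendsto_of_le_of_le' tendsto_const_nhds h1
    (.of_forall fun _ => zero_le) ?_
  obtain ⟨k, hk⟩ := pow_unbounded_of_one_lt (l / 2) (one_lt_two (α := ℝ))
  filter_upwards [Filter.eventually_ge_atTop k] with N hN
  rw [edist_zero_right, ← lintegral_const_mul' _ _ (by finiteness)]
  refine (enorm_integral_le_lintegral_enorm _).trans (lintegral_mono fun x => ?_)
  set R : ℝ := 2 ^ N with hR
  have hR0 : 0 < R := by positivity
  have hR1 : 1 ≤ R := one_le_pow₀ one_le_two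
  have hz : (2 : ℝ) ^ (-(N : ℤ)) = R⁻¹ := by rw [zpow_neg, zpow_natCast]
  have hz' : (2 : ℝ) ^ (-(-(N : ℤ))) = R := by rw [neg_neg, zpow_natCast]
  have hlR : R⁻¹ * l ≤ 2 := by
    rw [inv_mul_le_iff₀ hR0]
    have : (2 : ℝ) ^ k ≤ R := pow_le_pow_right₀ one_le_two hN
    linarith
  have h2 := hC h c l (-N) hh hsupp hint hl (by rw [hz]; exact hlR) x
  rw [hz, hz'] at h2
  have hdec : decay (2 * order d) R (x - c) ≤
      (1 + ‖c‖) ^ (2 * order d) * decay (2 * order d) R x := by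
    refine decay_le_mul_decay hR0 hR0 ?_
    have h4 : ‖x‖ ≤ ‖x - c‖ + ‖c‖ := by
      calc ‖x‖ = ‖(x - c) + c‖ := by rw [sub_add_cancel]
        _ ≤ _ := norm_add_le _ _
    have h5 : ‖x‖ / R ≤ ‖x - c‖ / R + ‖c‖ := by
      rw [div_le_iff₀ hR0, add_mul, div_mul_cancel₀ _ hR0.ne']
      nlinarith [norm_nonneg c]
    have h6 : 0 ≤ ‖c‖ * (‖x - c‖ / R) := by positivity
    linarith
  have hdec0 := (decay_pos (2 * order d) hR0 x).le
  dsimp only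
  rw [enorm_mul, mul_left_comm, ← ENNReal.ofReal_mul hA0]
  gcongr
  rw [← ofReal_norm]
  refine ENNReal.ofReal_le_ofReal (h2.trans ?_)
  calc C * (R⁻¹ ^ d * (R⁻¹ * l) * decay (2 * order d) R (x - c)) * ∫ y, ‖h y‖
      ≤ C * (R⁻¹ ^ d * (R⁻¹ * l) *
          ((1 + ‖c‖) ^ (2 * order d) * decay (2 * order d) R x)) * ∫ y, ‖h y‖ := by gcongr
    _ = _ := by rw [hA, ← inv_pow R, pow_succ]; ring

end Limits

/-! ### The bound of `‖f‖_BMO` by `‖f‖_D` -/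

section LowerBound

variable {d : ℕ}

lemma ennreal_mul_le_weighted_sq (a b : ℝ≥0∞) {t : ℝ≥0∞} (ht0 : t ≠ 0) (htt : t ≠ ⊤) :
    a * b ≤ t * a ^ 2 + t⁻¹ * b ^ 2 := by
  rcases le_total b (t * a) with h | h
  · calc a * b ≤ a * (t * a) := by gcongr
      _ = t * a ^ 2 := by ring
      _ ≤ _ := le_self_add
  · calc a * b = (t⁻¹ * (t * a)) * b := by
          rw [← mul_assoc, ENNReal.inv_mul_cancel ht0 htt, one_mul]
      _ ≤ (t⁻¹ * b) * b := by gcongr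
      _ = t⁻¹ * b ^ 2 := by ring
      _ ≤ _ := le_add_self

/-- The pairing of a function with quadratic means bounded on all large cubes with a function
dominated by a normalized decay profile. -/
lemma setLIntegral_mul_le_of_decay {F g : EuclideanSpace ℝ (Fin d) → ℂ}
    (hF : AEStronglyMeasurable F) {c : EuclideanSpace ℝ (Fin d)} {r : ℝ} (hr : 0 < r)
    {D : ℝ≥0∞}
    (hD : ∀ k : ℕ, ∫⁻ x in cube c (2 ^ k * r), ‖F x‖ₑ ^ 2 ≤ volume (cube c (2 ^ k * r)) * D ^ 2)
    {S : Set (EuclideanSpace ℝ (Fin d))} (hS : MeasurableSet S) {A H : ℝ} (hA : 0 ≤ A)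
    (hH : 0 ≤ H)
    (hg : ∀ x ∈ S, ‖g x‖ ≤ A * ((r⁻¹) ^ d * decay (2 * order d) r (x - c)) * H)
    {V U t : ℝ≥0∞} (hV0 : V ≠ 0) (hVt : V ≠ ⊤) (ht0 : t ≠ 0) (htt : t ≠ ⊤)
    (hHU : ENNReal.ofReal H ^ 2 ≤ V * U) :
    ∫⁻ x in S, ‖F x‖ₑ * ‖g x‖ₑ ≤
      ENNReal.ofReal A * (4 ^ (2 * order d) * 2) * (t * V * D ^ 2 + t⁻¹ * U) := by
  set w : EuclideanSpace ℝ (Fin d) → ℝ≥0∞ :=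
    fun x => ENNReal.ofReal (decay (2 * order d) r (x - c)) with hw
  have hwm : Measurable w := by
    have := continuous_decay (d := d) (2 * order d) hr
    exact (by fun_prop :
      Continuous fun x => decay (2 * order d) r (x - c)).measurable.ennreal_ofReal
  have h1 : ∫⁻ x, ‖F x‖ₑ ^ 2 * w x ≤ 4 ^ (2 * order d) * 2 * D ^ 2 * ENNReal.ofReal r ^ d := by
    have := lintegral_mul_decay_le (succ_le_two_mul_order d) hr c (hF.enorm.pow_const 2) (D ^ 2)
      (fun _ => 1) (fun k => by
        rw [mul_one, mul_comm (D ^ 2), ← volume_cube c _]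
        exact hD k)
    simpa [tsum_inv_two_pow] using this
  have h2 : ∫⁻ x, w x ≤ 4 ^ (2 * order d) * 2 * ENNReal.ofReal r ^ d :=
    lintegral_decay_le (succ_le_two_mul_order d) hr c
  have htV0 : t * V ≠ 0 := mul_ne_zero ht0 hV0
  have htVt : t * V ≠ ⊤ := ENNReal.mul_ne_top htt hVt
  have hinvt : (t * V)⁻¹ ≠ ⊤ := ENNReal.inv_ne_top.2 htV0
  have hUt : (t * V)⁻¹ * (V * U) = t⁻¹ * U := by
    rw [ENNReal.mul_inv (Or.inl ht0) (Or.inl htt), mul_assoc, ← mul_assoc V⁻¹,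
      ENNReal.inv_mul_cancel hV0 hVt, one_mul]
  calc ∫⁻ x in S, ‖F x‖ₑ * ‖g x‖ₑ
      ≤ ∫⁻ x in S, (ENNReal.ofReal A * ENNReal.ofReal (r⁻¹ ^ d)) *
          (t * V * (‖F x‖ₑ ^ 2 * w x) + (t * V)⁻¹ * ENNReal.ofReal H ^ 2 * w x) := by
        refine setLIntegral_mono' hS fun x hx => ?_
        have h3 : ‖g x‖ₑ ≤ ENNReal.ofReal A * (ENNReal.ofReal (r⁻¹ ^ d) * w x) *
            ENNReal.ofReal H := by
          rw [← ofReal_norm, hw, ← ENNReal.ofReal_mul (by positivity), ← ENNReal.ofReal_mul hA,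
            ← ENNReal.ofReal_mul' hH]
          exact ENNReal.ofReal_le_ofReal (hg x hx)
        calc ‖F x‖ₑ * ‖g x‖ₑ ≤ ‖F x‖ₑ * (ENNReal.ofReal A * (ENNReal.ofReal (r⁻¹ ^ d) * w x) *
              ENNReal.ofReal H) := by gcongr
          _ = (ENNReal.ofReal A * ENNReal.ofReal (r⁻¹ ^ d)) *
                (w x * (‖F x‖ₑ * ENNReal.ofReal H)) := by ring
          _ ≤ (ENNReal.ofReal A * ENNReal.ofReal (r⁻¹ ^ d)) *
                (w x * (t * V * ‖F x‖ₑ ^ 2 + (t * V)⁻¹ * ENNReal.ofReal H ^ 2)) := by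
              gcongr
              exact ennreal_mul_le_weighted_sq _ _ htV0 htVt
          _ = _ := by ring
    _ ≤ ∫⁻ x, (ENNReal.ofReal A * ENNReal.ofReal (r⁻¹ ^ d)) *
          (t * V * (‖F x‖ₑ ^ 2 * w x) + (t * V)⁻¹ * ENNReal.ofReal H ^ 2 * w x) :=
        setLIntegral_le_lintegral _ _
    _ = (ENNReal.ofReal A * ENNReal.ofReal (r⁻¹ ^ d)) *
          (t * V * (∫⁻ x, ‖F x‖ₑ ^ 2 * w x) +
            (t * V)⁻¹ * ENNReal.ofReal H ^ 2 * ∫⁻ x, w x) := by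
        rw [lintegral_const_mul' _ _ (by finiteness), lintegral_add_right _ (hwm.const_mul _),
          lintegral_const_mul' _ _ htVt, lintegral_const_mul' _ _ (by finiteness)]
    _ ≤ (ENNReal.ofReal A * ENNReal.ofReal (r⁻¹ ^ d)) *
          (t * V * (4 ^ (2 * order d) * 2 * D ^ 2 * ENNReal.ofReal r ^ d) +
            (t * V)⁻¹ * (V * U) * (4 ^ (2 * order d) * 2 * ENNReal.ofReal r ^ d)) := by
        gcongr
    _ = (ENNReal.ofReal (r⁻¹ ^ d) * ENNReal.ofReal r ^ d) * (ENNReal.ofReal A *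
          (4 ^ (2 * order d) * 2) * (t * V * D ^ 2 + t⁻¹ * U)) := by
        rw [hUt]; ring
    _ = _ := by
        rw [← ENNReal.ofReal_pow hr.le, ← ENNReal.ofReal_mul (by positivity), ← mul_pow,
          inv_mul_cancel₀ hr.ne', one_pow, ENNReal.ofReal_one, one_mul]

lemma dNorm_cube_le {ψ : ℤ → EuclideanSpace ℝ (Fin d) → ℂ} {f : EuclideanSpace ℝ (Fin d) → ℂ}
    {n : ℤ} {l : ℝ} (hn : (2 : ℝ) ^ (-n) ≤ l) (c : EuclideanSpace ℝ (Fin d)) :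
    ∫⁻ x in cube c l, ‖multiplier (ψ n) f x‖ₑ ^ 2 ≤ volume (cube c l) * dNorm ψ f ^ 2 := by
  have hl : 0 < l := lt_of_lt_of_le (by positivity) hn
  refine le_trans (lintegral_mono fun x => ?_) (dNorm_le_iff.1 (le_refl (dNorm ψ f)) c l hl)
  exact ENNReal.le_tsum (f := fun n : {n : ℤ // (2 : ℝ) ^ (-n) ≤ l} =>
    ‖multiplier (ψ n) f x‖ₑ ^ 2) ⟨n, hn⟩

lemma ofReal_le_two_mul_inv_two_pow {l : ℝ} {m : ℤ} (hm : 2 ^ m * l < 2) {j : ℤ} (hj : j ≤ m) :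
    ENNReal.ofReal (2 ^ j * l) ≤ 2 * 2⁻¹ ^ (j - m).natAbs := by
  obtain ⟨k, rfl⟩ := Int.le.dest hj
  have e : (j - (j + k) : ℤ).natAbs = k := by omega
  rw [e]
  rw [zpow_add₀ (by norm_num), zpow_natCast] at hm
  have h1 : (2 : ℝ) ^ j * l ≤ 2 * (2⁻¹) ^ k := by
    rw [inv_pow, ← div_eq_mul_inv, le_div_iff₀ (by positivity)]
    linarith
  refine (ENNReal.ofReal_le_ofReal h1).trans (le_of_eq ?_)
  rw [ENNReal.ofReal_mul (by norm_num), ENNReal.ofReal_pow (by norm_num),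
    ENNReal.ofReal_inv_of_pos (by norm_num)]
  simp

/-- Pointwise bounds for the frequency bands of a function of mean zero with support in a cube of
edge about `2 ^ (-m)`: everywhere if `j < m`, and away from the cube if `m ≤ j`. -/
lemma norm_band_le (d : ℕ) : ∃ C : ℝ, 0 < C ∧
    ∀ (h : EuclideanSpace ℝ (Fin d) → ℂ) (c : EuclideanSpace ℝ (Fin d)) (l : ℝ) (j : ℤ),
      Integrable h → (∀ x ∉ cube c l, h x = 0) → ∫ x, h x = 0 → 0 < l →
      (2 ^ (j + 1) * l ≤ 2 → ∀ x, ‖band j h x‖ ≤ C * (2 ^ j * l) *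
        (((2 : ℝ) ^ j) ^ d * decay (2 * order d) (2 ^ (-j)) (x - c)) * ∫ y, ‖h y‖) ∧
      ∀ x ∉ cube c (2 * l), ‖band j h x‖ ≤ C * (2 ^ j * l)⁻¹ *
        (((2 : ℝ) ^ j) ^ d * decay (2 * order d) (2 ^ (-j)) (x - c)) * ∫ y, ‖h y‖ := by
  obtain ⟨C₁, hC₁0, hC₁⟩ := norm_lowPass_le_of_integral_eq_zero d
  obtain ⟨C₂, hC₂0, hC₂⟩ := norm_lowPass_le_of_notMem d
  refine ⟨(C₁ + C₂) * (2 ^ d * 2 + 1), by positivity, ?_⟩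
  intro h c l j hh hsupp hint hl
  set H := ∫ y, ‖h y‖ with hH
  have hH0 : 0 ≤ H := integral_nonneg fun y => norm_nonneg _
  set R : ℝ := 2 ^ j with hR
  have hR0 : 0 < R := by positivity
  have hR2 : (2 : ℝ) ^ (j + 1) = 2 * R := by rw [zpow_add₀ (by norm_num), zpow_one, mul_comm]
  have hdec : ∀ x, decay (2 * order d) (2 ^ (-(j + 1))) (x - c) ≤
      decay (2 * order d) (2 ^ (-j)) (x - c) := by
    intro x
    have h1 := decay_le_mul_decay (s := 2 * order d) (A := 1)
      (by positivity : (0 : ℝ) < 2 ^ (-(j + 1))) (by positivity : (0 : ℝ) < 2 ^ (-j))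
      (z := x - c) (z' := x - c) (by
        rw [one_mul, zpow_neg, zpow_neg, hR2, ← hR, div_inv_eq_mul, div_inv_eq_mul]
        nlinarith [norm_nonneg (x - c)])
    simpa using h1
  have hdec0 : ∀ x, 0 ≤ decay (2 * order d) (2 ^ (-j)) (x - c) := fun x =>
    (decay_pos _ (by positivity) _).le
  constructor
  · intro hjl x
    have hP := hC₁ h c l (j + 1) hh hsupp hint hl hjl x
    have hQ := hC₁ h c l j hh hsupp hint hl (by
      rw [hR2] at hjl; rw [← hR]; nlinarith [mul_pos hR0 hl]) x
    rw [hR2, ← hH] at hP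
    rw [← hR, ← hH] at hQ
    set δ := decay (2 * order d) (2 ^ (-j)) (x - c) with hδ
    have hP' : ‖lowPass (j + 1) h x‖ ≤ C₁ * ((2 * R) ^ d * (2 * R * l) * δ) * H := by
      refine hP.trans ?_
      gcongr
      exact hdec x
    calc ‖band j h x‖ ≤ ‖lowPass (j + 1) h x‖ + ‖lowPass j h x‖ := norm_sub_le _ _
      _ ≤ C₁ * ((2 * R) ^ d * (2 * R * l) * δ) * H + C₁ * (R ^ d * (R * l) * δ) * H :=
          add_le_add hP' hQ
      _ = C₁ * (2 ^ d * 2 + 1) * (R * l) * (R ^ d * δ) * H := by rw [mul_pow]; ring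
      _ ≤ _ := by
          have := hdec0 x
          gcongr
          linarith
  · intro x hx
    have hP := hC₂ h c l (j + 1) hh hsupp hl x hx
    have hQ := hC₂ h c l j hh hsupp hl x hx
    rw [hR2, ← hH] at hP
    rw [← hR, ← hH] at hQ
    set δ := decay (2 * order d) (2 ^ (-j)) (x - c) with hδ
    have hP' : ‖lowPass (j + 1) h x‖ ≤ C₂ * ((2 * R) ^ d * (2 * R * l)⁻¹ * δ) * H := by
      refine hP.trans ?_
      gcongr
      exact hdec x
    calc ‖band j h x‖ ≤ ‖lowPass (j + 1) h x‖ + ‖lowPass j h x‖ := norm_sub_le _ _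
      _ ≤ C₂ * ((2 * R) ^ d * (2 * R * l)⁻¹ * δ) * H + C₂ * (R ^ d * (R * l)⁻¹ * δ) * H :=
          add_le_add hP' hQ
      _ = C₂ * (2 ^ d * 2⁻¹ + 1) * (R * l)⁻¹ * (R ^ d * δ) * H := by
          rw [mul_pow, mul_assoc 2 R l, mul_inv 2 (R * l)]; ring
      _ ≤ _ := by
          have := hdec0 x
          gcongr
          · linarith
          · norm_num

/-- The sum over all frequencies of the pairings of one shifted family of pieces of `f` with the
bands of `h`. -/
lemma tsum_lintegral_multiplier_mul_band_le (d : ℕ) : ∃ C : ℝ≥0,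
    ∀ (K M : ℝ) (ψ : ℤ → EuclideanSpace ℝ (Fin d) → ℂ), IsSymbolSystem d K M ψ →
    ∀ f : EuclideanSpace ℝ (Fin d) → ℂ, MemWeighted f →
    ∀ (h : EuclideanSpace ℝ (Fin d) → ℂ) (c : EuclideanSpace ℝ (Fin d)) (l : ℝ), 0 < l →
      Integrable h → MemLp h 2 → (∀ x ∉ cube c l, h x = 0) → ∫ x, h x = 0 →
    ∀ (i : ℕ) (t : ℝ≥0∞), t ≠ 0 → t ≠ ⊤ →
      ∑' j : ℤ, ∫⁻ x, ‖multiplier (ψ (j + i)) f x‖ₑ * ‖band j h x‖ₑ ≤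
        C * (t * (volume (cube c l) * dNorm ψ f ^ 2) + t⁻¹ * ∫⁻ x, ‖h x‖ₑ ^ 2) := by
  obtain ⟨C₀, hC₀0, hC₀⟩ := norm_band_le d
  set C₁ : ℝ≥0∞ := ENNReal.ofReal C₀ * 2 * (4 ^ (2 * order d) * 2) with hC₁
  have hC₁t : C₁ ≠ ⊤ := by finiteness
  refine ⟨(2 ^ d + 8 + 4 * C₁).toNNReal, ?_⟩
  rw [ENNReal.coe_toNNReal (by finiteness)]
  intro K M ψ hψ f hf h c l hl hh hh2 hsupp hint i t ht0 htt
  set V := volume (cube c l) with hV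
  set U := ∫⁻ x, ‖h x‖ₑ ^ 2 with hU
  set D := dNorm ψ f with hD
  have hV0 : V ≠ 0 := volume_cube_ne_zero c hl
  have hVt : V ≠ ⊤ := volume_cube_ne_top c _
  set H := ∫ y, ‖h y‖ with hH
  have hH0 : 0 ≤ H := integral_nonneg fun y => norm_nonneg _
  have hHU : ENNReal.ofReal H ^ 2 ≤ V * U := by
    rw [hH, ofReal_integral_norm_eq_lintegral_enorm hh]
    have e1 : ∫⁻ x, ‖h x‖ₑ = ∫⁻ x, (cube c l).indicator 1 x * ‖h x‖ₑ := by
      congr 1; ext x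
      by_cases hx : x ∈ cube c l
      · simp [hx]
      · simp [hsupp x hx]
    rw [e1]
    refine (lintegral_mul_sq_le (Measurable.aemeasurable (measurable_one.indicator
      (measurableSet_cube c l))) hh.1.enorm).trans (le_of_eq ?_)
    congr 1
    rw [hV, ← lintegral_indicator_one (measurableSet_cube c l)]
    congr 1; ext x
    by_cases hx : x ∈ cube c l <;> simp [hx]
  obtain ⟨m, hm1, hm2⟩ := exists_int_two_zpow hl
  set S := cube c (2 * l) with hS
  have hSm : MeasurableSet S := measurableSet_cube c _
  have hVS : volume S = 2 ^ d * V := by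
    rw [hS, hV, volume_cube c _, volume_cube c _,
      ENNReal.ofReal_mul (by norm_num), mul_pow]
    simp
  have hmeas : ∀ n, AEStronglyMeasurable (multiplier (ψ n) f) := fun n =>
    aestronglyMeasurable_multiplier (hψ.integrable n) hf.1
  have hDk : ∀ (j : ℤ) (k : ℕ), ∫⁻ x in cube c (2 ^ k * 2 ^ (-j)),
      ‖multiplier (ψ (j + i)) f x‖ₑ ^ 2 ≤ volume (cube c (2 ^ k * 2 ^ (-j))) * D ^ 2 := by
    intro j k
    refine dNorm_cube_le ?_ c
    calc (2 : ℝ) ^ (-(j + i)) ≤ 2 ^ (-j) := zpow_le_zpow_right₀ one_le_two (by omega)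
      _ ≤ 2 ^ k * 2 ^ (-j) := le_mul_of_one_le_left (by positivity) (one_le_pow₀ one_le_two)
  set near : ℤ → ℝ≥0∞ := fun j =>
    if m ≤ j then ∫⁻ x in S, ‖multiplier (ψ (j + i)) f x‖ₑ ^ 2 else 0 with hnear
  set E := t * V * D ^ 2 + t⁻¹ * U with hE
  have hterm : ∀ j : ℤ, ∫⁻ x, ‖multiplier (ψ (j + i)) f x‖ₑ * ‖band j h x‖ₑ ≤
      t * near j + t⁻¹ * (∫⁻ x, ‖band j h x‖ₑ ^ 2) + C₁ * 2⁻¹ ^ (j - m).natAbs * E := by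
    intro j
    have hr : (0 : ℝ) < 2 ^ (-j) := by positivity
    have hrinv : ((2 : ℝ) ^ (-j))⁻¹ = 2 ^ j := by rw [zpow_neg, inv_inv]
    obtain ⟨hlow, hhigh⟩ := hC₀ h c l j hh hsupp hint hl
    rw [← hrinv] at hlow hhigh
    -- At wavelengths up to about the edge of the cube, the doubled cube is split off; at longer
    -- wavelengths the cancellation of `h` gives decay on the whole space.
    rcases le_or_gt m j with hmj | hjm
    · have hfar : ∫⁻ x in Sᶜ, ‖multiplier (ψ (j + i)) f x‖ₑ * ‖band j h x‖ₑ ≤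
          C₁ * 2⁻¹ ^ (j - m).natAbs * E := by
        refine (setLIntegral_mul_le_of_decay (hmeas _) hr (hDk j) hSm.compl (by positivity) hH0
          (fun x hx => hhigh x hx) hV0 hVt ht0 htt hHU).trans ?_
        rw [hrinv, ENNReal.ofReal_mul hC₀0.le, hC₁]
        calc _ ≤ ENNReal.ofReal C₀ * 2⁻¹ ^ (j - m).natAbs * (4 ^ (2 * order d) * 2) * E := by
              gcongr
              exact ofReal_inv_le_inv_two_pow hm1 hmj
          _ ≤ 2 * (ENNReal.ofReal C₀ * 2⁻¹ ^ (j - m).natAbs * (4 ^ (2 * order d) * 2) * E) :=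
              le_mul_of_one_le_left' (by norm_num)
          _ = _ := by ring
      have hnr : ∫⁻ x in S, ‖multiplier (ψ (j + i)) f x‖ₑ * ‖band j h x‖ₑ ≤
          t * near j + t⁻¹ * ∫⁻ x, ‖band j h x‖ₑ ^ 2 := by
        calc _ ≤ ∫⁻ x in S, (t * ‖multiplier (ψ (j + i)) f x‖ₑ ^ 2 +
                t⁻¹ * ‖band j h x‖ₑ ^ 2) :=
              lintegral_mono fun x => ennreal_mul_le_weighted_sq _ _ ht0 htt
          _ = t * (∫⁻ x in S, ‖multiplier (ψ (j + i)) f x‖ₑ ^ 2) +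
                t⁻¹ * ∫⁻ x in S, ‖band j h x‖ₑ ^ 2 := by
              rw [lintegral_add_left', lintegral_const_mul' _ _ htt,
                lintegral_const_mul' _ _ (ENNReal.inv_ne_top.2 ht0)]
              exact ((hmeas _).restrict.enorm.pow_const 2).const_mul t
          _ ≤ _ := by
              simp only [hnear, if_pos hmj]
              gcongr
              exact Measure.restrict_le_self
      rw [← lintegral_add_compl _ hSm]
      exact add_le_add hnr hfar
    · have hjl : (2 : ℝ) ^ (j + 1) * l ≤ 2 := by
        refine le_trans ?_ hm2.le
        gcongr
        · norm_num
        · omega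
      have hfar : ∫⁻ x in Set.univ, ‖multiplier (ψ (j + i)) f x‖ₑ * ‖band j h x‖ₑ ≤
          C₁ * 2⁻¹ ^ (j - m).natAbs * E := by
        refine (setLIntegral_mul_le_of_decay (hmeas _) hr (hDk j) MeasurableSet.univ
          (by positivity) hH0 (fun x _ => hlow hjl x) hV0 hVt ht0 htt hHU).trans ?_
        rw [hrinv, ENNReal.ofReal_mul hC₀0.le, hC₁]
        calc _ ≤ ENNReal.ofReal C₀ * (2 * 2⁻¹ ^ (j - m).natAbs) * (4 ^ (2 * order d) * 2) * E := by
              gcongr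
              exact ofReal_le_two_mul_inv_two_pow hm2 hjm.le
          _ = _ := by ring
      rw [Measure.restrict_univ] at hfar
      exact hfar.trans le_add_self
  have hnear_sum : ∑' j : ℤ, near j ≤ 2 ^ d * V * D ^ 2 := by
    calc ∑' j : ℤ, near j
        ≤ ∑' j : ℤ, ∫⁻ x in S, (if (2 : ℝ) ^ (-(j + i)) ≤ 2 * l then
            ‖multiplier (ψ (j + i)) f x‖ₑ ^ 2 else 0) := by
          refine ENNReal.tsum_le_tsum fun j => ?_
          simp only [hnear]
          split_ifs with hmj hj
          · exact le_rfl
          · refine absurd ?_ hj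
            calc (2 : ℝ) ^ (-(j + i)) ≤ 2 ^ (-m) := zpow_le_zpow_right₀ one_le_two (by omega)
              _ ≤ l := by
                  rw [zpow_neg, inv_le_iff_one_le_mul₀' (by positivity)]; exact hm1
              _ ≤ 2 * l := by linarith
          all_goals exact zero_le
      _ = ∫⁻ x in S, ∑' j : ℤ, (if (2 : ℝ) ^ (-(j + i)) ≤ 2 * l then
            ‖multiplier (ψ (j + i)) f x‖ₑ ^ 2 else 0) := by
          refine (lintegral_tsum fun j => ?_).symm
          split_ifs
          · exact (hmeas _).restrict.enorm.pow_const 2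
          · exact aemeasurable_const
      _ = ∫⁻ x in S, ∑' n : {n : ℤ // (2 : ℝ) ^ (-n) ≤ 2 * l},
            ‖multiplier (ψ n) f x‖ₑ ^ 2 := by
          congr 1; ext x
          refine ((Equiv.addRight (i : ℤ)).tsum_eq (fun n : ℤ => if (2 : ℝ) ^ (-n) ≤ 2 * l then
            ‖multiplier (ψ n) f x‖ₑ ^ 2 else 0)).trans ?_
          refine Eq.trans ?_ (tsum_subtype {n : ℤ | (2 : ℝ) ^ (-n) ≤ 2 * l}
            fun n => ‖multiplier (ψ n) f x‖ₑ ^ 2).symm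
          congr 1
      _ ≤ volume S * D ^ 2 :=
          dNorm_le_iff.1 (le_refl (dNorm ψ f)) c (2 * l) (by positivity)
      _ = _ := by rw [hVS]
  calc ∑' j : ℤ, ∫⁻ x, ‖multiplier (ψ (j + i)) f x‖ₑ * ‖band j h x‖ₑ
      ≤ ∑' j : ℤ, (t * near j + t⁻¹ * (∫⁻ x, ‖band j h x‖ₑ ^ 2) +
          C₁ * 2⁻¹ ^ (j - m).natAbs * E) := ENNReal.tsum_le_tsum hterm
    _ = t * (∑' j : ℤ, near j) + t⁻¹ * (∑' j : ℤ, ∫⁻ x, ‖band j h x‖ₑ ^ 2) +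
          C₁ * (∑' j : ℤ, 2⁻¹ ^ (j - m).natAbs) * E := by
        rw [ENNReal.tsum_add, ENNReal.tsum_add, ENNReal.tsum_mul_left, ENNReal.tsum_mul_left,
          ENNReal.tsum_mul_right, ENNReal.tsum_mul_left]
    _ ≤ t * (2 ^ d * V * D ^ 2) + t⁻¹ * (8 * U) + C₁ * 4 * E := by
        gcongr
        · exact tsum_lintegral_band_sq_le hh hh2 hsupp
        · exact tsum_int_inv_two_pow m
    _ = (2 ^ d + 4 * C₁) * (t * (V * D ^ 2)) + (8 + 4 * C₁) * (t⁻¹ * U) := by rw [hE]; ring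
    _ ≤ (2 ^ d + 8 + 4 * C₁) * (t * (V * D ^ 2)) + (2 ^ d + 8 + 4 * C₁) * (t⁻¹ * U) := by
        gcongr
        · exact le_self_add
        · exact le_add_self
    _ = _ := by ring

/-- Calderón's reproducing formula in weak form: `f` pairs with functions of mean zero and compact
support as the sum of its frequency bands does. -/
lemma enorm_integral_mul_le_tsum {K M : ℝ} (hd : 1 ≤ d)
    {ψ : ℤ → EuclideanSpace ℝ (Fin d) → ℂ} (hψ : IsSymbolSystem d K M ψ)
    {f h : EuclideanSpace ℝ (Fin d) → ℂ} (hf : MemWeighted f) {c : EuclideanSpace ℝ (Fin d)}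
    {l : ℝ} (hl : 0 < l) (hh : Integrable h) (hh2 : MemLp h 2) (hsupp : ∀ x ∉ cube c l, h x = 0)
    (hint : ∫ x, h x = 0) :
    ‖∫ x, f x * h x‖ₑ ≤ ∑ i ∈ Finset.range 3,
      ∑' j : ℤ, ∫⁻ x, ‖multiplier (ψ (j + i)) f x‖ₑ * ‖band j h x‖ₑ := by
  have hlim := (tendsto_integral_mul_lowPass_atTop hf hh hh2 hl hsupp).sub
    (tendsto_integral_mul_lowPass_neg hf hh hl hsupp hint)
  rw [sub_zero] at hlim
  refine le_of_tendsto (hlim.enorm) (.of_forall fun N => ?_)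
  have hI := fun n => hf.integrable_mul_lowPass hh hsupp n
  have htel : (∫ x, f x * lowPass N h x) - ∫ x, f x * lowPass (-N) h x =
      ∑ k ∈ Finset.range (2 * N), ∫ x, f x * band (k - N) h x := by
    have := Finset.sum_range_sub (fun k : ℕ => ∫ x, f x * lowPass (k - N) h x) (2 * N)
    have e1 : ((2 * N : ℕ) : ℤ) - N = N := by omega
    have e2 : ((0 : ℕ) : ℤ) - N = -N := by omega
    rw [e1, e2] at this
    rw [← this]
    refine Finset.sum_congr rfl fun k _ => ?_
    have e3 : ((k + 1 : ℕ) : ℤ) - N = (k - N) + 1 := by omega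
    rw [e3, ← integral_sub (hI _) (hI _)]
    congr 1; ext x
    rw [band]; ring
  rw [htel]
  calc _ ≤ ∑ k ∈ Finset.range (2 * N), ‖∫ x, f x * band (k - N) h x‖ₑ := enorm_sum_le _ _
    _ ≤ ∑ k ∈ Finset.range (2 * N), ∑ i ∈ Finset.range 3,
          ∫⁻ x, ‖multiplier (ψ ((k - N : ℤ) + i)) f x‖ₑ * ‖band (k - N) h x‖ₑ := by
        refine Finset.sum_le_sum fun k _ => ?_
        rw [integral_mul_band_eq hd hψ hf hh hsupp]
        refine (enorm_sum_le _ _).trans (Finset.sum_le_sum fun i _ => ?_)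
        refine (enorm_integral_le_lintegral_enorm _).trans (le_of_eq ?_)
        simp_rw [enorm_mul]
    _ = ∑ i ∈ Finset.range 3, ∑ k ∈ Finset.range (2 * N),
          ∫⁻ x, ‖multiplier (ψ ((k - N : ℤ) + i)) f x‖ₑ * ‖band (k - N) h x‖ₑ :=
        Finset.sum_comm
    _ ≤ _ := by
        refine Finset.sum_le_sum fun i _ => ?_
        refine (ENNReal.sum_le_tsum _).trans ?_
        exact ENNReal.tsum_comp_le_tsum_of_injective (f := fun k : ℕ => (k - N : ℤ))
          (fun a b hab => by simpa using hab)
          fun j : ℤ => ∫⁻ x, ‖multiplier (ψ (j + i)) f x‖ₑ * ‖band j h x‖ₑ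

/-- The oscillation of `f` on a cube is estimated by duality. The constant does not depend on `K`
and `M`, because only the supports of the symbols and their sum enter quantitatively. -/
theorem bmoNorm_le_mul_dNorm (d : ℕ) (hd : 1 ≤ d) : ∃ C : ℝ≥0, 0 < C ∧
    ∀ (K M : ℝ) (ψ : ℤ → EuclideanSpace ℝ (Fin d) → ℂ), IsSymbolSystem d K M ψ →
    ∀ f : EuclideanSpace ℝ (Fin d) → ℂ, MemWeighted f → bmoNorm f ≤ C * dNorm ψ f := by
  obtain ⟨C₀, hC₀⟩ := tsum_lintegral_multiplier_mul_band_le d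
  -- With this weight in the arithmetic-geometric mean inequality the oscillation on the right
  -- hand side has a coefficient of at most one half.
  set t : ℝ≥0∞ := 6 * C₀ + 1 with ht
  have ht0 : t ≠ 0 := by positivity
  have htt : t ≠ ⊤ := by finiteness
  set A : ℝ≥0∞ := 6 * C₀ * t with hA
  have hAt : A ≠ ⊤ := by finiteness
  refine ⟨(1 + A).toNNReal, ?_, ?_⟩
  · refine ENNReal.toNNReal_pos ?_ (by finiteness)
    exact (add_pos_of_pos_of_nonneg one_pos zero_le).ne'
  intro K M ψ hψ f hf
  rw [ENNReal.coe_toNNReal (by finiteness), bmoNorm_le_iff]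
  intro c l hl
  set b := ⨍ y in cube c l, f y with hb
  -- Pairing `f` with the conjugate of its oscillation recovers the square of the oscillation.
  set u := (cube c l).indicator fun x => f x - b with hu
  set h : EuclideanSpace ℝ (Fin d) → ℂ := fun x => starRingEnd ℂ (u x) with hh
  have hui : Integrable u := hf.integrable_indicator_sub b c l
  have hu2 : MemLp u 2 := hf.memLp_indicator_sub b c l
  have hhi : Integrable h := (LinearIsometryEquiv.integrable_comp_iff Complex.conjLIE).2 hui
  have hh2 : MemLp h 2 := hu2.star
  have hsupp : ∀ x ∉ cube c l, h x = 0 := fun x hx => by simp [hh, hu, hx]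
  have hint : ∫ x, h x = 0 := by
    have hu0 : ∫ x, u x = 0 := by
      have := isFiniteMeasure_restrict_cube c l
      rw [hu, integral_indicator (measurableSet_cube c l)]
      exact integral_sub_average _ f
    rw [hh, integral_conj, hu0, map_zero]
  set U := ∫⁻ x, ‖h x‖ₑ ^ 2 with hU
  have hUt : U < ⊤ := lintegral_enorm_sq_lt_top hh2
  have hUeq : ∫⁻ x in cube c l, ‖f x - b‖ₑ ^ 2 = U := by
    rw [hU, ← lintegral_indicator (measurableSet_cube c l)]
    congr 1; ext x
    by_cases hx : x ∈ cube c l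
    · simp only [hh, hu, Set.indicator_of_mem hx, RCLike.enorm_conj]
    · simp [hh, hu, hx]
  have hpair : ‖∫ x, f x * h x‖ₑ = U := by
    have e1 : ∀ x, f x * h x = ((‖h x‖ ^ 2 : ℝ) : ℂ) + b * h x := by
      intro x
      by_cases hx : x ∈ cube c l
      · have h1 : f x = u x + b := by simp [hu, hx]
        have h2 : u x * h x = ((‖h x‖ ^ 2 : ℝ) : ℂ) := by
          simp only [hh]
          rw [Complex.mul_conj, RCLike.norm_conj, Complex.normSq_eq_norm_sq]
        rw [h1, add_mul, h2]
      · simp [hsupp x hx]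
    have hsq : Integrable fun x => ‖h x‖ ^ 2 := hh2.integrable_norm_pow (by norm_num)
    simp_rw [e1]
    rw [integral_add (f := fun x => ((‖h x‖ ^ 2 : ℝ) : ℂ)) hsq.ofReal (hhi.const_mul b),
      integral_const_mul, hint, mul_zero, add_zero,
      integral_complex_ofReal, ← ofReal_norm, Complex.norm_real,
      Real.norm_of_nonneg (integral_nonneg fun x => by positivity),
      ofReal_integral_eq_lintegral_ofReal hsq (.of_forall fun x => by positivity), hU]
    congr 1; ext x
    rw [ENNReal.ofReal_pow (norm_nonneg _), ofReal_norm]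
  have hmain : U ≤ 3 * (C₀ * (t * (volume (cube c l) * dNorm ψ f ^ 2) + t⁻¹ * U)) := by
    calc U = ‖∫ x, f x * h x‖ₑ := hpair.symm
      _ ≤ _ := enorm_integral_mul_le_tsum hd hψ hf hl hhi hh2 hsupp hint
      _ ≤ ∑ _i ∈ Finset.range 3,
            C₀ * (t * (volume (cube c l) * dNorm ψ f ^ 2) + t⁻¹ * U) :=
          Finset.sum_le_sum fun i _ => hC₀ K M ψ hψ f hf h c l hl hhi hh2 hsupp hint i t ht0 htt
      _ = _ := by rw [Finset.sum_const, Finset.card_range, nsmul_eq_mul]; norm_num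
  rw [hUeq]
  have habs : 2 * U ≤ A * (volume (cube c l) * dNorm ψ f ^ 2) + U := by
    calc 2 * U ≤ 2 * (3 * (C₀ * (t * (volume (cube c l) * dNorm ψ f ^ 2) + t⁻¹ * U))) := by gcongr
      _ = A * (volume (cube c l) * dNorm ψ f ^ 2) + (6 * C₀ * t⁻¹) * U := by rw [hA]; ring
      _ ≤ A * (volume (cube c l) * dNorm ψ f ^ 2) + 1 * U := by
          gcongr
          rw [← div_eq_mul_inv]
          exact ENNReal.div_le_of_le_mul (by rw [one_mul, ht]; exact le_self_add)
      _ = _ := by rw [one_mul]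
  rw [two_mul, ENNReal.add_le_add_iff_right hUt.ne] at habs
  calc U ≤ A * (volume (cube c l) * dNorm ψ f ^ 2) := habs
    _ = volume (cube c l) * (A * dNorm ψ f ^ 2) := by ring
    _ ≤ volume (cube c l) * ((1 + A) * dNorm ψ f) ^ 2 := by
        rw [mul_pow]
        gcongr
        calc A ≤ 1 + A := le_add_self
          _ ≤ (1 + A) ^ 2 := le_self_pow₀ le_self_add (by norm_num)

end LowerBound

end LittlewoodPaleyBMO

theorem theorem2 (d : ℕ) (hd : 1 ≤ d) (K M : ℝ) :
    (∀ f : EuclideanSpace ℝ (Fin d) → ℂ, LocallyIntegrable f →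
      LittlewoodPaleyBMO.bmoNorm f < ⊤ → LittlewoodPaleyBMO.MemWeighted f) ∧
    ∃ C₁ C₂ : ℝ≥0, 0 < C₁ ∧ 0 < C₂ ∧
      ∀ ψ : ℤ → EuclideanSpace ℝ (Fin d) → ℂ, LittlewoodPaleyBMO.IsSymbolSystem d K M ψ →
      ∀ f : EuclideanSpace ℝ (Fin d) → ℂ, LittlewoodPaleyBMO.MemWeighted f →
        (∀ n, LittlewoodPaleyBMO.FourierEq (ψ n) f (LittlewoodPaleyBMO.multiplier (ψ n) f)) ∧
        C₁ * LittlewoodPaleyBMO.dNorm ψ f ≤ LittlewoodPaleyBMO.bmoNorm f ∧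
        LittlewoodPaleyBMO.bmoNorm f ≤ C₂ * LittlewoodPaleyBMO.dNorm ψ f := by
  refine ⟨fun f hf hB => LittlewoodPaleyBMO.memWeighted_of_bmoNorm_lt_top hf hB, ?_⟩
  obtain ⟨C, hC⟩ := LittlewoodPaleyBMO.dNorm_le_mul_bmoNorm d hd K M
  obtain ⟨C₂, hC₂0, hC₂⟩ := LittlewoodPaleyBMO.bmoNorm_le_mul_dNorm d hd
  refine ⟨(C + 1)⁻¹, C₂, by positivity, hC₂0, fun ψ hψ f hf =>
    ⟨fun n => LittlewoodPaleyBMO.fourierEq_multiplier (hψ.integrable n)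
      (hψ.kernelEnergy_lt_top hd n) hf, ?_, hC₂ K M ψ hψ f hf⟩⟩
  rw [ENNReal.coe_inv (by positivity), ENNReal.inv_mul_le_iff (by simp) (by finiteness)]
  calc LittlewoodPaleyBMO.dNorm ψ f ≤ C * LittlewoodPaleyBMO.bmoNorm f := hC ψ hψ f hf
    _ ≤ (C + 1 : ℝ≥0) * LittlewoodPaleyBMO.bmoNorm f := by
        gcongr
        exact le_self_add
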